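/- Throughout, $\log$ is the natural logarithm, $h(x)=-x\log x$ (with $h(0)=0$), $a\land b=\min\{a,b\}$, and for a distribution $p=(p_1,\dots,p_k)$ on $[k]=\{1,\dots,k\}$ we write $H(p)=\sum_{i} h(p_i)$ for its Shannon entropy and $S_p$ for the number of $i$ with $p_i>0$. For an integer $m\ge 1$ let $\hat H^E(X^m)=\sum_i h(M_i/m)$ be the empirical estimator, where $M_i$ is the number of occurrences of $i$ in an i.i.d. sample $X^m\sim p$, and let $L(\hat H^E,p,m)=\mathbb E|\hat H^E(X^m)-H(p)|$. **The estimator $\hat H$.** Fix constants $c_l,c_s>0$, an integer $n$ and $\varepsilon\le 1$ with $\varepsilon\log n\ge 1$. Put $a=\varepsilon\log n$, $d=\lfloor c_s\log n\rfloor$, $r=n/(c_l\log n)$. Let $\sum_{j=0}^d b_jx^j$ be the polynomial of degree at most $d$ that best approximates $h$ uniformly on $[0,1]$, and let $$\tilde h_1(x)=\sum_{j=0}^d b_j r^{\,j-1}x^j+(\log r)\,x,$$ $$\tilde h_{na}(x)=-\log\frac{na-1}{na}+(na-1)\Big(\tilde h_1\big(x+\tfrac1{na-1}\big)-\tilde h_1(x)\Big),\qquad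 \tilde H_{na}(x)=\int_0^x\tilde h_{na}(t)\,dt=\sum_{t=1}^d b_t'x^t .$$ (This is for $d\ge1$.) For $N\in\mathbb N$ let $\hat H_{na}(N)=\sum_{t=1}^d b_t'\,N(N-1)\cdots(N-t+1)/n^t$. Let $N,N'$ be independent Poisson variables with mean $n$, let $X^N$ and $X^{N'}$ be independent sequences of $N$ and $N'$ i.i.d. draws from $p$, and let $N_i,N_i'$ be the numbers of occurrences of $i$ in them. Then $$\hat H(X^N,X^{N'})=\sum_{i\in[k]}\Big(\hat H_{na}(N_i)\,\mathbf 1_{N_i\le c_l\log n}\,\mathbf 1_{N_i'\le\varepsilon^{-1}}+h\big(\tfrac{N_i}{n}\big)\mathbf 1_{N_i'>\varepsilon^{-1}}\Big),\qquad L(\hat H,p,n)=\mathbb E\big|\hat H(X^N,X^{N'})-H(p)\big|.$$ **Theorem.** For all sufficiently large constants $c_l$ and all sufficiently small constants $c_s>0$ there are constants $c$ and $n_0$, depending only on $c_l$ and $c_s$, such that for all $n\ge n_0$, all $\varepsilon\le 1$ with $\varepsilon\log n\ge1$, all $k$ and all distributions $p$ on $[k]$, the error $\hat H-H(p)$ is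 integrable and $$L(\hat H,p,n)\le L(\hat H^E,p,\varepsilon n\log n)+(1+c\,\varepsilon)\land\Big(\frac{S_p}{\varepsilon n}+\frac1{n^{0.49}}\Big),$$ where the sample size $\varepsilon n\log n$ of the empirical estimator may be rounded to an integer either up or down. -/

import Mathlib

open MeasureTheory ProbabilityTheory Polynomial

namespace EntropyAmp

noncomputable section

/-! ### Shannon entropy, samples and the empirical estimator -/

/-- Shannon entropy `H(p) = ∑ i, -p_i log p_i` (natural logarithm) of a distribution on `k` symbols. -/
def entropy {k : ℕ} (p : PMF (Fin k)) : ℝ := ∑ i, Real.negMulLog (p i).toReal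

/-- The support size `S_p`, the number of symbols of positive probability. -/
def supportSize {k : ℕ} (p : PMF (Fin k)) : ℕ := p.support.ncard

/-- The number of times the symbol `i` appears in the sequence `x`. -/
def count {k m : ℕ} (x : Fin m → Fin k) (i : Fin k) : ℕ :=
  (Finset.univ.filter fun j => x j = i).card

/-- The law of a sequence of `m` independent draws from `p`. -/
def iidLaw {k : ℕ} (p : PMF (Fin k)) (m : ℕ) : Measure (Fin m → Fin k) :=
  Measure.pi fun _ => p.toMeasure

/-- The empirical (plug-in) entropy estimator. -/
def empiricalEntropy {k m : ℕ} (x : Fin m → Fin k) : ℝ :=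
  ∑ i, Real.negMulLog ((count x i : ℝ) / (m : ℝ))

/-- The mean absolute error of the empirical entropy estimator with `m` samples. -/
def empiricalLoss {k : ℕ} (p : PMF (Fin k)) (m : ℕ) : ℝ :=
  ∫ x, |empiricalEntropy x - entropy p| ∂(iidLaw p m)

/-! ### Poisson sampling -/

/-- Sequences of symbols of arbitrary finite length. -/
abbrev Sample (k : ℕ) : Type := Σ m : ℕ, (Fin m → Fin k)

/-- The law of `X^N`, where `N` is Poisson with mean `n` and, given `N = m`, the sequence `X^N`
consists of `m` independent draws from `p`. -/
def poissonSampleLaw {k : ℕ} (p : PMF (Fin k)) (n : ℕ) : Measure (Sample k) :=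
  Measure.sum fun m : ℕ =>
    poissonMeasure (n : NNReal) {m} • (iidLaw p m).map fun x => (⟨m, x⟩ : Sample k)

instance {k : ℕ} (p : PMF (Fin k)) (m : ℕ) : IsProbabilityMeasure (iidLaw p m) := by
  unfold iidLaw; infer_instance

theorem measurable_sigmaMk {k : ℕ} (m : ℕ) :
    Measurable fun x : Fin m → Fin k => (⟨m, x⟩ : Sample k) :=
  measurable_iff_le_map.2 (iInf_le (fun a => MeasurableSpace.map
    (fun x : Fin a → Fin k => (⟨a, x⟩ : Sample k)) inferInstance) m)

instance {k : ℕ} (p : PMF (Fin k)) (n : ℕ) : IsProbabilityMeasure (poissonSampleLaw p n) := by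
  constructor
  have h : ∀ m : ℕ, ((iidLaw p m).map fun x => (⟨m, x⟩ : Sample k)) Set.univ = 1 := fun m => by
    rw [Measure.map_apply (measurable_sigmaMk m) MeasurableSet.univ]; simp
  rw [poissonSampleLaw, Measure.sum_apply _ MeasurableSet.univ]
  simp only [Measure.smul_apply, h, smul_eq_mul, mul_one]
  have := Measure.tsum_indicator_apply_singleton (poissonMeasure (n : NNReal)) Set.univ
    MeasurableSet.univ
  simpa using this

/-! ### The min-max polynomial of `h(x) = -x log x` -/

/-- `q` has degree at most `d` and `sup_{[0,1]} |h - q| ≤ sup_{[0,1]} |h - r|` for every polynomial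
`r` of degree at most `d`, where `h(x) = -x log x`. -/
def IsMinMaxPoly (d : ℕ) (q : ℝ[X]) : Prop :=
  q.natDegree ≤ d ∧ ∀ r : ℝ[X], r.natDegree ≤ d → ∀ C : ℝ,
    (∀ x ∈ Set.Icc (0 : ℝ) 1, |Real.negMulLog x - r.eval x| ≤ C) →
      ∀ x ∈ Set.Icc (0 : ℝ) 1, |Real.negMulLog x - q.eval x| ≤ C

theorem exists_isMinMaxPoly (d : ℕ) : ∃ q : ℝ[X], IsMinMaxPoly d q := by
  let Φ : ℝ[X] →ₗ[ℝ] C(Set.Icc (0 : ℝ) 1, ℝ) :=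
    (Polynomial.toContinuousMapOnAlgHom (Set.Icc (0 : ℝ) 1)).toLinearMap
  let V : Submodule ℝ C(Set.Icc (0 : ℝ) 1, ℝ) := (Polynomial.degreeLE ℝ (d : WithBot ℕ)).map Φ
  let f : C(Set.Icc (0 : ℝ) 1, ℝ) :=
    ⟨fun x => Real.negMulLog x, Real.continuous_negMulLog.comp continuous_subtype_val⟩
  have : FiniteDimensional ℝ (Polynomial.degreeLE ℝ (d : WithBot ℕ)) := by
    rw [← Polynomial.degreeLT_succ_eq_degreeLE]
    exact Module.Finite.equiv (Polynomial.degreeLTEquiv ℝ (d + 1)).symm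
  have : FiniteDimensional ℝ V := inferInstance
  have : ProperSpace V := FiniteDimensional.proper ℝ V
  have hc : Continuous fun v : V => ‖f - (v : C(Set.Icc (0 : ℝ) 1, ℝ))‖ := by fun_prop
  have ht : Filter.Tendsto (fun v : V => ‖f - (v : C(Set.Icc (0 : ℝ) 1, ℝ))‖)
      (Filter.cocompact V) Filter.atTop := by
    refine Filter.tendsto_atTop_mono (f := fun v : V => ‖v‖ - ‖f‖) (fun v => ?_)
      (Filter.tendsto_atTop_add_const_right _ _ (tendsto_norm_cocompact_atTop (E := V)))
    have := norm_sub_norm_le (v : C(Set.Icc (0 : ℝ) 1, ℝ)) f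
    rw [norm_sub_rev] at this
    simpa using this
  obtain ⟨v, hv⟩ := hc.exists_forall_le ht
  obtain ⟨q, hq, hqv⟩ := (Submodule.mem_map).1 v.2
  refine ⟨q, Polynomial.natDegree_le_iff_degree_le.2 (Polynomial.mem_degreeLE.1 hq), ?_⟩
  intro r hr C hC x hx
  have hrV : Φ r ∈ V := Submodule.mem_map_of_mem
    (Polynomial.mem_degreeLE.2 (Polynomial.natDegree_le_iff_degree_le.1 hr))
  have h1 : ‖f - (v : C(Set.Icc (0 : ℝ) 1, ℝ))‖ ≤ ‖f - Φ r‖ := hv ⟨Φ r, hrV⟩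
  have hC0 : 0 ≤ C := (abs_nonneg _).trans (hC x hx)
  have h2 : ‖f - Φ r‖ ≤ C := (ContinuousMap.norm_le _ hC0).2 fun y => hC y.1 y.2
  have h3 := (f - (v : C(Set.Icc (0 : ℝ) 1, ℝ))).norm_coe_le_norm ⟨x, hx⟩
  rw [← hqv] at h1 h3
  exact h3.trans (h1.trans h2)

/-- The degree-`d` min-max polynomial `∑ j, b_j x^j` of `h(x) = -x log x` over `[0,1]`. -/
def minMaxPoly (d : ℕ) : ℝ[X] := Classical.choose (exists_isMinMaxPoly d)

theorem isMinMaxPoly_minMaxPoly (d : ℕ) : IsMinMaxPoly d (minMaxPoly d) :=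
  Classical.choose_spec (exists_isMinMaxPoly d)

/-! ### The polynomial approximation of the Bernstein polynomial

In the following `n` is the sample size parameter, `ε` the accuracy parameter, and `cl`, `cs` are the
constants that fix the threshold `cl * log n` and the degree `cs * log n`. -/

/-- The degree `d = cs * log n`, rounded down. -/
def degree (cs : ℝ) (n : ℕ) : ℕ := ⌊cs * Real.log n⌋₊

/-- The amplified sample size `na = ε n log n`, a real number. -/
def ampSize (ε : ℝ) (n : ℕ) : ℝ := ε * n * Real.log n

/-- The min-max polynomial of `h` over `[0, 1/r]`, with `r = n / (cl * log n)`, obtained from the one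
over `[0,1]` by the change of variables `∑ j, b_j r^(j-1) x^j + (log r) x`. -/
def scaledPoly (cl cs : ℝ) (n : ℕ) : ℝ[X] :=
  let r : ℝ := n / (cl * Real.log n)
  C r⁻¹ * (minMaxPoly (degree cs n)).comp (C r * X) + C (Real.log r) * X

/-- The polynomial
`-log ((na-1)/na) + (na-1) * (q (x + 1/(na-1)) - q x)` where `q = scaledPoly cl cs n`. -/
def derivPoly (cl cs ε : ℝ) (n : ℕ) : ℝ[X] :=
  let A : ℝ := ampSize ε n
  let q : ℝ[X] := scaledPoly cl cs n
  C (-Real.log ((A - 1) / A)) + C (A - 1) * (q.comp (X + C (A - 1)⁻¹) - q)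

/-- The coefficient of `x^t`, `t ≥ 1`, in `∫ s in 0..x, derivPoly s`. -/
def primitiveCoeff (cl cs ε : ℝ) (n t : ℕ) : ℝ :=
  (derivPoly cl cs ε n).coeff (t - 1) / t

/-! ### The estimator -/

/-- The estimator `∑ t = 1..d, b'_t N^{\underline t} / n^t` of the primitive at `p_i`, where
`N^{\underline t}` is the falling factorial. -/
def smallEstimator (cl cs ε : ℝ) (n N : ℕ) : ℝ :=
  ∑ t ∈ Finset.Icc 1 (degree cs n),
    primitiveCoeff cl cs ε n t * ((N.descFactorial t : ℝ) / (n : ℝ) ^ t)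

open Classical in
/-- The estimate of `h(p_i)` from the counts `N`, `N'` of the symbol `i` in the two samples. -/
def symbolEstimator (cl cs ε : ℝ) (n N N' : ℕ) : ℝ :=
  (if (N : ℝ) ≤ cl * Real.log n ∧ (N' : ℝ) ≤ ε⁻¹ then smallEstimator cl cs ε n N else 0)
    + (if ε⁻¹ < (N' : ℝ) then Real.negMulLog ((N : ℝ) / (n : ℝ)) else 0)

/-- The entropy estimator `Ĥ(X^N, X^{N'})`. -/
def entropyEstimator {k : ℕ} (cl cs ε : ℝ) (n : ℕ) (z : Sample k × Sample k) : ℝ :=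
  ∑ i, symbolEstimator cl cs ε n (count z.1.2 i) (count z.2.2 i)

/-- The joint law of `X^N` and `X^{N'}`: two independent Poisson samples with mean length `n`. -/
def pairLaw {k : ℕ} (p : PMF (Fin k)) (n : ℕ) : Measure (Sample k × Sample k) :=
  (poissonSampleLaw p n).prod (poissonSampleLaw p n)

/-- The mean absolute error `E |Ĥ(X^N, X^{N'}) - H(p)|`. -/
def estimatorLoss {k : ℕ} (cl cs ε : ℝ) (p : PMF (Fin k)) (n : ℕ) : ℝ :=
  ∫ z, |entropyEstimator cl cs ε n z - entropy p| ∂(pairLaw p n)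

theorem natDegree_scaledPoly_le (cl cs : ℝ) (n : ℕ) (hd : 1 ≤ degree cs n) :
    (scaledPoly cl cs n).natDegree ≤ degree cs n := by
  unfold scaledPoly
  refine Polynomial.natDegree_add_le_of_degree_le ?_ ?_
  · refine (Polynomial.natDegree_C_mul_le _ _).trans (Polynomial.natDegree_comp_le.trans ?_)
    have h1 := (isMinMaxPoly_minMaxPoly (degree cs n)).1
    have h2 : (C ((n : ℝ) / (cl * Real.log n)) * X : ℝ[X]).natDegree ≤ 1 :=
      (Polynomial.natDegree_C_mul_le _ _).trans Polynomial.natDegree_X_le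
    calc _ ≤ degree cs n * 1 := Nat.mul_le_mul h1 h2
      _ = _ := mul_one _
  · exact ((Polynomial.natDegree_C_mul_le _ _).trans Polynomial.natDegree_X_le).trans hd

theorem natDegree_derivPoly_lt (cl cs ε : ℝ) (n : ℕ) (hd : 1 ≤ degree cs n) :
    (derivPoly cl cs ε n).natDegree < degree cs n := by
  have hq := natDegree_scaledPoly_le cl cs n hd
  unfold derivPoly
  set q := scaledPoly cl cs n
  set A := ampSize ε n
  have key : (q.comp (X + C (A - 1)⁻¹) - q).natDegree ≤ degree cs n - 1 := by
    refine Polynomial.natDegree_le_iff_coeff_eq_zero.2 fun N hN => ?_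
    have hc : (q.comp (X + C (A - 1)⁻¹)).natDegree = q.natDegree := by
      rw [Polynomial.natDegree_comp, Polynomial.natDegree_X_add_C, mul_one]
    rw [Polynomial.coeff_sub]
    rcases lt_or_ge q.natDegree N with h | h
    · rw [Polynomial.coeff_eq_zero_of_natDegree_lt h,
        Polynomial.coeff_eq_zero_of_natDegree_lt (hc ▸ h), sub_zero]
    · have hN' : N = q.natDegree := by omega
      subst hN'
      have : (q.comp (X + C (A - 1)⁻¹)).leadingCoeff = q.leadingCoeff := by
        rw [Polynomial.leadingCoeff_comp (by simp), Polynomial.leadingCoeff_X_add_C]; simp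
      rw [Polynomial.leadingCoeff, hc] at this
      rw [this, Polynomial.leadingCoeff, sub_self]
  have : (C (-Real.log ((A - 1) / A)) + C (A - 1) * (q.comp (X + C (A - 1)⁻¹) - q)).natDegree
      ≤ degree cs n - 1 :=
    Polynomial.natDegree_add_le_of_degree_le (by simp)
      ((Polynomial.natDegree_C_mul_le _ _).trans key)
  show Polynomial.natDegree (C (-Real.log ((A - 1) / A)) +
    C (A - 1) * (q.comp (X + C (A - 1)⁻¹) - q)) < degree cs n
  omega

/-- `primitiveCoeff` gives the coefficients of the primitive of `derivPoly` that vanishes at `0`. -/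
theorem integral_derivPoly (cl cs ε : ℝ) (n : ℕ) (hd : 1 ≤ degree cs n) (x : ℝ) :
    ∫ s in (0 : ℝ)..x, (derivPoly cl cs ε n).eval s
      = ∑ t ∈ Finset.Icc 1 (degree cs n), primitiveCoeff cl cs ε n t * x ^ t := by
  simp_rw [Polynomial.eval_eq_sum_range' (natDegree_derivPoly_lt cl cs ε n hd)]
  rw [intervalIntegral.integral_finsetSum fun i _ => by
    exact (Continuous.intervalIntegrable (by fun_prop) _ _)]
  rw [Finset.range_eq_Ico, ← Finset.Ico_add_one_right_eq_Icc,
    ← Finset.sum_Ico_add' (fun t => primitiveCoeff cl cs ε n t * x ^ t) 0 (degree cs n) 1]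
  refine Finset.sum_congr rfl fun i _ => ?_
  simp only [primitiveCoeff, intervalIntegral.integral_const_mul, integral_pow]
  simp
  ring

end

end EntropyAmp

/-! Under Poisson sampling the pairs of counts of different symbols are independent, and the counts
of a symbol `i` are two independent Poisson variables of rate `n p_i`
(`measurePreserving_count_pair`). The error therefore splits into a standard deviation, whose square
is a sum of one-symbol variances, and a bias. The bias is measured against the mean of the empirical
estimator with `m ≈ A = ε n log n` samples: its total mean differs from `H(p)` by at most the
empirical loss, so only the differences of one-symbol means remain. Two one-symbol estimates carry
the proof, with `x = p_i`. The bias (`Regime.abs_symbolMean_sub_le`) is at most `min ((1 + O(ε)) x,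
1/(ε n))` plus `x` times a negligible factor, and the variance (`Regime.exists_integral_sub_sq_le`)
is at most `x` times a quantity below `n^(-0.99)` for large `n`. Since `∑ p_i = 1`, summation gives
the theorem, with `S_p` counting the symbols that contribute.

If `n x ≥ 8 log n`, the second count exceeds `1/ε` outside an event of probability `n⁻⁴`, and the
plug-in mean is within `1/n` of the empirical mean.

If `n x ≤ 8 log n`, the small-count estimator matters. The empirical mean of a symbol is the
Bernstein polynomial of `h` at `x`; its derivative is a binomial average of rescaled forward
differences of `h`. Replacing that average by its value at `x` and integrating gives `ampPrimitive`.
This differs from the Bernstein polynomial by at most `x`, or alternatively by about `log A / (2A)`,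
up to lower-order terms; these are the leading terms of the two bounds. Replacing `h` by its min-max
polynomial on `[0, cl log n / n]` costs `O(A x / (n log n)) = O(ε x)`, because the uniform error on
`[0,1]` is at most `d⁻²`. Falling factorials estimate the resulting polynomial without bias, apart
from the cutoff at `cl log n`.

The rate `d⁻²` comes from the cubically decaying Taylor coefficients of `(1-z)² log (1-z)`, read on
the unit circle as a Chebyshev expansion (`abs_negMulLog_sub_approxPoly_le`). The variance is
controlled by the sum of the rescaled coefficients, which grows at most like `17^d`, a small power
of `n`, up to logarithmic factors (`exists_majorizes`, `exists_coeff_derivPoly`). -/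

namespace EntropyAmp

/-! ### Elementary inequalities for `x ↦ -x log x` -/

/-- The tangent line of `-x log x` at `u` lies above the graph. -/
theorem negMulLog_le_tangent {u y : ℝ} (hu : 0 < u) (hy : 0 ≤ y) :
    Real.negMulLog y ≤ u - y - y * Real.log u := by
  rcases hy.eq_or_lt with rfl | hy
  · simp [hu.le]
  · have h := Real.log_le_sub_one_of_pos (div_pos hu hy)
    rw [Real.log_div hu.ne' hy.ne'] at h
    have h2 := mul_le_mul_of_nonneg_left h hy.le
    have h3 : y * (u / y - 1) = u - y := by field_simp
    rw [Real.negMulLog]; linarith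

/-- A quadratic lower bound of `-x log x`. -/
theorem quadratic_le_negMulLog {c y : ℝ} (hc : 0 < c) (hy : 0 ≤ y) :
    y - y ^ 2 / c - y * Real.log c ≤ Real.negMulLog y := by
  rcases hy.eq_or_lt with rfl | hy
  · simp
  · have h := Real.log_le_sub_one_of_pos (div_pos hy hc)
    rw [Real.log_div hy.ne' hc.ne'] at h
    have h2 := mul_le_mul_of_nonneg_left h hy.le
    have h3 : y * (y / c - 1) = y ^ 2 / c - y := by ring
    rw [Real.negMulLog]; linarith

/-- Jensen's inequality: integrate the tangent line at the mean. -/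
theorem integral_negMulLog_le {Ω : Type*} [MeasurableSpace Ω] {μ : Measure Ω}
    [IsProbabilityMeasure μ] {Y : Ω → ℝ} {x : ℝ} (hY : ∀ ω, 0 ≤ Y ω) (hx : 0 < x)
    (hYi : Integrable Y μ) (hhi : Integrable (fun ω => Real.negMulLog (Y ω)) μ)
    (h1 : ∫ ω, Y ω ∂μ = x) : ∫ ω, Real.negMulLog (Y ω) ∂μ ≤ Real.negMulLog x := by
  have h : ∫ ω, Real.negMulLog (Y ω) ∂μ ≤ ∫ ω, (x - Y ω - Y ω * Real.log x) ∂μ :=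
    integral_mono hhi (((integrable_const x).sub hYi).sub (hYi.mul_const _))
      fun ω => negMulLog_le_tangent hx (hY ω)
  have hi : Integrable (fun ω => x - Y ω) μ := (integrable_const x).sub hYi
  rw [integral_sub hi (hYi.mul_const _), integral_sub (integrable_const x) hYi, integral_mul_const, h1] at h
  simp only [integral_const, probReal_univ, one_smul] at h
  rw [Real.negMulLog]
  linarith

/-- Jensen's inequality for `log` under the size-biased law, whose mean is `E Y² / E Y ≤ x + v`.
Concretely, the quadratic minorant that touches `h` at `x + v` is integrated; its terms without
logarithm have nonnegative integral. -/
theorem le_integral_negMulLog {Ω : Type*} [MeasurableSpace Ω] {μ : Measure Ω}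
    [IsProbabilityMeasure μ] {Y : Ω → ℝ} {x v : ℝ} (hY : ∀ ω, 0 ≤ Y ω) (hx : 0 < x) (hv : 0 ≤ v)
    (hYi : Integrable Y μ) (hY2 : Integrable (fun ω => Y ω ^ 2) μ)
    (hhi : Integrable (fun ω => Real.negMulLog (Y ω)) μ)
    (h1 : ∫ ω, Y ω ∂μ = x) (h2 : ∫ ω, Y ω ^ 2 ∂μ ≤ x * (x + v)) :
    -(x * Real.log (x + v)) ≤ ∫ ω, Real.negMulLog (Y ω) ∂μ := by
  have hc : 0 < x + v := by linarith
  have h : ∫ ω, (Y ω - Y ω ^ 2 / (x + v) - Y ω * Real.log (x + v)) ∂μ ≤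
      ∫ ω, Real.negMulLog (Y ω) ∂μ :=
    integral_mono ((hYi.sub (hY2.div_const _)).sub (hYi.mul_const _)) hhi
      fun ω => quadratic_le_negMulLog hc (hY ω)
  have hi : Integrable (fun ω => Y ω - Y ω ^ 2 / (x + v)) μ := hYi.sub (hY2.div_const _)
  rw [integral_sub hi (hYi.mul_const _), integral_sub hYi (hY2.div_const _), integral_mul_const, integral_div, h1] at h
  have h3 : (∫ ω, Y ω ^ 2 ∂μ) / (x + v) ≤ x := by
    rw [div_le_iff₀ hc]; exact h2
  linarith

theorem negMulLog_sub_le {x v : ℝ} (hx : 0 < x) (hv : 0 ≤ v) :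
    Real.negMulLog x - v ≤ -(x * Real.log (x + v)) := by
  have h := Real.log_le_sub_one_of_pos (div_pos (by linarith : 0 < x + v) hx)
  rw [Real.log_div (by linarith) hx.ne'] at h
  have h2 := mul_le_mul_of_nonneg_left h hx.le
  have h3 : x * ((x + v) / x - 1) = v := by field_simp; ring
  rw [Real.negMulLog]; linarith

/-- The tangent majorant and the quadratic minorant at the same point `x` differ by `(y - x)² / x`.
The resulting bound is polynomial in `y`, so that Poisson moments suffice for the variance. -/
theorem abs_negMulLog_sub_le {x y : ℝ} (hx : 0 < x) (hy : 0 ≤ y) :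
    |Real.negMulLog y - Real.negMulLog x| ≤ |y - x| * (1 + |Real.log x|) + (y - x) ^ 2 / x := by
  have h1 := negMulLog_le_tangent hx hy
  have h2 := quadratic_le_negMulLog hx hy
  have e : y - y ^ 2 / x - y * Real.log x - Real.negMulLog x
      = -((y - x) ^ 2 / x) - (y - x) * (1 + Real.log x) := by
    rw [Real.negMulLog]; field_simp; ring
  have e2 : x - y - y * Real.log x - Real.negMulLog x = -((y - x) * (1 + Real.log x)) := by
    rw [Real.negMulLog]; ring
  have h3 : |(y - x) * (1 + Real.log x)| ≤ |y - x| * (1 + |Real.log x|) := by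
    rw [abs_mul]
    refine mul_le_mul_of_nonneg_left ?_ (abs_nonneg _)
    exact (abs_add_le _ _).trans (by simp)
  have h4 := abs_le.1 h3
  have h5 : 0 ≤ (y - x) ^ 2 / x := by positivity
  rw [abs_le]
  constructor <;> linarith [h4.1, h4.2]

/-! ### The primitive of the forward difference of `-x log x` -/

/-- The function `Γ(y) = y/2 - (1+y)²/2 log(1+y) + y²/2 log y`, a rescaled primitive of the forward
difference `h(y+1) - h(y)` of `h(x) = -x log x`. -/
noncomputable def diffPrimitive (y : ℝ) : ℝ :=
  y / 2 - (1 + y) ^ 2 / 2 * Real.log (1 + y) + y ^ 2 / 2 * Real.log y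

/-- This is `t ≤ sinh t` at `t = log z`. It is exact to second order at `z = 1`; the cruder `log z ≤
z - 1` would turn the `3/4` of `negMulLog_sub_diffPrimitive_le` into `1` and the two ranges that
meet at `1.15` would no longer be covered. -/
theorem log_le_half_sub_inv {z : ℝ} (hz : 1 ≤ z) : Real.log z ≤ (z - z⁻¹) / 2 := by
  have h := Real.self_le_sinh_iff.2 (Real.log_nonneg hz)
  rwa [Real.sinh_log (by linarith)] at h

theorem div_le_log_one_add {y : ℝ} (hy : 0 ≤ y) : y / (1 + y) ≤ Real.log (1 + y) := by
  have h := Real.one_sub_inv_le_log_of_pos (by linarith : 0 < 1 + y)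
  have : 1 - (1 + y)⁻¹ = y / (1 + y) := by field_simp; ring
  linarith

theorem diffPrimitive_eq {y : ℝ} (hy : 0 < y) :
    diffPrimitive y = y / 2 - (1 + 2 * y) / 2 * Real.log (1 + y)
      - y ^ 2 / 2 * Real.log (1 + y⁻¹) := by
  have : Real.log (1 + y⁻¹) = Real.log (1 + y) - Real.log y := by
    rw [← Real.log_div (by linarith) hy.ne']; congr 1; field_simp; ring
  rw [diffPrimitive, this]; ring

/-- At `y = (A-1) x`, the bounds `Γ ≤ 0` and `Γ ≤ h` give the upper bounds `x log A` and `h(x)` (up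
to lower order) for the amplified primitive. The mean of the empirical estimator has upper bounds of
the same two kinds. -/
theorem diffPrimitive_nonpos {y : ℝ} (hy : 0 < y) : diffPrimitive y ≤ 0 := by
  rw [diffPrimitive_eq hy]
  have h1 := div_le_log_one_add hy.le
  have h2 : 0 ≤ Real.log (1 + y⁻¹) := Real.log_nonneg (by simp [hy.le])
  have h3 : y ≤ (1 + 2 * y) * Real.log (1 + y) := by
    calc y ≤ (1 + 2 * y) * (y / (1 + y)) := by
          rw [mul_div_assoc', le_div_iff₀ (by linarith)]; nlinarith
      _ ≤ _ := mul_le_mul_of_nonneg_left h1 (by linarith)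
  have h4 : 0 ≤ y ^ 2 / 2 * Real.log (1 + y⁻¹) := by positivity
  linarith

theorem diffPrimitive_le_negMulLog {y : ℝ} (hy : 0 < y) :
    diffPrimitive y ≤ Real.negMulLog y := by
  have h1 := div_le_log_one_add hy.le
  have h2 := div_le_log_one_add (inv_nonneg.2 hy.le)
  have h3 : Real.log y ≤ Real.log (1 + y) := Real.log_le_log hy (by linarith)
  rw [diffPrimitive_eq hy, Real.negMulLog]
  have e : y⁻¹ / (1 + y⁻¹) = 1 / (1 + y) := by field_simp; ring
  rw [e] at h2
  have h4 := mul_le_mul_of_nonneg_left h2 (by positivity : 0 ≤ y ^ 2 / 2)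
  have h5 := mul_le_mul_of_nonneg_left h3 hy.le
  have h6 : y / (1 + y) / 2 + y ^ 2 / 2 * (1 / (1 + y)) = y / 2 := by field_simp
  linarith

theorem neg_diffPrimitive_le {y : ℝ} (hy : 0 < y) (hy' : y ≤ 1.15) : -diffPrimitive y ≤ y := by
  have h1 := negMulLog_le_tangent one_pos hy.le
  rw [Real.log_one, Real.negMulLog] at h1
  have h2 := mul_le_mul_of_nonneg_left h1 (by positivity : 0 ≤ y / 2)
  -- On `y ≤ 0.6` the bound `log (1 + y) ≤ y` suffices, since the claim then reduces to `y² + y ≤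
  -- 1`. Beyond, the tangent of `log` at `2` is used.
  have key : (1 + y) ^ 2 * Real.log (1 + y) ≤ 2 * y + y ^ 2 := by
    rcases le_total y 0.6 with h | h
    · have := Real.log_le_sub_one_of_pos (by linarith : 0 < 1 + y)
      calc (1 + y) ^ 2 * Real.log (1 + y) ≤ (1 + y) ^ 2 * y := by
            refine mul_le_mul_of_nonneg_left (by linarith) (by positivity)
        _ ≤ _ := by nlinarith [mul_nonneg hy.le (sub_nonneg.2 h)]
    · have h3 := Real.log_le_sub_one_of_pos (by linarith : 0 < (1 + y) / 2)
      rw [Real.log_div (by linarith) (by norm_num)] at h3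
      have := Real.log_two_lt_d9
      calc (1 + y) ^ 2 * Real.log (1 + y) ≤ (1 + y) ^ 2 * (0.6932 + (y - 1) / 2) := by
            refine mul_le_mul_of_nonneg_left (by linarith) (by positivity)
        _ ≤ _ := by nlinarith [mul_nonneg (sub_nonneg.2 h) (sub_nonneg.2 hy'),
              mul_nonneg (mul_nonneg (sub_nonneg.2 h) (sub_nonneg.2 hy')) hy.le]
  rw [diffPrimitive]
  nlinarith

/-- In `h - Γ`, write `log y = log (1 + y) - log (1 + 1/y)`: the coefficient of `log (1 + y)`
collapses to `1/2`, and the rest is bounded. Divided by `A - 1`, where `A = ε n log n`, this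
logarithm becomes the cost `1/(ε n)` per symbol. -/
theorem negMulLog_sub_diffPrimitive_le {y : ℝ} (hy : 0 < y) :
    Real.negMulLog y - diffPrimitive y ≤ Real.log (1 + y) / 2 + 3 / 4 := by
  have e : Real.log (1 + y⁻¹) = Real.log (1 + y) - Real.log y := by
    rw [← Real.log_div (by linarith) hy.ne']; congr 1; field_simp; ring
  have h1 := log_le_half_sub_inv (by simp [hy.le] : 1 ≤ 1 + y⁻¹)
  have h2 := mul_le_mul_of_nonneg_left h1 (by positivity : 0 ≤ y + y ^ 2 / 2)
  have h3 : (y + y ^ 2 / 2) * ((1 + y⁻¹ - (1 + y⁻¹)⁻¹) / 2) ≤ y / 2 + 3 / 4 := by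
    have : (y + y ^ 2 / 2) * ((1 + y⁻¹ - (1 + y⁻¹)⁻¹) / 2) = y / 2 + 3 / 4 - 1 / (4 * (1 + y)) := by
      have : 1 + y⁻¹ = (1 + y) / y := by field_simp; ring
      rw [this]
      field_simp
      ring
    rw [this]
    have : 0 < 1 / (4 * (1 + y)) := by positivity
    linarith
  rw [diffPrimitive_eq hy, Real.negMulLog]
  have : Real.log y = Real.log (1 + y) - Real.log (1 + y⁻¹) := by linarith
  rw [this]
  linarith

/-- Complements `neg_diffPrimitive_le`; at the common endpoint `1.15` both estimates hold. -/
theorem negMulLog_sub_diffPrimitive_le_self {y : ℝ} (hy : 1.15 ≤ y) :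
    Real.negMulLog y - diffPrimitive y ≤ y := by
  have h1 := negMulLog_sub_diffPrimitive_le (by linarith : 0 < y)
  have h3 := Real.log_le_sub_one_of_pos (by linarith : 0 < (1 + y) / 2)
  rw [Real.log_div (by linarith) (by norm_num)] at h3
  have := Real.log_two_lt_d9
  linarith

/-! ### Polynomial approximation of `-x log x` at the rate `d⁻²` -/

/-- The Taylor coefficients of `(1 - z)² log (1 - z)`. -/
noncomputable def sqLogCoeff : ℕ → ℝ
  | 0 => 0
  | 1 => -1
  | 2 => 3 / 2
  | k + 3 => -(2 / (((k : ℝ) + 1) * (k + 2) * (k + 3)))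

/-- From index 3 on, the coefficients are minus the second differences of `1/k`. The series of `-log
(1 - z)` is taken from indices 3, 2 and 1, so that multiplication by `1`, `-2z` and `z²` aligns the
powers of `z`. -/
theorem hasSum_sqLogCoeff {z : ℂ} (hz : ‖z‖ < 1) :
    HasSum (fun k => (sqLogCoeff k : ℂ) * z ^ k) ((1 - z) ^ 2 * Complex.log (1 - z)) := by
  have h := Complex.hasSum_taylorSeries_neg_log hz
  have h1 := (hasSum_nat_add_iff' 1).2 h
  have h2 := (hasSum_nat_add_iff' 2).2 h
  have h3 := (hasSum_nat_add_iff' 3).2 h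
  refine (hasSum_nat_add_iff' 3).1 ?_
  have h4 := ((h3.add (h2.mul_left (-2 * z))).add (h1.mul_left (z ^ 2))).mul_left (-1)
  have ef : (fun k => (sqLogCoeff (k + 3) : ℂ) * z ^ (k + 3)) = fun i : ℕ =>
      -1 * (z ^ (i + 3) / ((i + 3 : ℕ) : ℂ) + -2 * z * (z ^ (i + 2) / ((i + 2 : ℕ) : ℂ))
        + z ^ 2 * (z ^ (i + 1) / ((i + 1 : ℕ) : ℂ))) := by
    funext k
    have e1 : (k : ℂ) + 1 ≠ 0 := by exact_mod_cast Nat.succ_ne_zero k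
    have e2 : (k : ℂ) + 2 ≠ 0 := by exact_mod_cast Nat.succ_ne_zero (k + 1)
    have e3 : (k : ℂ) + 3 ≠ 0 := by exact_mod_cast Nat.succ_ne_zero (k + 2)
    simp only [sqLogCoeff]
    push_cast
    field_simp
    ring
  have ev : (1 - z) ^ 2 * Complex.log (1 - z)
      - ∑ i ∈ Finset.range 3, (sqLogCoeff i : ℂ) * z ^ i
      = -1 * (-Complex.log (1 - z) - ∑ i ∈ Finset.range 3, z ^ i / (i : ℂ)
        + -2 * z * (-Complex.log (1 - z) - ∑ i ∈ Finset.range 2, z ^ i / (i : ℂ))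
        + z ^ 2 * (-Complex.log (1 - z) - ∑ i ∈ Finset.range 1, z ^ i / (i : ℂ))) := by
    simp only [Finset.sum_range_succ, Finset.sum_range_zero, sqLogCoeff]
    push_cast
    simp only [pow_zero, div_zero]
    ring
  rw [ef, ev]
  exact h4

/-- The sum telescopes: `2/(j(j+1)(j+2)) = 1/(j(j+1)) - 1/((j+1)(j+2))`. -/
theorem sum_abs_sqLogCoeff_tail (d n : ℕ) (hd : 1 ≤ d) :
    ∑ k ∈ Finset.range n, |sqLogCoeff (k + (d + 2))| ≤ 1 / ((d : ℝ) * (d + 1)) := by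
  suffices h : ∑ k ∈ Finset.range n, |sqLogCoeff (k + (d + 2))| =
      1 / ((d : ℝ) * (d + 1)) - 1 / (((n : ℝ) + d) * (n + d + 1)) by
    rw [h]
    have : 0 ≤ 1 / (((n : ℝ) + d) * (n + d + 1)) := by positivity
    linarith
  have hd0 : (0 : ℝ) < d := by exact_mod_cast hd
  induction n with
  | zero => simp
  | succ n ih =>
    rw [Finset.sum_range_succ, ih]
    obtain ⟨e, rfl⟩ : ∃ e, d = e + 1 := ⟨d - 1, by omega⟩
    rw [show n + (e + 1 + 2) = (n + e) + 3 by ring]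
    simp only [sqLogCoeff, abs_neg]
    rw [abs_of_nonneg (by positivity)]
    push_cast
    field_simp
    ring

theorem norm_sqLog_sub_le {z : ℂ} (hz : ‖z‖ < 1) (d : ℕ) (hd : 1 ≤ d) :
    ‖(1 - z) ^ 2 * Complex.log (1 - z)
      - ∑ k ∈ Finset.range (d + 2), (sqLogCoeff k : ℂ) * z ^ k‖ ≤ 1 / ((d : ℝ) * (d + 1)) := by
  have h := (hasSum_nat_add_iff' (d + 2)).2 (hasSum_sqLogCoeff hz)
  have ht := h.tendsto_sum_nat.norm
  refine le_of_tendsto ht (Filter.Eventually.of_forall fun n => ?_)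
  refine (norm_sum_le _ _).trans (le_trans (Finset.sum_le_sum fun k _ => ?_)
    (sum_abs_sqLogCoeff_tail d n hd))
  rw [norm_mul, norm_pow, Complex.norm_real, Real.norm_eq_abs]
  exact mul_le_of_le_one_right (abs_nonneg _) (pow_le_one₀ (norm_nonneg _) hz.le)

/-- Radial limit of the bound in the open disc; excluding `z = 1` keeps `1 - z` in the slit plane,
where `log` is continuous. -/
theorem norm_sqLog_sub_le_of_norm_eq_one {z : ℂ} (hz : ‖z‖ = 1) (hz1 : z ≠ 1) (d : ℕ)
    (hd : 1 ≤ d) :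
    ‖(1 - z) ^ 2 * Complex.log (1 - z)
      - ∑ k ∈ Finset.range (d + 2), (sqLogCoeff k : ℂ) * z ^ k‖ ≤ 1 / ((d : ℝ) * (d + 1)) := by
  have hslit : 1 - z ∈ Complex.slitPlane := by
    rw [Complex.mem_slitPlane_iff]
    have hre : z.re ≤ 1 := hz ▸ Complex.re_le_norm z
    rcases hre.lt_or_eq with h | h
    · left; simp [h]
    · exfalso
      have h2 : z.re * z.re + z.im * z.im = 1 := by
        rw [← Complex.normSq_apply, Complex.normSq_eq_norm_sq, hz]; norm_num
      have h3 : z.im = 0 := by nlinarith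
      exact hz1 (Complex.ext (by simp [h]) (by simp [h3]))
  have hc : ContinuousAt (fun w : ℂ => ‖(1 - w) ^ 2 * Complex.log (1 - w)
      - ∑ k ∈ Finset.range (d + 2), (sqLogCoeff k : ℂ) * w ^ k‖) z := by
    have : ContinuousAt (fun w : ℂ => Complex.log (1 - w)) z :=
      (continuousAt_clog hslit).comp (f := fun w : ℂ => 1 - w) (by fun_prop)
    fun_prop
  have hu : Filter.Tendsto (fun j : ℕ => ((1 - 1 / ((j : ℝ) + 1) : ℝ) : ℂ) * z) Filter.atTop
      (nhds z) := by
    have h0 : Filter.Tendsto (fun j : ℕ => (1 - 1 / ((j : ℝ) + 1) : ℝ)) Filter.atTop (nhds 1) := by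
      simpa using tendsto_one_div_add_atTop_nhds_zero_nat.const_sub (1 : ℝ)
    have := (Complex.continuous_ofReal.tendsto 1).comp h0
    simpa using this.mul_const z
  refine le_of_tendsto (hc.tendsto.comp hu) (Filter.Eventually.of_forall fun j => ?_)
  refine norm_sqLog_sub_le ?_ d hd
  rw [norm_mul, hz, mul_one, Complex.norm_real, Real.norm_eq_abs, abs_lt]
  have : 0 < 1 / ((j : ℝ) + 1) := by positivity
  have : 1 / ((j : ℝ) + 1) ≤ 1 := by rw [div_le_one (by positivity)]; linarith [j.cast_nonneg (α := ℝ)]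
  constructor <;> linarith

/-- A polynomial of degree at most `d` that is `O(d⁻²)`-close to `-x log x` on `[0,1]`. -/
noncomputable def approxPoly (d : ℕ) : ℝ[X] :=
  ∑ k ∈ Finset.range (d + 2), C (sqLogCoeff k / 2) * (Chebyshev.T ℝ ((k : ℤ) - 1)).comp (1 - 2 * X)
    + C (Real.log 4) * X

theorem natDegree_approxPoly_le (d : ℕ) (hd : 1 ≤ d) : (approxPoly d).natDegree ≤ d := by
  refine Polynomial.natDegree_add_le_of_degree_le ?_ ?_
  · refine Polynomial.natDegree_sum_le_of_forall_le _ _ fun k hk => ?_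
    refine (Polynomial.natDegree_C_mul_le _ _).trans (Polynomial.natDegree_comp_le.trans ?_)
    have h1 : (1 - 2 * X : ℝ[X]).natDegree ≤ 1 := by compute_degree
    -- The index `k - 1` runs from `-1` to `d`; the degree of `T_{-1} = T_1` is at most `d` because
    -- `d ≥ 1`.
    have h2 : (Chebyshev.T ℝ ((k : ℤ) - 1)).natDegree ≤ d := by
      rw [Chebyshev.natDegree_T]
      have := Finset.mem_range.1 hk
      omega
    calc _ ≤ d * 1 := Nat.mul_le_mul h2 h1
      _ = d := mul_one d
  · exact ((Polynomial.natDegree_C_mul_le _ _).trans Polynomial.natDegree_X_le).trans hd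

/-- Put `1 - 2x = cos θ` and `z = e^{iθ}`. Then `(1-z)² z̄ = -4x` and `log |1-z| = log (4x) / 2`, so
the real part of `z̄ (1-z)² log (1-z)` is `2 (h(x) - x log 4)`, while that of `z̄ z^k` is `T_{k-1}(1
- 2x)`. Truncating the Taylor series is therefore a polynomial approximation of `h`. -/
theorem abs_negMulLog_sub_approxPoly_le (d : ℕ) (hd : 1 ≤ d) {x : ℝ} (hx : x ∈ Set.Icc (0 : ℝ) 1) :
    |Real.negMulLog x - (approxPoly d).eval x| ≤ 1 / (d : ℝ) ^ 2 := by
  have hclosed : IsClosed {x : ℝ | |Real.negMulLog x - (approxPoly d).eval x| ≤ 1 / (d : ℝ) ^ 2} :=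
    isClosed_le ((Real.continuous_negMulLog.sub (approxPoly d).continuous).abs) continuous_const
  have hd0 : (0 : ℝ) < d := by exact_mod_cast hd
  -- At `x = 0` one has `z = 1`, which is excluded; that point is recovered by continuity.
  suffices h : Set.Ioc (0 : ℝ) 1 ⊆
      {x : ℝ | |Real.negMulLog x - (approxPoly d).eval x| ≤ 1 / (d : ℝ) ^ 2} by
    have h2 := closure_minimal h hclosed
    rw [closure_Ioc zero_ne_one] at h2
    exact h2 hx
  clear hx x
  intro x hx
  set θ := Real.arccos (1 - 2 * x)
  have hcos : Real.cos θ = 1 - 2 * x := Real.cos_arccos (by linarith [hx.2]) (by linarith [hx.1])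
  set z : ℂ := Complex.exp (θ * Complex.I) with hzdef
  have hz : ‖z‖ = 1 := Complex.norm_exp_ofReal_mul_I θ
  have hzre : z.re = 1 - 2 * x := by rw [hzdef, Complex.exp_ofReal_mul_I_re, hcos]
  have hz1 : z ≠ 1 := by
    intro h
    rw [h, Complex.one_re] at hzre
    linarith [hx.1]
  have hzz : z * (starRingEnd ℂ) z = 1 := by
    rw [Complex.mul_conj, Complex.normSq_eq_norm_sq, hz]; norm_num
  have hsum : z + (starRingEnd ℂ) z = ((2 * (1 - 2 * x) : ℝ) : ℂ) := by
    rw [Complex.add_conj, hzre]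
  have hfac : (1 - z) ^ 2 * (starRingEnd ℂ) z = ((-(4 * x) : ℝ) : ℂ) := by
    have : (1 - z) ^ 2 * (starRingEnd ℂ) z
        = (z + (starRingEnd ℂ) z) - 2 + (z * (starRingEnd ℂ) z - 1) * (z - 2) := by ring
    rw [this, hsum, hzz]; push_cast; ring
  have hnorm : ‖1 - z‖ ^ 2 = 4 * x := by
    rw [← Complex.normSq_eq_norm_sq, Complex.normSq_sub, map_one, Complex.normSq_eq_norm_sq, hz,
      one_mul, Complex.conj_re, hzre]
    ring
  have hlog : Real.log ‖1 - z‖ = Real.log (4 * x) / 2 := by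
    rw [← hnorm, Real.log_pow]; push_cast; ring
  have hpow : ∀ k : ℕ, (z ^ k * (starRingEnd ℂ) z).re =
      (Chebyshev.T ℝ ((k : ℤ) - 1)).eval (1 - 2 * x) := by
    intro k
    rw [← hcos, Chebyshev.T_real_cos]
    have : z ^ k * (starRingEnd ℂ) z
        = Complex.exp (((((k : ℤ) - 1 : ℤ) : ℝ) * θ : ℝ) * Complex.I) := by
      rw [hzdef, ← Complex.exp_conj, ← Complex.exp_nat_mul, ← Complex.exp_add]
      congr 1
      simp only [map_mul, Complex.conj_ofReal, Complex.conj_I]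
      push_cast
      ring
    rw [this, Complex.exp_ofReal_mul_I_re]
  have main := norm_sqLog_sub_le_of_norm_eq_one hz hz1 d hd
  have hre := (Complex.abs_re_le_norm (((1 - z) ^ 2 * Complex.log (1 - z)
      - ∑ k ∈ Finset.range (d + 2), (sqLogCoeff k : ℂ) * z ^ k) * (starRingEnd ℂ) z))
  rw [norm_mul, Complex.norm_conj, hz, mul_one] at hre
  have heq : (((1 - z) ^ 2 * Complex.log (1 - z)
      - ∑ k ∈ Finset.range (d + 2), (sqLogCoeff k : ℂ) * z ^ k) * (starRingEnd ℂ) z).re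
      = 2 * (Real.negMulLog x - (approxPoly d).eval x) := by
    have e1 : ((1 - z) ^ 2 * Complex.log (1 - z)
        - ∑ k ∈ Finset.range (d + 2), (sqLogCoeff k : ℂ) * z ^ k) * (starRingEnd ℂ) z
        = ((-(4 * x) : ℝ) : ℂ) * Complex.log (1 - z)
          - ∑ k ∈ Finset.range (d + 2), (sqLogCoeff k : ℂ) * (z ^ k * (starRingEnd ℂ) z) := by
      rw [← hfac, sub_mul, Finset.sum_mul]
      congr 1
      · ring
      · exact Finset.sum_congr rfl fun k _ => by ring
    rw [e1, Complex.sub_re, Complex.re_sum, Complex.re_ofReal_mul, Complex.log_re, hlog]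
    simp only [Complex.re_ofReal_mul, hpow]
    rw [Real.log_mul (by norm_num) hx.1.ne', approxPoly, Real.negMulLog]
    simp only [eval_add, eval_finsetSum, eval_mul, eval_C, eval_comp, eval_sub, eval_one, eval_X,
      eval_ofNat]
    rw [mul_sub, mul_add, Finset.mul_sum]
    have : ∀ k : ℕ, 2 * (sqLogCoeff k / 2 * (Chebyshev.T ℝ ((k : ℤ) - 1)).eval (1 - 2 * x))
        = sqLogCoeff k * (Chebyshev.T ℝ ((k : ℤ) - 1)).eval (1 - 2 * x) := fun k => by ring
    simp only [this]
    ring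
  rw [heq, abs_mul, abs_two] at hre
  have h1 : 1 / ((d : ℝ) * (d + 1)) ≤ 1 / (d : ℝ) ^ 2 :=
    one_div_le_one_div_of_le (by positivity) (by nlinarith)
  show |Real.negMulLog x - (approxPoly d).eval x| ≤ 1 / (d : ℝ) ^ 2
  have h2 := abs_nonneg (Real.negMulLog x - (approxPoly d).eval x)
  linarith

theorem abs_negMulLog_sub_minMaxPoly_le (d : ℕ) (hd : 1 ≤ d) {x : ℝ}
    (hx : x ∈ Set.Icc (0 : ℝ) 1) :
    |Real.negMulLog x - (minMaxPoly d).eval x| ≤ 1 / (d : ℝ) ^ 2 :=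
  (isMinMaxPoly_minMaxPoly d).2 _ (natDegree_approxPoly_le d hd) _
    (fun _ hy => abs_negMulLog_sub_approxPoly_le d hd hy) x hx

/-! ### Majorants of polynomials -/

/-- The coefficients of `P` bound those of `p` in absolute value. -/
def Majorizes (P p : ℝ[X]) : Prop := ∀ i, |p.coeff i| ≤ P.coeff i

namespace Majorizes

theorem coeff_nonneg {P p : ℝ[X]} (h : Majorizes P p) (i : ℕ) : 0 ≤ P.coeff i :=
  (abs_nonneg _).trans (h i)

theorem const (a : ℝ) : Majorizes (C |a|) (C a) := by
  intro i
  rw [coeff_C, coeff_C]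
  split_ifs <;> simp

theorem add {P p Q q : ℝ[X]} (h : Majorizes P p) (h' : Majorizes Q q) :
    Majorizes (P + Q) (p + q) := by
  intro i
  rw [coeff_add, coeff_add]
  exact (abs_add_le _ _).trans (add_le_add (h i) (h' i))

theorem sub {P p Q q : ℝ[X]} (h : Majorizes P p) (h' : Majorizes Q q) :
    Majorizes (P + Q) (p - q) := by
  intro i
  rw [coeff_add, coeff_sub]
  exact (abs_sub _ _).trans (add_le_add (h i) (h' i))

theorem mul {P p Q q : ℝ[X]} (h : Majorizes P p) (h' : Majorizes Q q) :
    Majorizes (P * Q) (p * q) := by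
  intro i
  rw [coeff_mul, coeff_mul]
  refine (Finset.abs_sum_le_sum_abs _ _).trans (Finset.sum_le_sum fun x _ => ?_)
  rw [abs_mul]
  exact mul_le_mul (h _) (h' _) (abs_nonneg _) (h.coeff_nonneg _)

theorem sum {ι : Type*} (s : Finset ι) {P p : ι → ℝ[X]} (h : ∀ i ∈ s, Majorizes (P i) (p i)) :
    Majorizes (∑ i ∈ s, P i) (∑ i ∈ s, p i) := by
  intro i
  rw [finsetSum_coeff, finsetSum_coeff]
  exact (Finset.abs_sum_le_sum_abs _ _).trans (Finset.sum_le_sum fun x hx => h x hx i)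

theorem prod {ι : Type*} (s : Finset ι) {P p : ι → ℝ[X]} (h : ∀ i ∈ s, Majorizes (P i) (p i)) :
    Majorizes (∏ i ∈ s, P i) (∏ i ∈ s, p i) := by
  classical
  induction s using Finset.induction_on with
  | empty => simpa using const 1
  | insert a s ha ih =>
    rw [Finset.prod_insert ha, Finset.prod_insert ha]
    exact (h a (Finset.mem_insert_self _ _)).mul (ih fun i hi => h i (Finset.mem_insert_of_mem hi))

theorem pow {P p : ℝ[X]} (h : Majorizes P p) (n : ℕ) : Majorizes (P ^ n) (p ^ n) := by
  simpa using prod (Finset.range n) (P := fun _ => P) (p := fun _ => p) fun _ _ => h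

theorem X_self : Majorizes X X := by
  intro i
  rw [coeff_X]
  split_ifs <;> simp

theorem X_add_C {a : ℝ} (ha : 0 ≤ a) : Majorizes (X + C a) (X + C a) := by
  simpa only [abs_of_nonneg ha] using X_self.add (const a)

theorem X_sub_C {a : ℝ} (ha : 0 ≤ a) : Majorizes (X + C a) (X - C a) := by
  simpa only [abs_of_nonneg ha] using X_self.sub (const a)

/-- Nonnegative shifts preserve domination, so a value of the shifted majorant at `1` is a value of
the original one at `1 + a`. With `a ≤ 1` the value at `2` controls everything. -/
theorem comp {P p : ℝ[X]} (h : Majorizes P p) {a : ℝ} (ha : 0 ≤ a) :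
    Majorizes (P.comp (X + C a)) (p.comp (X + C a)) := by
  have e : ∀ q : ℝ[X], q.natDegree ≤ max P.natDegree p.natDegree → q.comp (X + C a) =
      ∑ i ∈ Finset.range (max P.natDegree p.natDegree + 1), C (q.coeff i) * (X + C a) ^ i := by
    intro q hq
    rw [Polynomial.comp, eval₂_eq_sum_range' _ (Nat.lt_succ_of_le hq)]
  rw [e P (le_max_left _ _), e p (le_max_right _ _)]
  refine sum _ fun i _ => Majorizes.mul ?_ ((X_add_C ha).pow i)
  intro j
  rw [coeff_C, coeff_C]
  split_ifs
  · exact h i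
  · simp

theorem eval_mono {P p : ℝ[X]} (h : Majorizes P p) {x y : ℝ} (hx : 0 ≤ x) (hxy : x ≤ y) :
    P.eval x ≤ P.eval y := by
  rw [eval_eq_sum_range, eval_eq_sum_range]
  exact Finset.sum_le_sum fun i _ =>
    mul_le_mul_of_nonneg_left (pow_le_pow_left₀ hx hxy i) (h.coeff_nonneg i)

theorem sum_abs_coeff_le {P p : ℝ[X]} (h : Majorizes P p) (n : ℕ) :
    ∑ i ∈ Finset.range n, |p.coeff i| ≤ P.eval 1 := by
  rw [eval_eq_sum_range' (Nat.lt_succ_of_le (le_max_left P.natDegree n))]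
  simp only [one_pow, mul_one]
  exact (Finset.sum_le_sum fun i _ => h i).trans
    (Finset.sum_le_sum_of_subset_of_nonneg (Finset.range_mono (by omega))
      fun i _ _ => h.coeff_nonneg i)

end Majorizes

/-- Denominators of the Lagrange basis at equispaced nodes; their inverses are binomial coefficients
over `d!`. -/
theorem prod_erase_abs_sub (d j : ℕ) (hj : j ≤ d) :
    ∏ i ∈ (Finset.range (d + 1)).erase j, |(j : ℝ) - i| = (j.factorial : ℝ) * (d - j).factorial := by
  obtain ⟨e, rfl⟩ := Nat.exists_eq_add_of_le hj
  have h1 : ∏ i ∈ (Finset.range (j + e + 1)).erase j, |(j : ℝ) - i| =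
      ∏ i ∈ Finset.range (j + e + 1), if i = j then 1 else |(j : ℝ) - i| := by
    rw [← Finset.mul_prod_erase (Finset.range (j + e + 1)) _ (a := j) (by simp)]
    simp only [if_true, one_mul]
    exact Finset.prod_congr rfl fun i hi => by rw [if_neg (Finset.ne_of_mem_erase hi)]
  rw [h1, add_assoc, Finset.prod_range_add, Finset.prod_range_succ', Nat.add_sub_cancel_left]
  congr 1
  · rw [← Finset.prod_range_add_one_eq_factorial, ← Finset.prod_range_reflect]
    push_cast
    refine Finset.prod_congr rfl fun i hi => ?_
    have hi := Finset.mem_range.1 hi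
    rw [if_neg (by omega), Nat.cast_sub (by omega), Nat.cast_sub (by omega)]
    push_cast
    rw [abs_of_nonneg (by linarith [i.cast_nonneg (α := ℝ)])]
    ring
  · rw [← Finset.prod_range_add_one_eq_factorial]
    push_cast
    simp only [add_zero, if_true, mul_one]
    refine Finset.prod_congr rfl fun i hi => ?_
    rw [if_neg (by omega), abs_sub_comm, abs_of_nonneg (by linarith [i.cast_nonneg (α := ℝ)])]
    ring

/-- A polynomial of degree at most `d` that is bounded on `[0,1]` has a majorant whose value at `2`
is at most exponential in `d`. -/
theorem exists_majorizes {d : ℕ} (hd : 1 ≤ d) {Q : ℝ[X]} (hQ : Q.natDegree ≤ d) {M : ℝ}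
    (hM : ∀ x ∈ Set.Icc (0 : ℝ) 1, |Q.eval x| ≤ M) :
    ∃ P, Majorizes P Q ∧ P.eval 2 ≤ M * 17 ^ d := by
  have hd0 : (0 : ℝ) < d := by exact_mod_cast hd
  have hM0 : 0 ≤ M := (abs_nonneg _).trans (hM 0 (by simp))
  set v : ℕ → ℝ := fun i => i / d with hv
  set s := Finset.range (d + 1) with hs
  have hinj : Set.InjOn v s := by
    intro i _ j _ hij
    simp only [hv] at hij
    rw [div_left_inj' hd0.ne'] at hij
    exact_mod_cast hij
  have hvm : ∀ i ∈ s, v i ∈ Set.Icc (0 : ℝ) 1 := by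
    intro i hi
    have : (i : ℝ) ≤ d := by exact_mod_cast Nat.lt_succ_iff.1 (Finset.mem_range.1 hi)
    exact ⟨by positivity, (div_le_one hd0).2 this⟩
  have hdeg : Q.degree < s.card := by
    rw [hs, Finset.card_range]
    exact lt_of_le_of_lt (Polynomial.natDegree_le_iff_degree_le.1 hQ)
      (by exact_mod_cast Nat.lt_succ_self d)
  have hinteg := Lagrange.eq_interpolate hinj hdeg
  rw [Lagrange.interpolate_apply] at hinteg
  -- The Lagrange interpolation formula at the nodes `i/d`, with every sign made positive.
  refine ⟨∑ j ∈ s, C |Q.eval (v j)| * ∏ i ∈ s.erase j, (C |(v j - v i)⁻¹| * (X + C (v i))), ?_, ?_⟩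
  · conv_rhs => rw [hinteg]
    refine Majorizes.sum _ fun j hj => (Majorizes.const _).mul (Majorizes.prod _ fun i hi => ?_)
    exact (Majorizes.const _).mul
      (Majorizes.X_sub_C (hvm i (Finset.mem_of_mem_erase hi)).1)
  · rw [eval_finsetSum]
    have hfac : (d : ℝ) ^ d / d.factorial ≤ Real.exp d := Real.pow_div_factorial_le_exp _ hd0.le d
    have hterm : ∀ j ∈ s, (C |Q.eval (v j)| *
        ∏ i ∈ s.erase j, (C |(v j - v i)⁻¹| * (X + C (v i)))).eval 2 ≤
        M * ((3 : ℝ) ^ d * Real.exp d * d.choose j) := by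
      intro j hj
      have hjd : j ≤ d := Nat.lt_succ_iff.1 (Finset.mem_range.1 hj)
      rw [eval_mul, eval_C, eval_prod]
      refine mul_le_mul (hM _ (hvm j hj)) ?_ ?_ hM0
      -- Each factor is at most `3` over the distance of two nodes, so a product is at most `3^d
      -- (d^d / d!) (d choose j)`, and `d^d / d! ≤ e^d`.
      · have : ∀ i ∈ s.erase j, (C |(v j - v i)⁻¹| * (X + C (v i))).eval 2 ≤
            3 * d * |(j : ℝ) - i|⁻¹ := by
          intro i hi
          have hi1 := (hvm i (Finset.mem_of_mem_erase hi)).2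
          simp only [eval_mul, eval_C, eval_add, eval_X]
          have : |(v j - v i)⁻¹| = d * |(j : ℝ) - i|⁻¹ := by
            simp only [hv]
            rw [← sub_div, inv_div, abs_div, abs_of_pos hd0, div_eq_mul_inv]
          rw [this]
          have h0 : 0 ≤ d * |(j : ℝ) - i|⁻¹ := by positivity
          nlinarith
        refine (Finset.prod_le_prod (fun i hi => ?_) this).trans ?_
        · have hi0 := (hvm i (Finset.mem_of_mem_erase hi)).1
          simp only [eval_mul, eval_C, eval_add, eval_X]
          positivity
        · rw [Finset.prod_mul_distrib, Finset.prod_const, Finset.card_erase_of_mem hj, hs,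
            Finset.card_range, Nat.add_sub_cancel, Finset.prod_inv_distrib,
            prod_erase_abs_sub d j hjd, mul_pow]
          have hc : (d.choose j : ℝ) = d.factorial / (j.factorial * (d - j).factorial) :=
            Nat.cast_choose ℝ hjd
          have hc' : ((j.factorial : ℝ) * (d - j).factorial)⁻¹ = d.choose j / d.factorial := by
            rw [hc]
            have : (d.factorial : ℝ) ≠ 0 := by positivity
            field_simp
          rw [hc']
          calc (3 : ℝ) ^ d * (d : ℝ) ^ d * (d.choose j / d.factorial)
              = 3 ^ d * ((d : ℝ) ^ d / d.factorial) * d.choose j := by ring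
            _ ≤ _ := by gcongr
      · refine Finset.prod_nonneg fun i hi => ?_
        have hi0 := (hvm i (Finset.mem_of_mem_erase hi)).1
        simp only [eval_mul, eval_C, eval_add, eval_X]
        positivity
    refine (Finset.sum_le_sum hterm).trans ?_
    rw [← Finset.mul_sum, ← Finset.mul_sum]
    refine mul_le_mul_of_nonneg_left ?_ hM0
    have : ∑ j ∈ s, (d.choose j : ℝ) = 2 ^ d := by
      exact_mod_cast Nat.sum_range_choose d
    rw [this, ← mul_one (d : ℝ), Real.exp_nat_mul, ← mul_pow, ← mul_pow]
    -- The base is `3 · e · 2 < 17`.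
    refine pow_le_pow_left₀ (by positivity) ?_ d
    have := Real.exp_one_lt_d9
    linarith

/-! ### The primitive of the rescaled min-max polynomial -/

theorem integral_negMulLog_interval {a b : ℝ} (ha : 0 ≤ a) (hab : a ≤ b) :
    ∫ t in a..b, Real.negMulLog t =
      (b ^ 2 / 4 - b ^ 2 / 2 * Real.log b) - (a ^ 2 / 4 - a ^ 2 / 2 * Real.log a) := by
  have hc : Continuous fun x : ℝ => x ^ 2 / 4 - x ^ 2 / 2 * Real.log x := by
    have : (fun x : ℝ => x ^ 2 / 4 - x ^ 2 / 2 * Real.log x)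
        = fun x => x ^ 2 / 4 - x / 2 * (x * Real.log x) := by funext x; ring
    rw [this]
    have := Real.continuous_mul_log
    fun_prop
  refine intervalIntegral.integral_eq_sub_of_hasDerivAt_of_le hab hc.continuousOn
    (fun x hx => ?_) (Real.continuous_negMulLog.intervalIntegrable _ _)
  have hx0 : x ≠ 0 := (lt_of_le_of_lt ha hx.1).ne'
  have h1 : HasDerivAt (fun x : ℝ => x ^ 2 / 4) (2 * x / 4) x := by
    simpa using (hasDerivAt_pow 2 x).div_const 4
  have h2 : HasDerivAt (fun x : ℝ => x ^ 2 / 2) (2 * x / 2) x := by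
    simpa using (hasDerivAt_pow 2 x).div_const 2
  have h3 := h1.sub (h2.mul (Real.hasDerivAt_log hx0))
  convert! h3 using 1
  rw [Real.negMulLog]
  field_simp
  ring

/-- The primitive vanishing at `0` of
`x ↦ -log ((A-1)/A) + (A-1) (h (x + 1/(A-1)) - h x)`, where `h(x) = -x log x`. -/
noncomputable def ampPrimitive (A x : ℝ) : ℝ :=
  x * Real.log A + (A - 1)⁻¹ * diffPrimitive (x * (A - 1))

theorem integral_amp_eq {A x : ℝ} (hA : 1 < A) (hx : 0 < x) :
    ∫ t in (0 : ℝ)..x, (-Real.log ((A - 1) / A)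
      + (A - 1) * (Real.negMulLog (t + (A - 1)⁻¹) - Real.negMulLog t)) = ampPrimitive A x := by
  have hA1 : 0 < A - 1 := by linarith
  have hc := Real.continuous_negMulLog
  have i1 : IntervalIntegrable (fun t => Real.negMulLog (t + (A - 1)⁻¹)) volume 0 x :=
    (by fun_prop : Continuous fun t => Real.negMulLog (t + (A - 1)⁻¹)).intervalIntegrable _ _
  have i2 : IntervalIntegrable Real.negMulLog volume 0 x := hc.intervalIntegrable _ _
  rw [intervalIntegral.integral_add intervalIntegrable_const ((i1.sub i2).const_mul _),
    intervalIntegral.integral_const_mul, intervalIntegral.integral_sub i1 i2,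
    intervalIntegral.integral_comp_add_right (fun t => Real.negMulLog t), intervalIntegral.integral_const,
    integral_negMulLog_interval (by positivity) (by linarith), integral_negMulLog_interval le_rfl hx.le,
    ampPrimitive, diffPrimitive, Real.log_div hA1.ne' (by linarith)]
  have e1 : x + (A - 1)⁻¹ = (1 + x * (A - 1)) / (A - 1) := by field_simp; ring
  rw [e1, Real.log_div (by positivity) hA1.ne', Real.log_mul hx.ne' hA1.ne', zero_add, Real.log_inv]
  simp only [smul_eq_mul, sub_zero]
  field_simp
  ring

theorem eval_scaledPoly (cl cs : ℝ) (n : ℕ) (x : ℝ) :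
    (scaledPoly cl cs n).eval x = ((n : ℝ) / (cl * Real.log n))⁻¹ *
      (minMaxPoly (degree cs n)).eval ((n : ℝ) / (cl * Real.log n) * x)
        + Real.log ((n : ℝ) / (cl * Real.log n)) * x := by
  simp [scaledPoly]

/-- Since `h(rx) = r h(x) - r x log r`, the linear term of `scaledPoly` is matched exactly and the
error on `[0,1]` is only multiplied by `1/r`. -/
theorem abs_negMulLog_sub_scaledPoly_le {cl cs : ℝ} {n : ℕ} (hd : 1 ≤ degree cs n) {r : ℝ}
    (hr : r = (n : ℝ) / (cl * Real.log n)) (hr0 : 0 < r) {x : ℝ} (hx : 0 ≤ x) (hx' : x ≤ r⁻¹) :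
    |Real.negMulLog x - (scaledPoly cl cs n).eval x| ≤ r⁻¹ * (1 / (degree cs n : ℝ) ^ 2) := by
  have hrx : r * x ∈ Set.Icc (0 : ℝ) 1 :=
    ⟨by positivity, by rw [← mul_inv_cancel₀ hr0.ne']; gcongr⟩
  have h := abs_negMulLog_sub_minMaxPoly_le _ hd hrx
  have e : Real.negMulLog x - (scaledPoly cl cs n).eval x = r⁻¹ *
      (Real.negMulLog (r * x) - (minMaxPoly (degree cs n)).eval (r * x)) := by
    rw [eval_scaledPoly, ← hr, Real.negMulLog_mul, Real.negMulLog, Real.negMulLog]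
    field_simp
    ring
  rw [e, abs_mul, abs_of_pos (inv_pos.2 hr0)]
  gcongr

theorem eval_derivPoly (cl cs ε : ℝ) (n : ℕ) (x : ℝ) :
    (derivPoly cl cs ε n).eval x = -Real.log ((ampSize ε n - 1) / ampSize ε n)
      + (ampSize ε n - 1) * ((scaledPoly cl cs n).eval (x + (ampSize ε n - 1)⁻¹)
        - (scaledPoly cl cs n).eval x) := by
  simp [derivPoly]

/-- With `e` the approximation error of `h` and `δ = 1/(A-1)`, the difference is `(A-1) ∫₀ˣ (e(t+δ)
- e(t)) dt`. The integral is at most `2ηx` pointwise, and at most `2ηδ` because it cancels to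
integrals over two windows of length `δ`. -/
theorem abs_primitive_sub_ampPrimitive_le {cl cs ε : ℝ} {n : ℕ} (hd : 1 ≤ degree cs n) {r : ℝ}
    (hr : r = (n : ℝ) / (cl * Real.log n)) (hr0 : 0 < r) (hA : 1 < ampSize ε n) {x : ℝ}
    (hx : 0 < x) (hx' : x + (ampSize ε n - 1)⁻¹ ≤ r⁻¹) :
    |∑ t ∈ Finset.Icc 1 (degree cs n), primitiveCoeff cl cs ε n t * x ^ t
        - ampPrimitive (ampSize ε n) x| ≤
      2 * (r⁻¹ * (1 / (degree cs n : ℝ) ^ 2)) * min 1 ((ampSize ε n - 1) * x) := by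
  set A := ampSize ε n
  set η := r⁻¹ * (1 / (degree cs n : ℝ) ^ 2)
  set δ := (A - 1)⁻¹ with hδ
  have hA1 : 0 < A - 1 := by linarith
  have hδ0 : 0 < δ := inv_pos.2 hA1
  set e : ℝ → ℝ := fun t => (scaledPoly cl cs n).eval t - Real.negMulLog t with he
  have hec : Continuous e := (scaledPoly cl cs n).continuous.sub Real.continuous_negMulLog
  have heb : ∀ t, 0 ≤ t → t ≤ x + δ → ‖e t‖ ≤ η := fun t h0 h1 => by
    rw [Real.norm_eq_abs, he, abs_sub_comm]
    exact abs_negMulLog_sub_scaledPoly_le hd hr hr0 h0 (h1.trans hx')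
  have i1 : IntervalIntegrable (fun t => e (t + δ)) volume 0 x :=
    (by fun_prop : Continuous fun t => e (t + δ)).intervalIntegrable _ _
  have i2 : ∀ a b, IntervalIntegrable e volume a b := fun a b => hec.intervalIntegrable _ _
  have key : ∑ t ∈ Finset.Icc 1 (degree cs n), primitiveCoeff cl cs ε n t * x ^ t
        - ampPrimitive A x = (A - 1) * ∫ t in (0 : ℝ)..x, (e (t + δ) - e t) := by
    rw [← integral_derivPoly cl cs ε n hd, ← integral_amp_eq hA hx,
      ← intervalIntegral.integral_const_mul, ← intervalIntegral.integral_sub]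
    · refine intervalIntegral.integral_congr fun t _ => ?_
      simp only [eval_derivPoly, he]
      ring
    · exact (derivPoly cl cs ε n).continuous.intervalIntegrable _ _
    · have := Real.continuous_negMulLog
      exact Continuous.intervalIntegrable (by fun_prop) _ _
  rw [key, abs_mul, abs_of_pos hA1]
  have b1 : |∫ t in (0 : ℝ)..x, (e (t + δ) - e t)| ≤ 2 * η * x := by
    have := intervalIntegral.norm_integral_le_of_norm_le_const (a := 0) (b := x) (C := 2 * η)
      (f := fun t => e (t + δ) - e t) fun t ht => ?_
    · rwa [sub_zero, abs_of_pos hx] at this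
    · rw [Set.uIoc_of_le hx.le] at ht
      refine (norm_sub_le _ _).trans ?_
      have := heb (t + δ) (by linarith [ht.1]) (by linarith [ht.2])
      have := heb t ht.1.le (by linarith [ht.2])
      linarith
  -- After the change of variable only the windows `[x, x+δ]` and `[0, δ]` remain.
  have b2 : |∫ t in (0 : ℝ)..x, (e (t + δ) - e t)| ≤ 2 * η * δ := by
    rw [intervalIntegral.integral_sub i1 (i2 _ _),
      intervalIntegral.integral_comp_add_right e, zero_add,
      intervalIntegral.integral_interval_sub_interval_comm' (i2 _ _) (i2 _ _) (i2 _ _)]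
    have c1 := intervalIntegral.norm_integral_le_of_norm_le_const (a := x) (b := x + δ) (C := η)
      (f := e) fun t ht => by
        rw [Set.uIoc_of_le (by linarith)] at ht
        exact heb t (by linarith [ht.1]) ht.2
    have c2 := intervalIntegral.norm_integral_le_of_norm_le_const (a := 0) (b := δ) (C := η)
      (f := e) fun t ht => by
        rw [Set.uIoc_of_le hδ0.le] at ht
        exact heb t ht.1.le (by linarith [ht.2])
    rw [add_sub_cancel_left, abs_of_pos hδ0] at c1
    rw [sub_zero, abs_of_pos hδ0] at c2
    rw [Real.norm_eq_abs] at c1 c2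
    refine (abs_sub _ _).trans ?_
    linarith
  have hη : 0 ≤ η := (norm_nonneg _).trans (heb 0 le_rfl (by linarith))
  rcases min_choice 1 ((A - 1) * x) with h | h <;> rw [h]
  · calc _ ≤ (A - 1) * (2 * η * δ) := by gcongr
      _ = _ := by rw [hδ]; field_simp
  · calc _ ≤ (A - 1) * (2 * η * x) := by gcongr
      _ = _ := by ring

/-! ### Coefficient bounds and the pointwise bound of the small-count estimator -/

theorem abs_eval_minMaxPoly_le (d : ℕ) (hd : 1 ≤ d) {x : ℝ} (hx : x ∈ Set.Icc (0 : ℝ) 1) :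
    |(minMaxPoly d).eval x| ≤ 2 := by
  have h := abs_negMulLog_sub_minMaxPoly_le d hd hx
  have h1 : 0 ≤ Real.negMulLog x := Real.negMulLog_nonneg hx.1 hx.2
  have h2 := negMulLog_le_tangent one_pos hx.1
  rw [Real.log_one] at h2
  have h3 : 1 / (d : ℝ) ^ 2 ≤ 1 := by
    rw [div_le_one (by positivity)]
    exact one_le_pow₀ (by exact_mod_cast hd)
  rw [abs_le] at h ⊢
  constructor <;> linarith [h.1, h.2, hx.1]

/-- Substituting `rX` removes the powers of `r` from the coefficients. The shift becomes `r/(A-1) ≤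
1`, so the majorant of the min-max polynomial is evaluated at points at most `2`, where it is at
most `2 · 17^d`; the two such values in the difference give the factor `4`. -/
theorem exists_coeff_derivPoly {cl cs ε : ℝ} {n : ℕ} (hd : 1 ≤ degree cs n) {r : ℝ}
    (hr : r = (n : ℝ) / (cl * Real.log n)) (hr1 : 1 ≤ r) (hrA : r ≤ ampSize ε n - 1) :
    ∃ w : ℕ → ℝ, (∀ l, (derivPoly cl cs ε n).coeff l = w l * r ^ l) ∧
      ∑ l ∈ Finset.range (degree cs n), |w l| ≤
        1 + Real.log r + 4 * (ampSize ε n - 1) / r * 17 ^ degree cs n := by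
  set A := ampSize ε n with hAdef
  have hr0 : 0 < r := by linarith
  have hA1 : 1 ≤ A - 1 := by linarith
  obtain ⟨P, hP, hP2⟩ := exists_majorizes hd (isMinMaxPoly_minMaxPoly (degree cs n)).1
    fun x hx => abs_eval_minMaxPoly_le _ hd hx
  set Q := minMaxPoly (degree cs n) with hQ
  set c := -Real.log ((A - 1) / A) + Real.log r
  set E : ℝ[X] := C c + C ((A - 1) / r) * (Q.comp (X + C (r * (A - 1)⁻¹)) - Q) with hE
  have heq : derivPoly cl cs ε n = E.comp (C r * X) := by
    refine Polynomial.funext fun x => ?_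
    rw [eval_derivPoly, eval_scaledPoly, eval_scaledPoly, ← hr, ← hAdef, ← hQ]
    simp only [hE, eval_comp, eval_add, eval_mul, eval_sub, eval_C, eval_X, c, mul_add]
    field_simp
    ring
  have hη0 : 0 ≤ r * (A - 1)⁻¹ := by positivity
  have hη1 : r * (A - 1)⁻¹ ≤ 1 := by
    rw [← div_eq_mul_inv, div_le_one (by linarith)]; exact hrA
  have hmaj := (Majorizes.const c).add ((Majorizes.const ((A - 1) / r)).mul ((hP.comp hη0).sub hP))
  refine ⟨E.coeff, fun l => ?_, (hmaj.sum_abs_coeff_le _).trans ?_⟩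
  · rw [heq, comp_C_mul_X_coeff]
  · simp only [eval_add, eval_mul, eval_C, eval_comp, eval_X]
    have hc : |c| ≤ 1 + Real.log r := by
      have h1 : 0 ≤ Real.log r := Real.log_nonneg hr1
      have h2 : -Real.log ((A - 1) / A) = Real.log (A / (A - 1)) := by
        rw [← Real.log_inv, inv_div]
      have h3 : 0 ≤ Real.log (A / (A - 1)) :=
        Real.log_nonneg ((one_le_div (by linarith)).2 (by linarith))
      have h4 := Real.log_le_sub_one_of_pos (by
        refine div_pos ?_ ?_ <;> linarith : 0 < A / (A - 1))
      have h5 : A / (A - 1) ≤ 2 := by rw [div_le_iff₀ (by linarith)]; linarith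
      have h6 : c = Real.log (A / (A - 1)) + Real.log r := by rw [← h2]
      rw [h6, abs_of_nonneg (by linarith)]
      linarith
    have h1 := hP.eval_mono (x := 1 + r * (A - 1)⁻¹) (y := 2) (by linarith) (by linarith)
    have h2 := hP.eval_mono (x := 1) (y := 2) (by norm_num) (by norm_num)
    rw [abs_of_nonneg (by positivity : 0 ≤ (A - 1) / r)]
    have h3 : (A - 1) / r * (P.eval (1 + r * (A - 1)⁻¹) + P.eval 1) ≤
        (A - 1) / r * (4 * 17 ^ degree cs n) := by
      gcongr
      linarith
    calc _ ≤ (1 + Real.log r) + (A - 1) / r * (4 * 17 ^ degree cs n) := add_le_add hc h3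
      _ = _ := by ring

theorem sum_Icc_one_eq_sum_range (f : ℕ → ℝ) (d : ℕ) :
    ∑ t ∈ Finset.Icc 1 d, f t = ∑ l ∈ Finset.range d, f (l + 1) := by
  rw [Finset.range_eq_Ico, Finset.sum_Ico_add' f 0 d 1, zero_add]
  rfl

/-- The condition `r N ≤ n` makes all remaining powers of `rN/n` at most one. One factor `N/n` is
kept: it makes the moments linear in `p_i`, so that they can be summed without a factor `k`. -/
theorem abs_smallEstimator_le {cl cs ε : ℝ} {n N : ℕ} {r W : ℝ} {w : ℕ → ℝ} (hr0 : 0 ≤ r)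
    (hw : ∀ l, (derivPoly cl cs ε n).coeff l = w l * r ^ l)
    (hW : ∑ l ∈ Finset.range (degree cs n), |w l| ≤ W) (hn : 0 < n) (hN : r * N ≤ n) :
    |smallEstimator cl cs ε n N| ≤ W * (N / n) := by
  have hn0 : (0 : ℝ) < n := by exact_mod_cast hn
  rw [smallEstimator, sum_Icc_one_eq_sum_range]
  refine (Finset.abs_sum_le_sum_abs _ _).trans (le_trans ?_
    (mul_le_mul_of_nonneg_right hW (by positivity)))
  rw [Finset.sum_mul]
  refine Finset.sum_le_sum fun l _ => ?_
  rw [primitiveCoeff, Nat.add_sub_cancel, hw, abs_mul, abs_div, abs_mul,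
    abs_of_nonneg (pow_nonneg hr0 l), abs_of_nonneg (by positivity : (0 : ℝ) ≤ ((l + 1 : ℕ) : ℝ)),
    abs_of_nonneg (by positivity : (0 : ℝ) ≤ (N.descFactorial (l + 1) : ℝ) / (n : ℝ) ^ (l + 1))]
  have h1 : |w l| * r ^ l / ((l + 1 : ℕ) : ℝ) ≤ |w l| * r ^ l :=
    div_le_self (by positivity) (by push_cast; linarith [l.cast_nonneg (α := ℝ)])
  have h2 : (N.descFactorial (l + 1) : ℝ) ≤ (N : ℝ) ^ (l + 1) := by
    exact_mod_cast Nat.descFactorial_le_pow N (l + 1)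
  calc _ ≤ |w l| * r ^ l * ((N : ℝ) ^ (l + 1) / (n : ℝ) ^ (l + 1)) := by gcongr
    _ = |w l| * (r * N / n) ^ l * (N / n) := by rw [div_pow, mul_pow]; field_simp; ring
    _ ≤ |w l| * 1 * (N / n) := by
        gcongr
        exact pow_le_one₀ (by positivity) ((div_le_one hn0).2 hN)
    _ = _ := by ring

/-! ### Moments and tails of the Poisson distribution -/

/-- The weight identity behind `E[N^{\underline t} f(N)] = l^t E[f(N + t)]`. -/
theorem poisson_weight_shift (l : NNReal) (t k : ℕ) :
    Real.exp (-l) * (l : ℝ) ^ (k + t) / ((k + t).factorial : ℝ) * ((k + t).descFactorial t : ℝ)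
      = (l : ℝ) ^ t * (Real.exp (-l) * (l : ℝ) ^ k / (k.factorial : ℝ)) := by
  have h := Nat.factorial_mul_descFactorial (Nat.le_add_left t k)
  rw [Nat.add_sub_cancel] at h
  have h' : ((k + t).factorial : ℝ) = k.factorial * (k + t).descFactorial t := by
    exact_mod_cast h.symm
  have h1 : (k.factorial : ℝ) ≠ 0 := by positivity
  have h2 : ((k + t).descFactorial t : ℝ) ≠ 0 := by
    have : 0 < (k + t).descFactorial t := Nat.descFactorial_pos.2 (Nat.le_add_left t k)
    positivity
  rw [h', pow_add]
  field_simp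

theorem integrable_descFactorial_mul (l : NNReal) (t : ℕ) {f : ℕ → ℝ}
    (hf : Integrable (fun N => f (N + t)) (poissonMeasure l)) :
    Integrable (fun N => (N.descFactorial t : ℝ) * f N) (poissonMeasure l) := by
  rw [integrable_poissonMeasure_iff] at hf ⊢
  refine (summable_nat_add_iff t).1 ?_
  convert! hf.mul_left ((l : ℝ) ^ t) using 1
  funext k
  rw [norm_mul, Real.norm_of_nonneg (by positivity : (0 : ℝ) ≤ ((k + t).descFactorial t : ℝ)),
    ← mul_assoc, poisson_weight_shift, mul_assoc]

theorem integral_descFactorial_mul (l : NNReal) (t : ℕ) {f : ℕ → ℝ}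
    (hf : Integrable (fun N => f (N + t)) (poissonMeasure l)) :
    ∫ N, (N.descFactorial t : ℝ) * f N ∂(poissonMeasure l)
      = (l : ℝ) ^ t * ∫ N, f (N + t) ∂(poissonMeasure l) := by
  have h1 := hasSum_integral_poissonMeasure (integrable_descFactorial_mul l t hf)
  have h2 := (hasSum_integral_poissonMeasure hf).mul_left ((l : ℝ) ^ t)
  have h3 := (hasSum_nat_add_iff' t).2 h1
  have h4 : ∑ i ∈ Finset.range t, (Real.exp (-l) * (l : ℝ) ^ i / (i.factorial : ℝ)) •
      ((i.descFactorial t : ℝ) * f i) = 0 := Finset.sum_eq_zero fun i hi => by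
    rw [Nat.descFactorial_of_lt (Finset.mem_range.1 hi)]; simp
  rw [h4, sub_zero] at h3
  refine h3.unique ?_
  convert! h2 using 1
  funext k
  rw [smul_eq_mul, smul_eq_mul, ← mul_assoc, poisson_weight_shift, mul_assoc]

theorem integrable_descFactorial (l : NNReal) (t : ℕ) :
    Integrable (fun N => (N.descFactorial t : ℝ)) (poissonMeasure l) := by
  simpa using integrable_descFactorial_mul l t (f := fun _ => 1) (integrable_const _)

theorem integral_descFactorial (l : NNReal) (t : ℕ) :
    ∫ N, (N.descFactorial t : ℝ) ∂(poissonMeasure l) = (l : ℝ) ^ t := by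
  simpa using integral_descFactorial_mul l t (f := fun _ => 1) (integrable_const _)

theorem hasSum_exp_poisson (l : NNReal) (s : ℝ) :
    HasSum (fun n : ℕ => Real.exp (-l) * (l : ℝ) ^ n / (n.factorial : ℝ) * Real.exp (s * n))
      (Real.exp (l * (Real.exp s - 1))) := by
  have h := (NormedSpace.expSeries_div_hasSum_exp ((l : ℝ) * Real.exp s)).mul_left (Real.exp (-l))
  rw [← Real.exp_eq_exp_ℝ, ← Real.exp_add] at h
  convert! h using 1
  · funext n
    rw [mul_pow, ← Real.exp_nat_mul, mul_comm s]
    ring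
  · congr 1; ring

theorem integrable_exp_poisson (l : NNReal) (s : ℝ) :
    Integrable (fun N : ℕ => Real.exp (s * N)) (poissonMeasure l) := by
  rw [integrable_poissonMeasure_iff]
  convert! (hasSum_exp_poisson l s).summable using 1
  funext n
  rw [Real.norm_of_nonneg (Real.exp_pos _).le]

theorem integral_exp_poisson (l : NNReal) (s : ℝ) :
    ∫ N : ℕ, Real.exp (s * N) ∂(poissonMeasure l) = Real.exp (l * (Real.exp s - 1)) :=
  (hasSum_integral_poissonMeasure (integrable_exp_poisson l s)).unique (hasSum_exp_poisson l s)

theorem cast_descFactorial_succ (N t : ℕ) :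
    (N.descFactorial (t + 1) : ℝ) = ((N : ℝ) - t) * N.descFactorial t := by
  rw [Nat.descFactorial_succ]
  rcases lt_or_ge N t with h | h
  · rw [Nat.descFactorial_of_lt h]; simp
  · push_cast [Nat.cast_sub h]; ring

theorem poisson_quartic (l : NNReal) (a₀ a₁ a₂ a₃ a₄ : ℝ) :
    Integrable (fun N : ℕ => a₀ + a₁ * N + a₂ * (N : ℝ) ^ 2 + a₃ * (N : ℝ) ^ 3 + a₄ * (N : ℝ) ^ 4)
      (poissonMeasure l) ∧
    ∫ N : ℕ, (a₀ + a₁ * N + a₂ * (N : ℝ) ^ 2 + a₃ * (N : ℝ) ^ 3 + a₄ * (N : ℝ) ^ 4)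
      ∂(poissonMeasure l) = a₀ + a₁ * l + a₂ * ((l : ℝ) ^ 2 + l)
        + a₃ * ((l : ℝ) ^ 3 + 3 * (l : ℝ) ^ 2 + l)
        + a₄ * ((l : ℝ) ^ 4 + 6 * (l : ℝ) ^ 3 + 7 * (l : ℝ) ^ 2 + l) := by
  -- Powers are expanded in falling factorials; the coefficients `1, 3, 7, 6` are Stirling numbers
  -- of the second kind.
  have e : (fun N : ℕ => a₀ + a₁ * N + a₂ * (N : ℝ) ^ 2 + a₃ * (N : ℝ) ^ 3 + a₄ * (N : ℝ) ^ 4) =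
      fun N : ℕ => ∑ i : Fin 5, ![a₀, a₁ + a₂ + a₃ + a₄, a₂ + 3 * a₃ + 7 * a₄, a₃ + 6 * a₄, a₄] i
        * (N.descFactorial (i : ℕ) : ℝ) := by
    funext N
    rw [Fin.sum_univ_five]
    change _ = a₀ * (N.descFactorial 0 : ℝ) + (a₁ + a₂ + a₃ + a₄) * (N.descFactorial (0 + 1) : ℝ)
      + (a₂ + 3 * a₃ + 7 * a₄) * (N.descFactorial (1 + 1) : ℝ)
      + (a₃ + 6 * a₄) * (N.descFactorial (2 + 1) : ℝ) + a₄ * (N.descFactorial (3 + 1) : ℝ)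
    rw [cast_descFactorial_succ N 3, cast_descFactorial_succ N 2, cast_descFactorial_succ N 1,
      cast_descFactorial_succ N 0, Nat.descFactorial_zero]
    push_cast
    ring
  have hi : ∀ i ∈ Finset.univ, Integrable (fun N : ℕ =>
      ![a₀, a₁ + a₂ + a₃ + a₄, a₂ + 3 * a₃ + 7 * a₄, a₃ + 6 * a₄, a₄] i
        * (N.descFactorial ((i : Fin 5) : ℕ) : ℝ)) (poissonMeasure l) :=
    fun i _ => (integrable_descFactorial l i).const_mul _
  rw [e]
  refine ⟨integrable_finsetSum _ hi, ?_⟩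
  rw [integral_finsetSum _ hi]
  simp only [integral_const_mul, integral_descFactorial]
  simp [Fin.sum_univ_succ]
  ring

theorem integrable_cast_poisson (l : NNReal) :
    Integrable (fun N : ℕ => (N : ℝ)) (poissonMeasure l) := by
  simpa using (poisson_quartic l 0 1 0 0 0).1

theorem integral_cast_poisson (l : NNReal) : ∫ N : ℕ, (N : ℝ) ∂(poissonMeasure l) = l := by
  simpa using (poisson_quartic l 0 1 0 0 0).2

theorem integrable_sq_poisson (l : NNReal) :
    Integrable (fun N : ℕ => (N : ℝ) ^ 2) (poissonMeasure l) := by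
  simpa using (poisson_quartic l 0 0 1 0 0).1

theorem integral_sq_poisson (l : NNReal) :
    ∫ N : ℕ, (N : ℝ) ^ 2 ∂(poissonMeasure l) = (l : ℝ) ^ 2 + l := by
  simpa using (poisson_quartic l 0 0 1 0 0).2

/-- Chernoff bound with exponential parameter `-1`. -/
theorem poisson_lower_tail (l : NNReal) (a : ℝ) :
    (poissonMeasure l).real {N : ℕ | (N : ℝ) ≤ a} ≤ Real.exp (a - l * (1 - Real.exp (-1))) := by
  have h1 : (poissonMeasure l).real {N : ℕ | (N : ℝ) ≤ a} ≤
      ∫ N : ℕ, Real.exp a * Real.exp (-1 * N) ∂(poissonMeasure l) := by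
    rw [← integral_indicator_one (MeasurableSet.of_discrete)]
    refine integral_mono ((integrable_const _).indicator MeasurableSet.of_discrete)
      ((integrable_exp_poisson l (-1)).const_mul _) fun N => ?_
    by_cases h : (N : ℝ) ≤ a
    · rw [Set.indicator_of_mem (by exact h)]
      simp only [Pi.one_apply]
      rw [← Real.exp_add]
      exact Real.one_le_exp (by linarith)
    · rw [Set.indicator_of_notMem (by exact h)]
      positivity
  rw [integral_const_mul, integral_exp_poisson, ← Real.exp_add] at h1
  refine h1.trans (le_of_eq ?_)
  congr 1; ring

theorem poisson_markov (l : NNReal) {a : ℝ} (ha : 0 < a) :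
    (poissonMeasure l).real {N : ℕ | a < (N : ℝ)} ≤ l / a := by
  have h1 : (poissonMeasure l).real {N : ℕ | a < (N : ℝ)} ≤
      ∫ N : ℕ, (N : ℝ) / a ∂(poissonMeasure l) := by
    rw [← integral_indicator_one (MeasurableSet.of_discrete)]
    refine integral_mono ((integrable_const _).indicator MeasurableSet.of_discrete)
      ((integrable_cast_poisson l).div_const _) fun N => ?_
    by_cases h : a < (N : ℝ)
    · rw [Set.indicator_of_mem (by exact h)]
      simp only [Pi.one_apply]
      exact (one_le_div ha).2 h.le
    · rw [Set.indicator_of_notMem (by exact h)]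
      positivity
  rwa [integral_div, integral_cast_poisson] at h1

/-! ### The small-count estimator under the Poisson law -/

section Small

variable {cl cs ε : ℝ} {n : ℕ} {r W T x : ℝ} {w : ℕ → ℝ} {l : NNReal}

theorem integrable_smallEstimator :
    Integrable (fun N => smallEstimator cl cs ε n N) (poissonMeasure l) :=
  integrable_finsetSum _ fun t _ => ((integrable_descFactorial l t).div_const _).const_mul _

theorem integral_smallEstimator (hn : 0 < n) (hl : (l : ℝ) = n * x) :
    ∫ N, smallEstimator cl cs ε n N ∂(poissonMeasure l) =
      ∑ t ∈ Finset.Icc 1 (degree cs n), primitiveCoeff cl cs ε n t * x ^ t := by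
  have hn0 : (n : ℝ) ≠ 0 := by positivity
  simp only [smallEstimator]
  rw [integral_finsetSum _ fun t _ => ((integrable_descFactorial l t).div_const _).const_mul _]
  refine Finset.sum_congr rfl fun t _ => ?_
  rw [integral_const_mul, integral_div, integral_descFactorial, hl, mul_pow]
  field_simp

/-- Without cutoff the estimator is unbiased, so the difference is the contribution of `N > T`.
There `1 ≤ e^{N-T}`, and factorial moments with this exponential weight are explicit; `rx ≤ 1`
absorbs the powers of `r` and leaves one factor `x`. -/
theorem abs_integral_indicator_sub_le (hr0 : 0 ≤ r)
    (hw : ∀ l, (derivPoly cl cs ε n).coeff l = w l * r ^ l)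
    (hW : ∑ l ∈ Finset.range (degree cs n), |w l| ≤ W) (hn : 0 < n) (hl : (l : ℝ) = n * x)
    (hx : 0 ≤ x) (hrx : r * x ≤ 1) :
    |∫ N : ℕ, {N : ℕ | (N : ℝ) ≤ T}.indicator (fun N => smallEstimator cl cs ε n N) N
        ∂(poissonMeasure l)
      - ∑ t ∈ Finset.Icc 1 (degree cs n), primitiveCoeff cl cs ε n t * x ^ t| ≤
      W * x * Real.exp (degree cs n + l * (Real.exp 1 - 1) - T) := by
  have hn0 : (0 : ℝ) < n := by exact_mod_cast hn
  have hexp : ∀ t : ℕ, Integrable (fun N : ℕ => Real.exp (((N + t : ℕ) : ℝ) - T))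
      (poissonMeasure l) ∧ ∫ N : ℕ, Real.exp (((N + t : ℕ) : ℝ) - T) ∂(poissonMeasure l)
        = Real.exp (t + l * (Real.exp 1 - 1) - T) := by
    intro t
    have e : (fun N : ℕ => Real.exp (((N + t : ℕ) : ℝ) - T))
        = fun N : ℕ => Real.exp (t - T) * Real.exp (1 * N) := by
      funext N; rw [← Real.exp_add]; push_cast; congr 1; ring
    rw [e]
    refine ⟨(integrable_exp_poisson l 1).const_mul _, ?_⟩
    rw [integral_const_mul, integral_exp_poisson, ← Real.exp_add]
    congr 1; ring
  have hD := fun t => integrable_descFactorial_mul l t (f := fun N => Real.exp ((N : ℝ) - T))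
    (hexp t).1
  have hterm : ∀ t : ℕ, Integrable (fun N : ℕ => |primitiveCoeff cl cs ε n t| / (n : ℝ) ^ t *
      ((N.descFactorial t : ℝ) * Real.exp ((N : ℝ) - T))) (poissonMeasure l) :=
    fun t => (hD t).const_mul _
  rw [← integral_smallEstimator hn hl, abs_sub_comm, ← integral_sub integrable_smallEstimator
    (integrable_smallEstimator.indicator MeasurableSet.of_discrete)]
  have hbound : ∀ N : ℕ, |smallEstimator cl cs ε n N -
      {N : ℕ | (N : ℝ) ≤ T}.indicator (fun N => smallEstimator cl cs ε n N) N| ≤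
      ∑ t ∈ Finset.Icc 1 (degree cs n), |primitiveCoeff cl cs ε n t| / (n : ℝ) ^ t *
        ((N.descFactorial t : ℝ) * Real.exp ((N : ℝ) - T)) := by
    intro N
    by_cases h : (N : ℝ) ≤ T
    · rw [Set.indicator_of_mem (by exact h), sub_self, abs_zero]
      positivity
    · rw [Set.indicator_of_notMem (by exact h), sub_zero, smallEstimator]
      refine (Finset.abs_sum_le_sum_abs _ _).trans (Finset.sum_le_sum fun t _ => ?_)
      rw [abs_mul, abs_of_nonneg (by positivity : (0 : ℝ) ≤ (N.descFactorial t : ℝ) / (n : ℝ) ^ t)]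
      have : 1 ≤ Real.exp ((N : ℝ) - T) := Real.one_le_exp (by linarith)
      calc |primitiveCoeff cl cs ε n t| * ((N.descFactorial t : ℝ) / (n : ℝ) ^ t)
          = |primitiveCoeff cl cs ε n t| / (n : ℝ) ^ t * ((N.descFactorial t : ℝ) * 1) := by ring
        _ ≤ _ := by gcongr
  refine (abs_integral_le_integral_abs).trans ((integral_mono
    (integrable_smallEstimator.sub
      (integrable_smallEstimator.indicator MeasurableSet.of_discrete)).abs
    (integrable_finsetSum _ fun t _ => hterm t) hbound).trans ?_)
  rw [integral_finsetSum _ fun t _ => hterm t]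
  simp only [integral_const_mul]
  have hW' : ∑ k ∈ Finset.range (degree cs n), |w k| * (x * Real.exp (degree cs n
      + l * (Real.exp 1 - 1) - T)) ≤ W * x * Real.exp (degree cs n + l * (Real.exp 1 - 1) - T) := by
    rw [← Finset.sum_mul, mul_assoc]
    gcongr
  refine le_trans ?_ hW'
  rw [sum_Icc_one_eq_sum_range]
  refine Finset.sum_le_sum fun k hk => ?_
  have hk : k + 1 ≤ degree cs n := Finset.mem_range.1 hk
  rw [integral_descFactorial_mul l (k + 1) (f := fun N => Real.exp ((N : ℝ) - T)) (hexp (k + 1)).1,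
    (hexp (k + 1)).2, primitiveCoeff, Nat.add_sub_cancel, hw, abs_div, abs_mul,
    abs_of_nonneg (pow_nonneg hr0 k), abs_of_nonneg (by positivity : (0 : ℝ) ≤ ((k + 1 : ℕ) : ℝ)), hl]
  have h1 : |w k| * r ^ k / ((k + 1 : ℕ) : ℝ) ≤ |w k| * r ^ k :=
    div_le_self (by positivity) (by push_cast; linarith [k.cast_nonneg (α := ℝ)])
  have h2 : Real.exp ((k + 1 : ℕ) + n * x * (Real.exp 1 - 1) - T) ≤
      Real.exp (degree cs n + n * x * (Real.exp 1 - 1) - T) := by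
    have : ((k + 1 : ℕ) : ℝ) ≤ degree cs n := by exact_mod_cast hk
    gcongr
  calc _ ≤ |w k| * r ^ k / (n : ℝ) ^ (k + 1) * ((n * x) ^ (k + 1) *
        Real.exp (degree cs n + n * x * (Real.exp 1 - 1) - T)) := by gcongr
    _ = |w k| * (r * x) ^ k * (x * Real.exp (degree cs n + n * x * (Real.exp 1 - 1) - T)) := by
        rw [mul_pow, mul_pow]; field_simp; ring
    _ ≤ |w k| * 1 * (x * Real.exp (degree cs n + n * x * (Real.exp 1 - 1) - T)) := by
        gcongr
        exact pow_le_one₀ (by positivity) hrx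
    _ = _ := by ring

end Small

/-! ### The counts of a Poisson sample are independent Poisson variables -/

/-- Both sides are the coefficient of `X^c` in `(∑ X_i)^m`: once by expanding the product over
sequences, once by the multinomial theorem. -/
theorem card_filter_count_eq {k m : ℕ} (c : Fin k → ℕ) (hc : ∑ i, c i = m) :
    (Finset.univ.filter fun x : Fin m → Fin k => count x = c).card
      = Nat.multinomial Finset.univ c := by
  classical
  set d : Fin k →₀ ℕ := Finsupp.equivFunOnFinite.symm c with hd
  have hdc : ∀ i, d i = c i := fun i => rfl
  have h := MvPolynomial.coeff_sum_X_pow_of_fintype (R := ℕ) d m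
  have hsum : d.sum (fun _ m => m) = m := by
    rw [Finsupp.sum_fintype _ _ (fun _ => rfl), ← hc]
    exact Finset.sum_congr rfl fun i _ => hdc i
  rw [if_pos hsum, Finsupp.multinomial_eq_of_support_subset (Finset.subset_univ _),
    Fintype.sum_pow, MvPolynomial.coeff_sum] at h
  have hterm : ∀ x : Fin m → Fin k, MvPolynomial.coeff d (∏ j, (MvPolynomial.X (x j) :
      MvPolynomial (Fin k) ℕ)) = if count x = c then 1 else 0 := by
    intro x
    have e : ∏ j, (MvPolynomial.X (x j) : MvPolynomial (Fin k) ℕ)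
        = MvPolynomial.monomial (∑ j, Finsupp.single (x j) 1) 1 := by
      simp only [MvPolynomial.X]
      rw [MvPolynomial.monomial_sum_one]
    rw [e, MvPolynomial.coeff_monomial]
    have hiff : (∑ j, Finsupp.single (x j) 1 = d) ↔ count x = c := by
      rw [DFunLike.ext_iff, funext_iff]
      refine forall_congr' fun i => ?_
      rw [hdc, Finsupp.finsetSum_apply, count, Finset.card_filter]
      simp only [Finsupp.single_apply]
    simp only [hiff]
  simp only [hterm] at h
  rw [Finset.card_filter]
  simpa [hd] using h

theorem sum_count {k m : ℕ} (x : Fin m → Fin k) : ∑ i, count x i = m := by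
  simp only [count]
  rw [← Finset.card_eq_sum_card_fiberwise (fun j _ => Finset.mem_univ (x j))]
  simp

theorem iidLaw_singleton {k m : ℕ} (p : PMF (Fin k)) (x : Fin m → Fin k) :
    iidLaw p m {x} = ∏ i, p i ^ count x i := by
  rw [iidLaw, Measure.pi_singleton]
  simp only [PMF.toMeasure_apply_singleton _ _ (MeasurableSet.singleton _), count]
  rw [← Finset.prod_fiberwise (s := Finset.univ) (g := x) (f := fun j => p (x j))]
  refine Finset.prod_congr rfl fun i _ => ?_
  rw [Finset.prod_congr rfl (fun j hj => by rw [(Finset.mem_filter.1 hj).2]), Finset.prod_const]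

theorem iidLaw_count_eq {k m : ℕ} (p : PMF (Fin k)) (c : Fin k → ℕ) :
    iidLaw p m {x | count x = c} =
      if ∑ i, c i = m then (Nat.multinomial Finset.univ c : ENNReal) * ∏ i, p i ^ c i else 0 := by
  classical
  have hset : {x : Fin m → Fin k | count x = c}
      = ((Finset.univ.filter fun x : Fin m → Fin k => count x = c) : Set (Fin m → Fin k)) := by
    ext; simp
  split_ifs with h
  · rw [hset, ← sum_measure_singleton]
    rw [Finset.sum_congr rfl fun x hx => by
      rw [iidLaw_singleton, (Finset.mem_filter.1 hx).2], Finset.sum_const, card_filter_count_eq c h,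
      nsmul_eq_mul]
  · have : {x : Fin m → Fin k | count x = c} = ∅ := by
      ext x
      simp only [Set.mem_ofPred_eq, Set.mem_empty_iff_false, iff_false]
      rintro rfl
      exact h (sum_count x)
    rw [this, measure_empty]

/-- Every fibre of `Sample k` is finite and discrete, so every set is measurable. -/
theorem measurable_of_sigma {k : ℕ} {β : Type*} [MeasurableSpace β] (f : Sample k → β) :
    Measurable f := by
  intro s _
  refine MeasurableSpace.measurableSet_iInf.2 fun m => ?_
  exact (MeasurableSet.of_discrete : MeasurableSet
    {x : Fin m → Fin k | f ⟨m, x⟩ ∈ s})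

/-- The rate of the Poisson law of the number of occurrences of `i`. -/
noncomputable def rate {k : ℕ} (p : PMF (Fin k)) (n : ℕ) (i : Fin k) : NNReal :=
  n * (p i).toNNReal

theorem coe_rate {k : ℕ} (p : PMF (Fin k)) (n : ℕ) (i : Fin k) :
    (rate p n i : ℝ) = n * (p i).toReal := by
  simp [rate, ENNReal.coe_toNNReal_eq_toReal]

theorem sum_toReal_pmf {k : ℕ} (p : PMF (Fin k)) : ∑ i, (p i).toReal = 1 := by
  rw [← ENNReal.toReal_sum fun i _ => p.apply_ne_top i, ← tsum_fintype (L := .unconditional _), p.tsum_coe]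
  simp

/-- Poisson splitting. Only the length `m = ∑ c_i` contributes to a vector `c`; there `m!` cancels
against the multinomial coefficient and `e^{-n} = ∏ e^{-n p_i}`. -/
theorem map_count_poissonSampleLaw {k : ℕ} (p : PMF (Fin k)) (n : ℕ) :
    (poissonSampleLaw p n).map (fun z => count z.2)
      = Measure.pi fun i => poissonMeasure (rate p n i) := by
  refine Measure.ext_of_singleton fun c => ?_
  rw [Measure.map_apply (measurable_of_sigma _) (MeasurableSet.singleton _), poissonSampleLaw,
    Measure.sum_apply _ (measurable_of_sigma _ (MeasurableSet.singleton _)), Measure.pi_singleton]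
  have h1 : ∀ m : ℕ, (poissonMeasure (n : NNReal) {m} •
      (iidLaw p m).map fun x => (⟨m, x⟩ : Sample k)) ((fun z : Sample k => count z.2) ⁻¹' {c})
      = if m = ∑ i, c i then poissonMeasure (n : NNReal) {m} *
        ((Nat.multinomial Finset.univ c : ENNReal) * ∏ i, p i ^ c i) else 0 := by
    intro m
    rw [Measure.smul_apply, Measure.map_apply (measurable_sigmaMk m)
      (measurable_of_sigma _ (MeasurableSet.singleton _)), smul_eq_mul]
    have : (fun x => (⟨m, x⟩ : Sample k)) ⁻¹' ((fun z : Sample k => count z.2) ⁻¹' {c})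
        = {x : Fin m → Fin k | count x = c} := rfl
    rw [this, iidLaw_count_eq]
    by_cases h : m = ∑ i, c i
    · rw [if_pos h, if_pos h.symm]
    · rw [if_neg h, if_neg (Ne.symm h), mul_zero]
  simp only [h1]
  rw [tsum_ite_eq]
  have h2 : ∀ i, p i = ENNReal.ofReal (p i).toReal := fun i =>
    (ENNReal.ofReal_toReal (p.apply_ne_top i)).symm
  have h3 : ∏ i, p i ^ c i = ENNReal.ofReal (∏ i, (p i).toReal ^ c i) := by
    rw [ENNReal.ofReal_prod_of_nonneg fun i _ => by positivity]
    exact Finset.prod_congr rfl fun i _ => by rw [ENNReal.ofReal_pow (by positivity), ← h2]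
  simp only [poissonMeasure_singleton]
  rw [← ENNReal.ofReal_prod_of_nonneg fun i _ => by positivity, h3, ← ENNReal.ofReal_natCast,
    ← ENNReal.ofReal_mul (by positivity), ← ENNReal.ofReal_mul (by positivity)]
  congr 1
  have h4 : (∏ i, ((c i).factorial : ℝ)) * (Nat.multinomial Finset.univ c : ℝ)
      = ((∑ i, c i).factorial : ℝ) := by exact_mod_cast Nat.multinomial_spec Finset.univ c
  have h5 : (∏ i, ((c i).factorial : ℝ)) ≠ 0 :=
    Finset.prod_ne_zero_iff.2 fun i _ => by positivity
  have h6 : (Nat.multinomial Finset.univ c : ℝ) ≠ 0 := by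
    have := Nat.multinomial_pos Finset.univ c
    positivity
  simp only [coe_rate, NNReal.coe_natCast]
  rw [Finset.prod_div_distrib, Finset.prod_mul_distrib, ← Real.exp_sum, ← h4,
    Finset.sum_neg_distrib, ← Finset.mul_sum, sum_toReal_pmf, mul_one]
  simp only [mul_pow]
  rw [Finset.prod_mul_distrib, Finset.prod_pow_eq_pow_sum]
  field_simp

theorem measurePreserving_count_pair {k : ℕ} (p : PMF (Fin k)) (n : ℕ) :
    MeasurePreserving (fun z : Sample k × Sample k => fun i => (count z.1.2 i, count z.2.2 i))
      (pairLaw p n)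
      (Measure.pi fun i => (poissonMeasure (rate p n i)).prod (poissonMeasure (rate p n i))) := by
  have h1 : MeasurePreserving (fun z : Sample k × Sample k => (count z.1.2, count z.2.2))
      (pairLaw p n) ((Measure.pi fun i => poissonMeasure (rate p n i)).prod
        (Measure.pi fun i => poissonMeasure (rate p n i))) := by
    have hm : Measurable fun z : Sample k => count z.2 := measurable_of_sigma _
    refine ⟨hm.prodMap hm, ?_⟩
    rw [← map_count_poissonSampleLaw]
    exact (Measure.map_prod_map _ _ hm hm).symm
  exact (MeasurePreserving.symm _ (measurePreserving_arrowProdEquivProdArrow ℕ ℕ (Fin k)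
    (fun i => poissonMeasure (rate p n i)) (fun i => poissonMeasure (rate p n i)))).comp h1

/-- Mean absolute error of a sum of functions of the independent coordinates. -/
theorem integral_abs_sum_sub_le {ι α : Type*} [Fintype ι] [MeasurableSpace α]
    (μ : ι → Measure α) [∀ i, IsProbabilityMeasure (μ i)] (g : α → ℝ)
    (hg : Measurable g) (hg2 : ∀ i, MemLp g 2 (μ i)) (H : ℝ) (c V : ι → ℝ)
    (hV : ∀ i, ∫ a, (g a - c i) ^ 2 ∂(μ i) ≤ V i) :
    Integrable (fun ω : ι → α => ∑ i, g (ω i) - H) (Measure.pi μ) ∧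
      ∫ ω : ι → α, |∑ i, g (ω i) - H| ∂(Measure.pi μ) ≤
        √(∑ i, V i) + |∑ i, ∫ a, g a ∂(μ i) - H| := by
  have hX : ∀ i, MemLp (fun ω : ι → α => g (ω i)) 2 (Measure.pi μ) := fun i =>
    (hg2 i).comp_measurePreserving (measurePreserving_eval μ i)
  have hinteg : ∀ i, ∫ ω : ι → α, g (ω i) ∂(Measure.pi μ) = ∫ a, g a ∂(μ i) := fun i => by
    rw [← (measurePreserving_eval μ i).map_eq, integral_map (measurable_pi_apply i).aemeasurable
      hg.aestronglyMeasurable]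
  set S : (ι → α) → ℝ := fun ω => ∑ i, g (ω i) with hS
  have hS2 : MemLp S 2 (Measure.pi μ) := memLp_finsetSum _ fun i _ => hX i
  have hSi : Integrable S (Measure.pi μ) := hS2.integrable (by norm_num)
  have hES : ∫ ω, S ω ∂(Measure.pi μ) = ∑ i, ∫ a, g a ∂(μ i) := by
    rw [hS, integral_finsetSum _ fun i _ => (hX i).integrable (by norm_num)]
    exact Finset.sum_congr rfl fun i _ => hinteg i
  have hvar : Var[S; Measure.pi μ] ≤ ∑ i, V i := by
    have h := variance_sum_pi (μ := μ) (X := fun _ => g) hg2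
    have hS' : S = ∑ i, fun ω : ι → α => g (ω i) := by funext ω; simp [hS]
    rw [hS', h]
    -- The variance does not exceed the mean square about any centre `c i`.
    refine Finset.sum_le_sum fun i _ => le_trans ?_ (hV i)
    rw [← variance_sub_const (hg2 i).aestronglyMeasurable (c i)]
    exact variance_le_expectation_sq ((hg2 i).aestronglyMeasurable.sub aestronglyMeasurable_const)
  refine ⟨hSi.sub (integrable_const H), ?_⟩
  set e := ∫ ω, S ω ∂(Measure.pi μ) with he
  have hY : MemLp (fun ω => |S ω - e|) 2 (Measure.pi μ) := (hS2.sub (memLp_const e)).abs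
  -- Cauchy-Schwarz, in the form that the variance of `|S - e|` is nonnegative.
  have hdev : ∫ ω, |S ω - e| ∂(Measure.pi μ) ≤ √(∑ i, V i) := by
    refine Real.le_sqrt_of_sq_le (le_trans ?_ hvar)
    have h1 := variance_nonneg (fun ω => |S ω - e|) (Measure.pi μ)
    rw [variance_eq_sub hY] at h1
    rw [variance_eq_integral hS2.aemeasurable]
    simp only [Pi.pow_apply, sq_abs] at h1
    linarith
  rw [← hES]
  have hYi : Integrable (fun ω => |S ω - e|) (Measure.pi μ) := hY.integrable (by norm_num)
  calc ∫ ω, |S ω - H| ∂(Measure.pi μ) ≤ ∫ ω, (|S ω - e| + |e - H|) ∂(Measure.pi μ) :=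
        integral_mono (hSi.sub (integrable_const H)).abs (hYi.add (integrable_const _))
          fun ω => abs_sub_le _ _ _
    _ = ∫ ω, |S ω - e| ∂(Measure.pi μ) + |e - H| := by
        rw [integral_add hYi (integrable_const _)]; simp
    _ ≤ _ := by linarith

/-! ### The mean of the empirical estimator -/

/-- The mean of the contribution of the symbol `i` to the empirical estimator, that is, the value at
`p_i` of the Bernstein polynomial of `h(x) = -x log x`. -/
noncomputable def empiricalMean {k : ℕ} (p : PMF (Fin k)) (m : ℕ) (i : Fin k) : ℝ :=
  ∫ x, Real.negMulLog ((count x i : ℝ) / (m : ℝ)) ∂(iidLaw p m)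

theorem count_le {k m : ℕ} (x : Fin m → Fin k) (i : Fin k) : count x i ≤ m := by
  rw [count]
  exact (Finset.card_le_univ _).trans (by simp)

theorem cast_count {k m : ℕ} (x : Fin m → Fin k) (i : Fin k) :
    (count x i : ℝ) = ∑ j, if x j = i then (1 : ℝ) else 0 := by
  rw [count, Finset.card_filter]
  push_cast
  rfl

theorem integral_indicator_pmf {k : ℕ} (p : PMF (Fin k)) (i : Fin k) :
    ∫ a, (if a = i then (1 : ℝ) else 0) ∂p.toMeasure = (p i).toReal := by
  rw [PMF.integral_eq_sum]
  simp

theorem integral_count {k m : ℕ} (p : PMF (Fin k)) (i : Fin k) :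
    ∫ x, (count x i : ℝ) ∂(iidLaw p m) = m * (p i).toReal := by
  simp only [cast_count]
  rw [integral_finsetSum _ fun _ _ => Integrable.of_finite]
  have h : ∀ j : Fin m, ∫ x, (if x j = i then (1 : ℝ) else 0) ∂(iidLaw p m) = (p i).toReal := by
    intro j
    rw [← integral_indicator_pmf p i,
      ← (measurePreserving_eval (fun _ : Fin m => p.toMeasure) j).map_eq,
      integral_map (measurable_pi_apply j).aemeasurable (Measurable.of_discrete).aestronglyMeasurable]
    rfl
  simp [h]

/-- The binomial variance is `m x (1 - x)`; its negative part is dropped. -/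
theorem integral_count_sq_le {k m : ℕ} (p : PMF (Fin k)) (i : Fin k) :
    ∫ x, (count x i : ℝ) ^ 2 ∂(iidLaw p m) ≤ m * (p i).toReal * (m * (p i).toReal + 1) := by
  have hfin : ∀ (f : Fin k → ℝ), MemLp f 2 p.toMeasure := fun f => MemLp.of_discrete
  have hfin' : ∀ (f : (Fin m → Fin k) → ℝ), MemLp f 2 (iidLaw p m) := fun f => MemLp.of_discrete
  have h := variance_sum_pi (μ := fun _ : Fin m => p.toMeasure)
    (X := fun _ a => if a = i then (1 : ℝ) else 0) fun _ => hfin _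
  have hsum : (∑ j : Fin m, fun ω : Fin m → Fin k => if ω j = i then (1 : ℝ) else 0)
      = fun x : Fin m → Fin k => (count x i : ℝ) := by
    funext x; rw [cast_count]; simp
  rw [hsum] at h
  have h1 := variance_eq_sub (hfin' fun x => (count x i : ℝ))
  have h2 := variance_eq_sub (hfin fun a => if a = i then (1 : ℝ) else 0)
  have h3 : ((fun a : Fin k => if a = i then (1 : ℝ) else 0) ^ 2)
      = fun a => if a = i then (1 : ℝ) else 0 := by
    funext a; simp
  rw [h3, integral_indicator_pmf] at h2
  rw [integral_count] at h1
  simp only [Finset.sum_const, Finset.card_univ, Fintype.card_fin, nsmul_eq_mul] at h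
  change Var[fun x : Fin m → Fin k => (count x i : ℝ); iidLaw p m] = _ at h
  rw [h1, h2] at h
  have h4 : ∫ x, (count x i : ℝ) ^ 2 ∂(iidLaw p m)
      = ∫ x, ((fun x : Fin m → Fin k => (count x i : ℝ)) ^ 2) x ∂(iidLaw p m) := rfl
  rw [h4]
  have h5 : 0 ≤ (m : ℝ) * (p i).toReal ^ 2 := by positivity
  linarith

section EmpiricalMean

variable {k m : ℕ} (p : PMF (Fin k)) (i : Fin k)

theorem empiricalMean_nonneg : 0 ≤ empiricalMean p m i := by
  refine integral_nonneg fun x => Real.negMulLog_nonneg (by positivity) ?_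
  exact div_le_one_of_le₀ (by exact_mod_cast count_le x i) (by positivity)

/-- A nonzero count `c` has `log c ≥ 0`, hence `h(c/m) ≤ (c/m) log m`. This beats Jensen's bound
when `x < 1/m`. -/
theorem empiricalMean_le_mul_log : empiricalMean p m i ≤ (p i).toReal * Real.log m := by
  rcases Nat.eq_zero_or_pos m with rfl | hm
  · simp [empiricalMean]
  have hm0 : (0 : ℝ) < m := by exact_mod_cast hm
  have h : empiricalMean p m i ≤ ∫ x, (count x i : ℝ) * (Real.log m / m) ∂(iidLaw p m) := by
    refine integral_mono Integrable.of_finite Integrable.of_finite fun x => ?_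
    rcases Nat.eq_zero_or_pos (count x i) with h | h
    · simp [h]
    · have h1 : (1 : ℝ) ≤ count x i := by exact_mod_cast h
      simp only [Real.negMulLog]
      rw [Real.log_div (by positivity) hm0.ne']
      have : 0 ≤ (count x i : ℝ) / m * Real.log (count x i) :=
        mul_nonneg (by positivity) (Real.log_nonneg h1)
      have e : (count x i : ℝ) * (Real.log m / m) = (count x i : ℝ) / m * Real.log m := by ring
      rw [e]
      linarith
  rw [integral_mul_const, integral_count] at h
  refine h.trans (le_of_eq ?_)
  field_simp

variable {p i}

theorem empiricalMean_le_negMulLog (hm : 0 < m) (hx : 0 < (p i).toReal) :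
    empiricalMean p m i ≤ Real.negMulLog (p i).toReal := by
  have hm0 : (0 : ℝ) < m := by exact_mod_cast hm
  refine integral_negMulLog_le (fun x => by positivity) hx Integrable.of_finite
    Integrable.of_finite ?_
  rw [integral_div, integral_count]
  field_simp

theorem le_empiricalMean (hm : 0 < m) (hx : 0 < (p i).toReal) :
    -((p i).toReal * Real.log ((p i).toReal + 1 / m)) ≤ empiricalMean p m i := by
  have hm0 : (0 : ℝ) < m := by exact_mod_cast hm
  refine le_integral_negMulLog (fun x => by positivity) hx (by positivity) Integrable.of_finite
    Integrable.of_finite Integrable.of_finite ?_ ?_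
  · rw [integral_div, integral_count]
    field_simp
  · simp only [div_pow]
    rw [integral_div, div_le_iff₀ (by positivity)]
    refine (integral_count_sq_le p i).trans (le_of_eq ?_)
    field_simp

end EmpiricalMean

/-- The source of the empirical loss in the theorem: a bias is at most the mean absolute error. -/
theorem abs_sum_empiricalMean_sub_entropy_le {k : ℕ} (p : PMF (Fin k)) (m : ℕ) :
    |∑ i, empiricalMean p m i - entropy p| ≤ empiricalLoss p m := by
  have h : ∑ i, empiricalMean p m i - entropy p
      = ∫ x, (empiricalEntropy x - entropy p) ∂(iidLaw p m) := by
    rw [integral_sub Integrable.of_finite Integrable.of_finite]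
    simp only [empiricalEntropy, empiricalMean]
    rw [integral_finsetSum _ fun _ _ => Integrable.of_finite]
    simp
  rw [h]
  exact abs_integral_le_integral_abs

/-! ### The plug-in estimator of one symbol under the Poisson law -/

section PoissonPlugin

variable {n : ℕ} {x : ℝ} {l : NNReal}

/-- Crude on purpose: replacing `log N` by `N` bounds the square by a quartic polynomial in `N`. -/
theorem abs_negMulLog_div_le (hn : 0 < n) (N : ℕ) :
    |Real.negMulLog ((N : ℝ) / n)| ≤ (N : ℝ) / n * (Real.log n + N) := by
  have hn0 : (0 : ℝ) < n := by exact_mod_cast hn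
  rcases Nat.eq_zero_or_pos N with rfl | hN
  · simp
  have hN1 : (1 : ℝ) ≤ N := by exact_mod_cast hN
  have hn1 : (1 : ℝ) ≤ n := by exact_mod_cast hn
  rw [Real.negMulLog, abs_mul, abs_neg, abs_of_nonneg (by positivity : 0 ≤ (N : ℝ) / n)]
  gcongr
  rw [Real.log_div (by positivity) hn0.ne']
  have h1 := Real.log_le_sub_one_of_pos (by linarith : (0 : ℝ) < N)
  have h2 := Real.log_nonneg hN1
  have h3 := Real.log_nonneg hn1
  rw [abs_le]
  constructor <;> linarith

theorem negMulLog_div_sq_le (hn : 0 < n) (N : ℕ) :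
    Real.negMulLog ((N : ℝ) / n) ^ 2 ≤
      0 + 0 * N + 2 * Real.log n ^ 2 / n ^ 2 * (N : ℝ) ^ 2 + 0 * (N : ℝ) ^ 3
        + 2 / (n : ℝ) ^ 2 * (N : ℝ) ^ 4 := by
  have hn0 : (0 : ℝ) < n := by exact_mod_cast hn
  have h := pow_le_pow_left₀ (abs_nonneg _) (abs_negMulLog_div_le hn N) 2
  rw [sq_abs] at h
  refine h.trans ?_
  have h2 : (Real.log n + N) ^ 2 ≤ 2 * Real.log n ^ 2 + 2 * (N : ℝ) ^ 2 := by
    nlinarith [sq_nonneg (Real.log n - N)]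
  calc ((N : ℝ) / n * (Real.log n + N)) ^ 2 = ((N : ℝ) / n) ^ 2 * (Real.log n + N) ^ 2 := by ring
    _ ≤ ((N : ℝ) / n) ^ 2 * (2 * Real.log n ^ 2 + 2 * (N : ℝ) ^ 2) := by gcongr
    _ = _ := by ring

theorem memLp_negMulLog_poisson (hn : 0 < n) :
    MemLp (fun N : ℕ => Real.negMulLog ((N : ℝ) / n)) 2 (poissonMeasure l) := by
  rw [memLp_two_iff_integrable_sq (Measurable.of_discrete).aestronglyMeasurable]
  refine (poisson_quartic l 0 0 (2 * Real.log n ^ 2 / n ^ 2) 0 (2 / (n : ℝ) ^ 2)).1.mono'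
    (Measurable.of_discrete).aestronglyMeasurable (Filter.Eventually.of_forall fun N => ?_)
  rw [Real.norm_of_nonneg (sq_nonneg _)]
  exact negMulLog_div_sq_le hn N

theorem integral_negMulLog_sq_poisson_le (hn : 0 < n) :
    ∫ N : ℕ, Real.negMulLog ((N : ℝ) / n) ^ 2 ∂(poissonMeasure l) ≤
      2 / (n : ℝ) ^ 2 * (Real.log n ^ 2 * ((l : ℝ) ^ 2 + l)
        + ((l : ℝ) ^ 4 + 6 * (l : ℝ) ^ 3 + 7 * (l : ℝ) ^ 2 + l)) := by
  have hq := poisson_quartic l 0 0 (2 * Real.log n ^ 2 / n ^ 2) 0 (2 / (n : ℝ) ^ 2)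
  refine (integral_mono (memLp_negMulLog_poisson hn).integrable_sq hq.1
    (negMulLog_div_sq_le hn)).trans (le_of_eq ?_)
  rw [hq.2]
  ring

theorem integral_negMulLog_poisson_le (hn : 0 < n) (hx : 0 < x) (hl : (l : ℝ) = n * x) :
    ∫ N : ℕ, Real.negMulLog ((N : ℝ) / n) ∂(poissonMeasure l) ≤ Real.negMulLog x := by
  have hn0 : (0 : ℝ) < n := by exact_mod_cast hn
  refine integral_negMulLog_le (fun N => by positivity) hx ((integrable_cast_poisson l).div_const _)
    ((memLp_negMulLog_poisson hn).integrable (by norm_num)) ?_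
  rw [integral_div, integral_cast_poisson, hl]
  field_simp

theorem le_integral_negMulLog_poisson (hn : 0 < n) (hx : 0 < x) (hl : (l : ℝ) = n * x) :
    Real.negMulLog x - 1 / n ≤ ∫ N : ℕ, Real.negMulLog ((N : ℝ) / n) ∂(poissonMeasure l) := by
  have hn0 : (0 : ℝ) < n := by exact_mod_cast hn
  refine (negMulLog_sub_le hx (by positivity)).trans ?_
  refine le_integral_negMulLog (fun N => by positivity) hx (by positivity)
    ((integrable_cast_poisson l).div_const _) ?_
    ((memLp_negMulLog_poisson hn).integrable (by norm_num)) ?_ ?_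
  · simp only [div_pow]
    exact (integrable_sq_poisson l).div_const _
  · rw [integral_div, integral_cast_poisson, hl]
    field_simp
  · simp only [div_pow]
    rw [integral_div, integral_sq_poisson, hl]
    refine le_of_eq ?_
    field_simp

theorem integral_negMulLog_sub_sq_poisson_le (hn : 0 < n) (hx : 0 < x) (hl : (l : ℝ) = n * x)
    (hl1 : 1 ≤ n * x) :
    ∫ N : ℕ, (Real.negMulLog ((N : ℝ) / n) - Real.negMulLog x) ^ 2 ∂(poissonMeasure l) ≤
      x / n * (2 * (1 + |Real.log x|) ^ 2 + 8) := by
  have hn0 : (0 : ℝ) < n := by exact_mod_cast hn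
  set D := (1 + |Real.log x|) ^ 2
  set a := 2 * D / (n : ℝ) ^ 2
  set b := 2 / (x ^ 2 * (n : ℝ) ^ 4)
  -- The coefficients of `a (N - l)² + b (N - l)⁴`, whose mean is `a l + b (3 l² + l)`.
  have hq := poisson_quartic l (a * l ^ 2 + b * l ^ 4) (-2 * a * l - 4 * b * l ^ 3)
    (a + 6 * b * l ^ 2) (-4 * b * l) b
  have hb : ∀ N : ℕ, (Real.negMulLog ((N : ℝ) / n) - Real.negMulLog x) ^ 2 ≤
      a * l ^ 2 + b * l ^ 4 + (-2 * a * l - 4 * b * l ^ 3) * N + (a + 6 * b * l ^ 2) * (N : ℝ) ^ 2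
        + (-4 * b * l) * (N : ℝ) ^ 3 + b * (N : ℝ) ^ 4 := by
    intro N
    have h := abs_negMulLog_sub_le hx (by positivity : 0 ≤ (N : ℝ) / n)
    have h2 := pow_le_pow_left₀ (abs_nonneg _) h 2
    rw [sq_abs] at h2
    refine h2.trans ?_
    have h3 : ∀ u v : ℝ, (u + v) ^ 2 ≤ 2 * u ^ 2 + 2 * v ^ 2 := fun u v => by
      nlinarith [sq_nonneg (u - v)]
    refine (h3 _ _).trans (le_of_eq ?_)
    rw [mul_pow, sq_abs]
    have e : (N : ℝ) / n - x = (N - l) / n := by rw [hl]; field_simp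
    rw [e]
    simp only [a, b]
    rw [show (1 + |Real.log x|) ^ 2 = D from rfl]
    field_simp
    ring
  have hi : Integrable (fun N : ℕ => (Real.negMulLog ((N : ℝ) / n) - Real.negMulLog x) ^ 2)
      (poissonMeasure l) := ((memLp_negMulLog_poisson hn).sub (memLp_const _)).integrable_sq
  refine (integral_mono hi hq.1 hb).trans ?_
  rw [hq.2]
  have e : a * (l : ℝ) ^ 2 + b * l ^ 4 + (-2 * a * l - 4 * b * l ^ 3) * l
      + (a + 6 * b * l ^ 2) * ((l : ℝ) ^ 2 + l)
      + (-4 * b * l) * ((l : ℝ) ^ 3 + 3 * (l : ℝ) ^ 2 + l)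
      + b * ((l : ℝ) ^ 4 + 6 * (l : ℝ) ^ 3 + 7 * (l : ℝ) ^ 2 + l)
      = a * l + b * (3 * (l : ℝ) ^ 2 + l) := by ring
  rw [e, hl]
  -- This uses `3λ² + λ ≤ 4λ³` for `λ = n x ≥ 1`.
  have h4 : b * (3 * (n * x) ^ 2 + n * x) ≤ b * (4 * (n * x) ^ 2 * (n * x)) := by
    gcongr
    nlinarith [mul_nonneg (sub_nonneg.2 hl1) (sub_nonneg.2 hl1), mul_pos hn0 hx,
      mul_nonneg (mul_nonneg (sub_nonneg.2 hl1) (sub_nonneg.2 hl1)) (mul_pos hn0 hx).le]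
  have h5 : b * (4 * (n * x) ^ 2 * (n * x)) = x / n * 8 := by
    simp only [b]; field_simp; ring
  have h6 : a * (n * x) = x / n * (2 * D) := by simp only [a]; field_simp
  rw [h5] at h4
  rw [h6]
  linarith

end PoissonPlugin

/-! ### One symbol of the estimator under the Poisson law -/

/-- The small-count estimator, cut off at counts above `cl * log n`. -/
noncomputable def cutEstimator (cl cs ε : ℝ) (n : ℕ) (N : ℕ) : ℝ :=
  {N : ℕ | (N : ℝ) ≤ cl * Real.log n}.indicator (fun N => smallEstimator cl cs ε n N) N

theorem symbolEstimator_eq (cl cs ε : ℝ) (n N N' : ℕ) :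
    symbolEstimator cl cs ε n N N' = if (N' : ℝ) ≤ ε⁻¹ then cutEstimator cl cs ε n N
      else Real.negMulLog ((N : ℝ) / n) := by
  unfold symbolEstimator cutEstimator
  by_cases h : (N' : ℝ) ≤ ε⁻¹
  · rw [if_pos h, if_neg (not_lt.2 h), add_zero]
    by_cases h' : (N : ℝ) ≤ cl * Real.log n
    · rw [if_pos ⟨h', h⟩, Set.indicator_of_mem (by exact h')]
    · rw [if_neg (fun q => h' q.1), Set.indicator_of_notMem (by exact h')]
  · rw [if_neg h, if_neg (fun q => h q.2), if_pos (not_le.1 h), zero_add]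

/-- The probability that the second count is at most `1 / ε`. -/
noncomputable def smallProb (ε : ℝ) (l : NNReal) : ℝ :=
  (poissonMeasure l).real {N : ℕ | (N : ℝ) ≤ ε⁻¹}

theorem smallProb_nonneg (ε : ℝ) (l : NNReal) : 0 ≤ smallProb ε l := measureReal_nonneg

theorem smallProb_le_one (ε : ℝ) (l : NNReal) : smallProb ε l ≤ 1 := measureReal_le_one

theorem one_sub_smallProb (ε : ℝ) (l : NNReal) :
    1 - smallProb ε l = (poissonMeasure l).real {N : ℕ | ε⁻¹ < (N : ℝ)} := by
  have : {N : ℕ | ε⁻¹ < (N : ℝ)} = {N : ℕ | (N : ℝ) ≤ ε⁻¹}ᶜ := by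
    ext N; simp
  rw [this, probReal_compl_eq_one_sub MeasurableSet.of_discrete, smallProb]

/-- Markov's inequality suffices: the plug-in estimate is biased by at most `1/n`, so for small
rates it costs at most `ε n x · (1/n) = ε x`. -/
theorem one_sub_smallProb_le {ε : ℝ} (hε : 0 < ε) (l : NNReal) : 1 - smallProb ε l ≤ ε * l := by
  rw [one_sub_smallProb]
  refine (poisson_markov l (inv_pos.2 hε)).trans (le_of_eq ?_)
  rw [div_inv_eq_mul, mul_comm]

/-- The expectation of a function of the estimate of one symbol is a mixture. -/
theorem integral_comp_symbolEstimator (cl cs ε : ℝ) (n : ℕ) (l : NNReal) (φ : ℝ → ℝ)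
    (h1 : Integrable (fun N => φ (cutEstimator cl cs ε n N)) (poissonMeasure l))
    (h2 : Integrable (fun N : ℕ => φ (Real.negMulLog ((N : ℝ) / n))) (poissonMeasure l)) :
    Integrable (fun q : ℕ × ℕ => φ (symbolEstimator cl cs ε n q.1 q.2))
        ((poissonMeasure l).prod (poissonMeasure l)) ∧
      ∫ q : ℕ × ℕ, φ (symbolEstimator cl cs ε n q.1 q.2)
          ∂((poissonMeasure l).prod (poissonMeasure l)) =
        smallProb ε l * ∫ N, φ (cutEstimator cl cs ε n N) ∂(poissonMeasure l) +
          (1 - smallProb ε l) *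
            ∫ N : ℕ, φ (Real.negMulLog ((N : ℝ) / n)) ∂(poissonMeasure l) := by
  set A : Set ℕ := {N : ℕ | (N : ℝ) ≤ ε⁻¹} with hA
  have e : (fun q : ℕ × ℕ => φ (symbolEstimator cl cs ε n q.1 q.2)) = fun q : ℕ × ℕ =>
      φ (cutEstimator cl cs ε n q.1) * A.indicator 1 q.2
        + φ (Real.negMulLog ((q.1 : ℝ) / n)) * Aᶜ.indicator 1 q.2 := by
    funext q
    rw [symbolEstimator_eq]
    by_cases h : (q.2 : ℝ) ≤ ε⁻¹
    · have hm : q.2 ∈ A := h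
      simp [h, hm]
    · have hm : q.2 ∉ A := h
      simp [h, hm]
  have hi : ∀ B : Set ℕ, Integrable (B.indicator (1 : ℕ → ℝ)) (poissonMeasure l) := fun B =>
    (integrable_const (1 : ℝ)).indicator MeasurableSet.of_discrete
  rw [e]
  refine ⟨(h1.mul_prod (hi A)).add (h2.mul_prod (hi Aᶜ)), ?_⟩
  rw [integral_add (h1.mul_prod (hi A)) (h2.mul_prod (hi Aᶜ)),
    integral_prod_mul (fun N => φ (cutEstimator cl cs ε n N)) (A.indicator (1 : ℕ → ℝ)),
    integral_prod_mul (fun N : ℕ => φ (Real.negMulLog ((N : ℝ) / n))) (Aᶜ.indicator (1 : ℕ → ℝ)),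
    integral_indicator_one MeasurableSet.of_discrete,
    integral_indicator_one MeasurableSet.of_discrete,
    probReal_compl_eq_one_sub MeasurableSet.of_discrete, smallProb]
  ring

section Cut

variable {cl cs ε : ℝ} {n : ℕ} {r W : ℝ} {l : NNReal}

theorem integral_cutEstimator_bounds (hn : 0 < n) (hT : 0 ≤ cl * Real.log n)
    (hb : ∀ N : ℕ, |cutEstimator cl cs ε n N| ≤ W * (N / n)) :
    Integrable (fun N => cutEstimator cl cs ε n N) (poissonMeasure l) ∧
    Integrable (fun N => cutEstimator cl cs ε n N ^ 2) (poissonMeasure l) ∧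
    |∫ N, cutEstimator cl cs ε n N ∂(poissonMeasure l)| ≤ W * (l / n) ∧
    ∫ N, cutEstimator cl cs ε n N ^ 2 ∂(poissonMeasure l) ≤
      W ^ 2 * (cl * Real.log n) * l / n ^ 2 := by
  have hn0 : (0 : ℝ) < n := by exact_mod_cast hn
  have hi1 : Integrable (fun N : ℕ => W * ((N : ℝ) / n)) (poissonMeasure l) :=
    ((integrable_cast_poisson l).div_const _).const_mul _
  have hi2 : Integrable (fun N : ℕ => W ^ 2 * (cl * Real.log n) / n ^ 2 * (N : ℝ))
      (poissonMeasure l) := (integrable_cast_poisson l).const_mul _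
  -- The cutoff trades one factor `N` for `cl log n`, so that the second moment stays linear in the
  -- rate.
  have hsq : ∀ N : ℕ, cutEstimator cl cs ε n N ^ 2 ≤
      W ^ 2 * (cl * Real.log n) / n ^ 2 * (N : ℝ) := by
    intro N
    by_cases h : (N : ℝ) ≤ cl * Real.log n
    · have h1 := pow_le_pow_left₀ (abs_nonneg _) (hb N) 2
      rw [sq_abs] at h1
      refine h1.trans ?_
      calc (W * ((N : ℝ) / n)) ^ 2 = W ^ 2 * (N : ℝ) / n ^ 2 * N := by ring
        _ ≤ W ^ 2 * (cl * Real.log n) / n ^ 2 * N := by gcongr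
    · rw [cutEstimator, Set.indicator_of_notMem (by exact h), zero_pow two_ne_zero]
      positivity
  have hc1 : Integrable (fun N => cutEstimator cl cs ε n N) (poissonMeasure l) :=
    hi1.mono' (Measurable.of_discrete).aestronglyMeasurable (Filter.Eventually.of_forall hb)
  have hc2 : Integrable (fun N => cutEstimator cl cs ε n N ^ 2) (poissonMeasure l) :=
    hi2.mono' (Measurable.of_discrete).aestronglyMeasurable
      (Filter.Eventually.of_forall fun N => by
        rw [Real.norm_of_nonneg (sq_nonneg _)]; exact hsq N)
  refine ⟨hc1, hc2, ?_, ?_⟩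
  · refine abs_integral_le_integral_abs.trans ((integral_mono hc1.abs hi1 hb).trans (le_of_eq ?_))
    rw [integral_const_mul, integral_div, integral_cast_poisson]
  · refine (integral_mono hc2 hi2 hsq).trans (le_of_eq ?_)
    rw [integral_const_mul, integral_cast_poisson]
    ring

theorem abs_cutEstimator_le {w : ℕ → ℝ} (hr : r * (cl * Real.log n) = n) (hr0 : 0 ≤ r)
    (hw : ∀ l, (derivPoly cl cs ε n).coeff l = w l * r ^ l)
    (hW : ∑ l ∈ Finset.range (degree cs n), |w l| ≤ W) (hn : 0 < n) (N : ℕ) :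
    |cutEstimator cl cs ε n N| ≤ W * (N / n) := by
  have hW0 : 0 ≤ W := (Finset.sum_nonneg fun _ _ => abs_nonneg _).trans hW
  by_cases h : (N : ℝ) ≤ cl * Real.log n
  · rw [cutEstimator, Set.indicator_of_mem (by exact h)]
    refine abs_smallEstimator_le hr0 hw hW hn ?_
    rw [← hr]
    gcongr
  · rw [cutEstimator, Set.indicator_of_notMem (by exact h), abs_zero]
    positivity

end Cut

/-! ### The amplified primitive against the mean of the empirical estimator -/

section Bias

variable {k m n : ℕ} {p : PMF (Fin k)} {i : Fin k} {A x : ℝ}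

theorem negMulLog_sub_ampPrimitive_le (hA : 1 < A) (hx : 0 < x) :
    Real.negMulLog x - ampPrimitive A x ≤
      (A - 1)⁻¹ * (Real.negMulLog (x * (A - 1)) - diffPrimitive (x * (A - 1))) := by
  have hA1 : 0 < A - 1 := by linarith
  have h : Real.log (A - 1) ≤ Real.log A := Real.log_le_log hA1 (by linarith)
  have h2 := mul_le_mul_of_nonneg_left h hx.le
  have e : (A - 1)⁻¹ * Real.negMulLog (x * (A - 1))
      = Real.negMulLog x - x * Real.log (A - 1) := by
    rw [Real.negMulLog, Real.negMulLog, Real.log_mul hx.ne' hA1.ne']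
    field_simp
    ring
  rw [ampPrimitive, mul_sub (A - 1)⁻¹, e]
  linarith

theorem ampPrimitive_le_mul_log (hA : 1 < A) (hx : 0 < x) :
    ampPrimitive A x ≤ x * Real.log A := by
  have hA1 : 0 < A - 1 := by linarith
  have := mul_nonpos_of_nonneg_of_nonpos (inv_pos.2 hA1).le
    (diffPrimitive_nonpos (mul_pos hx hA1))
  rw [ampPrimitive]
  linarith

theorem ampPrimitive_le_negMulLog (hA : 1 < A) (hx : 0 < x) :
    ampPrimitive A x ≤ Real.negMulLog x + x * (A - 1)⁻¹ := by
  have hA1 : 0 < A - 1 := by linarith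
  have h := mul_le_mul_of_nonneg_left (diffPrimitive_le_negMulLog (mul_pos hx hA1))
    (inv_pos.2 hA1).le
  have e : (A - 1)⁻¹ * Real.negMulLog (x * (A - 1))
      = Real.negMulLog x - x * Real.log (A - 1) := by
    rw [Real.negMulLog, Real.negMulLog, Real.log_mul hx.ne' hA1.ne']
    field_simp
    ring
  have h2 := Real.log_le_sub_one_of_pos (div_pos (by linarith : 0 < A) hA1)
  rw [Real.log_div (by linarith) hA1.ne'] at h2
  have h3 : A / (A - 1) - 1 = (A - 1)⁻¹ := by field_simp; ring
  have h4 := mul_le_mul_of_nonneg_left (h2.trans h3.le) hx.le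
  rw [ampPrimitive]
  linarith

/-- The leading constant `1` comes from here. Both quantities have upper bounds `x log A` and `h(x)`
up to lower order, and each lies below the relevant one by at most about `x`. The term `2x/n`
absorbs the rounding of `A` to `m` and the shift from `A` to `A - 1`. -/
theorem abs_ampPrimitive_sub_empiricalMean_le (hn : 4 ≤ n) (hA : (n : ℝ) ≤ A)
    (hm : |(m : ℝ) - A| < 1) (hx : 0 < (p i).toReal) :
    |ampPrimitive A (p i).toReal - empiricalMean p m i| ≤
      (p i).toReal + (p i).toReal * (2 / n) := by
  set x := (p i).toReal
  have hn4 : (4 : ℝ) ≤ n := by exact_mod_cast hn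
  have hA1 : 0 < A - 1 := by linarith
  rw [abs_lt] at hm
  have hmn : n ≤ m := by
    have : (n : ℝ) < m + 1 := by linarith
    exact Nat.lt_succ_iff.1 (by exact_mod_cast this)
  have hm0 : 0 < m := by omega
  have hmR : (n : ℝ) ≤ m := by exact_mod_cast hmn
  have hmp : (0 : ℝ) < m := by linarith
  have hinv : (A - 1)⁻¹ ≤ 2 / n := by
    rw [inv_le_comm₀ hA1 (by positivity), inv_div]; linarith
  have hminv : 1 / (m : ℝ) ≤ 2 / n := by
    rw [div_le_div_iff₀ hmp (by linarith)]; linarith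
  have hAinv : 1 / A ≤ 2 / n := by
    rw [div_le_div_iff₀ (by linarith) (by linarith)]; linarith
  have hlow := le_empiricalMean (p := p) (i := i) hm0 hx
  rw [abs_le]
  constructor
  -- For small `x` the comparison value is `x log m`, for larger `x` it is `h(x)`.
  · rcases le_total (x * (A - 1)) 1.15 with hy | hy
    · have h1 := empiricalMean_le_mul_log (m := m) p i
      have h2 := mul_le_mul_of_nonneg_left (neg_diffPrimitive_le (mul_pos hx hA1) hy)
        (inv_pos.2 hA1).le
      have e : (A - 1)⁻¹ * (x * (A - 1)) = x := by field_simp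
      have h3 := Real.log_le_sub_one_of_pos (div_pos hmp (by linarith : 0 < A))
      rw [Real.log_div hmp.ne' (by linarith)] at h3
      have h4 : (m : ℝ) / A - 1 ≤ 1 / A := by
        rw [div_sub_one (by linarith)]
        exact div_le_div_of_nonneg_right (by linarith) (by linarith)
      have h5 := mul_le_mul_of_nonneg_left ((h3.trans h4).trans hAinv) hx.le
      rw [ampPrimitive]
      linarith
    · have h1 := empiricalMean_le_negMulLog (p := p) (i := i) hm0 hx
      have h2 := negMulLog_sub_ampPrimitive_le (by linarith : 1 < A) hx
      have h3 := mul_le_mul_of_nonneg_left (negMulLog_sub_diffPrimitive_le_self hy)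
        (inv_pos.2 hA1).le
      have e : (A - 1)⁻¹ * (x * (A - 1)) = x := by field_simp
      have h5 : 0 ≤ x * (2 / n) := by positivity
      linarith
  -- If `m x ≤ 1`, the lower bound of the empirical mean is `x log m - x log (1 + m x) ≥ x log m -
  -- x`; otherwise it is at least `h(x) - 1/m ≥ h(x) - x`.
  · rcases le_total (m * x) 1 with hy | hy
    · have h1 := ampPrimitive_le_mul_log (by linarith : 1 < A) hx
      have h3 := Real.log_le_sub_one_of_pos (div_pos (by linarith : 0 < A) hmp)
      rw [Real.log_div (by linarith) hmp.ne'] at h3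
      have h4 : A / (m : ℝ) - 1 ≤ 1 / m := by
        rw [div_sub_one hmp.ne']
        exact div_le_div_of_nonneg_right (by linarith) hmp.le
      have h5 := mul_le_mul_of_nonneg_left ((h3.trans h4).trans hminv) hx.le
      have e : x + 1 / m = (1 + m * x) / m := by field_simp; ring
      rw [e, Real.log_div (by positivity) hmp.ne'] at hlow
      have h6 := Real.log_le_sub_one_of_pos (by positivity : 0 < 1 + m * x)
      have h7 := mul_le_mul_of_nonneg_left (h6.trans (by linarith : 1 + m * x - 1 ≤ 1)) hx.le
      linarith
    · have h1 := ampPrimitive_le_negMulLog (by linarith : 1 < A) hx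
      have h2 := negMulLog_sub_le hx (by positivity : 0 ≤ 1 / (m : ℝ))
      have h3 : 1 / (m : ℝ) ≤ x := by rw [div_le_iff₀ hmp]; linarith
      have h4 := mul_le_mul_of_nonneg_left hinv hx.le
      linarith

/-- A bound whose main term does not depend on `x`; summed over the support it yields the term
`S_p/(ε n)`. Both quantities are compared with `h(x)`. -/
theorem abs_ampPrimitive_sub_empiricalMean_le' (hn : 4 ≤ n) (hA : (n : ℝ) ≤ A)
    (hm : |(m : ℝ) - A| < 1) (hx : 0 < (p i).toReal) :
    |ampPrimitive A (p i).toReal - empiricalMean p m i| ≤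
      (A - 1)⁻¹ * (Real.log A / 2 + 3 / 4) + (p i).toReal * (2 / n) := by
  set x := (p i).toReal
  have hx1 : x ≤ 1 := ENNReal.toReal_le_of_le_ofReal zero_le_one (by simpa using p.coe_le_one i)
  have hn4 : (4 : ℝ) ≤ n := by exact_mod_cast hn
  have hA1 : 0 < A - 1 := by linarith
  rw [abs_lt] at hm
  have hmp : (0 : ℝ) < m := by linarith
  have hm0 : 0 < m := by exact_mod_cast hmp
  have hinv : (A - 1)⁻¹ ≤ 2 / n := by
    rw [inv_le_comm₀ hA1 (by positivity), inv_div]; linarith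
  have hlow := le_empiricalMean (p := p) (i := i) hm0 hx
  have hx2 : 0 ≤ x * (2 / n) := by positivity
  rw [abs_le]
  constructor
  · have h1 := empiricalMean_le_negMulLog (p := p) (i := i) hm0 hx
    have h2 := negMulLog_sub_ampPrimitive_le (by linarith : 1 < A) hx
    have h3 := negMulLog_sub_diffPrimitive_le (mul_pos hx hA1)
    have h4 : Real.log (1 + x * (A - 1)) ≤ Real.log A :=
      Real.log_le_log (by positivity) (by nlinarith)
    have h5 := mul_le_mul_of_nonneg_left (h3.trans (by linarith :
      _ ≤ Real.log A / 2 + 3 / 4)) (inv_pos.2 hA1).le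
    linarith
  · have h1 := ampPrimitive_le_negMulLog (by linarith : 1 < A) hx
    have h2 := negMulLog_sub_le hx (by positivity : 0 ≤ 1 / (m : ℝ))
    have h4 := mul_le_mul_of_nonneg_left hinv hx.le
    have h5 : 1 / (m : ℝ) ≤ (A - 1)⁻¹ := by
      rw [one_div]
      exact inv_anti₀ hA1 (by linarith)
    have h6 : 1 ≤ Real.log A := by
      rw [Real.le_log_iff_exp_le (by linarith)]
      have := Real.exp_one_lt_d9
      linarith
    have h7 : (A - 1)⁻¹ * 1 ≤ (A - 1)⁻¹ * (Real.log A / 2 + 3 / 4) :=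
      mul_le_mul_of_nonneg_left (by linarith) (inv_pos.2 hA1).le
    linarith

end Bias

/-! ### Bias and variance of one symbol -/

/-- The range of the parameters in which the error bounds are proved. -/
structure Regime (cl cs ε : ℝ) (n : ℕ) : Prop where
  cl_ge : 20 ≤ cl
  cs_pos : 0 < cs
  -- Keeps `17^d` below `n^0.003`.
  cs_le : cs ≤ 1 / 1000
  eps_le : ε ≤ 1
  eps_log : 1 ≤ ε * Real.log n
  log_ge : 100 ≤ Real.log n
  cs_log : 2 ≤ cs * Real.log n
  -- Makes the polynomial approximation cost at most `1/(4n)`.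
  log_ge' : 32 * cl / cs ^ 2 ≤ Real.log n
  cl_log_le : cl * Real.log n ≤ n

/-- A bound of the coefficients of the small-count estimator, after rescaling. -/
noncomputable def coeffBound (cl : ℝ) (n : ℕ) : ℝ :=
  6 * cl * Real.log n ^ 2 * (n : ℝ) ^ (0.003 : ℝ)

namespace Regime

variable {cl cs ε : ℝ} {n : ℕ}

theorem log_pos (h : Regime cl cs ε n) : 0 < Real.log n := by linarith [h.log_ge]

theorem four_le (h : Regime cl cs ε n) : (4 : ℝ) ≤ n := by linarith [h.cl_log_le, mul_le_mul h.cl_ge h.log_ge (by norm_num) (by linarith [h.cl_ge])]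

theorem n_pos (h : Regime cl cs ε n) : 0 < n := by
  have := h.four_le
  exact_mod_cast (by linarith : (0 : ℝ) < n)

theorem eps_pos (h : Regime cl cs ε n) : 0 < ε := by
  by_contra hc
  have := mul_nonpos_of_nonpos_of_nonneg (not_lt.1 hc) h.log_pos.le
  linarith [h.eps_log]

theorem inv_eps_le (h : Regime cl cs ε n) : ε⁻¹ ≤ Real.log n := by
  rw [inv_le_iff_one_le_mul₀' h.eps_pos]; exact h.eps_log

theorem le_ampSize (h : Regime cl cs ε n) : (n : ℝ) ≤ ampSize ε n := by
  have := mul_le_mul_of_nonneg_left h.eps_log (by linarith [h.four_le] : (0 : ℝ) ≤ n)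
  rw [ampSize]
  linarith

theorem ampSize_le (h : Regime cl cs ε n) : ampSize ε n ≤ n * Real.log n := by
  have := mul_le_mul_of_nonneg_right h.eps_le
    (mul_nonneg (by linarith [h.four_le] : (0 : ℝ) ≤ n) h.log_pos.le)
  rw [ampSize]
  linarith

theorem half_le_degree (h : Regime cl cs ε n) : cs * Real.log n / 2 ≤ degree cs n := by
  have := Nat.lt_floor_add_one (cs * Real.log n)
  rw [degree]
  linarith [h.cs_log]

theorem degree_le (h : Regime cl cs ε n) : (degree cs n : ℝ) ≤ Real.log n / 1000 := by
  have h1 := Nat.floor_le (by linarith [h.cs_log] : 0 ≤ cs * Real.log n)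
  have h2 := mul_le_mul_of_nonneg_right h.cs_le h.log_pos.le
  rw [degree]
  linarith

theorem one_le_degree (h : Regime cl cs ε n) : 1 ≤ degree cs n := by
  have h1 := h.half_le_degree
  have h2 := h.cs_log
  exact_mod_cast (by linarith : (1 : ℝ) ≤ degree cs n)

theorem scale_pos (h : Regime cl cs ε n) : 0 < (n : ℝ) / (cl * Real.log n) :=
  div_pos (by linarith [h.four_le]) (mul_pos (by linarith [h.cl_ge]) h.log_pos)

theorem exists_coeff (h : Regime cl cs ε n) : ∃ w : ℕ → ℝ,
    (∀ l, (derivPoly cl cs ε n).coeff l = w l * ((n : ℝ) / (cl * Real.log n)) ^ l) ∧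
      ∑ l ∈ Finset.range (degree cs n), |w l| ≤ coeffBound cl n := by
  have hcl := h.cl_ge
  have hL := h.log_ge
  have hn := h.four_le
  have hT : 2000 ≤ cl * Real.log n := by nlinarith
  have hr1 : 1 ≤ (n : ℝ) / (cl * Real.log n) := (one_le_div (by linarith)).2 h.cl_log_le
  have hrA : (n : ℝ) / (cl * Real.log n) ≤ ampSize ε n - 1 := by
    have h1 := h.le_ampSize
    rw [div_le_iff₀ (by linarith)]
    nlinarith
  obtain ⟨w, hw, hW⟩ := exists_coeff_derivPoly h.one_le_degree rfl hr1 hrA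
  refine ⟨w, hw, hW.trans ?_⟩
  have hn1 : (1 : ℝ) ≤ (n : ℝ) ^ (0.003 : ℝ) := Real.one_le_rpow (by linarith) (by norm_num)
  -- Since `17 ≤ e³` and `d ≤ log n / 1000`.
  have h17 : (17 : ℝ) ^ degree cs n ≤ (n : ℝ) ^ (0.003 : ℝ) := by
    have e1 : (17 : ℝ) ≤ Real.exp 3 := by
      have h1 := Real.exp_one_gt_d9
      have h2 : Real.exp 3 = Real.exp 1 ^ 3 := by rw [← Real.exp_nat_mul]; norm_num
      rw [h2]
      calc (17 : ℝ) ≤ 2.7 ^ 3 := by norm_num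
        _ ≤ _ := pow_le_pow_left₀ (by norm_num) (by linarith) 3
    calc (17 : ℝ) ^ degree cs n ≤ Real.exp 3 ^ degree cs n := pow_le_pow_left₀ (by norm_num) e1 _
      _ = Real.exp (degree cs n * 3) := by rw [← Real.exp_nat_mul]
      _ ≤ Real.exp (Real.log n * 0.003) := by
          refine Real.exp_le_exp.2 ?_
          have := h.degree_le
          linarith
      _ = _ := by rw [Real.rpow_def_of_pos (by linarith)]
  have hlogr : Real.log ((n : ℝ) / (cl * Real.log n)) ≤ Real.log n :=
    Real.log_le_log (by linarith) (div_le_self (by linarith) (by linarith))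
  have hAr : 4 * (ampSize ε n - 1) / ((n : ℝ) / (cl * Real.log n)) ≤ 4 * cl * Real.log n ^ 2 := by
    rw [div_le_iff₀ (by linarith)]
    have e : 4 * cl * Real.log n ^ 2 * (n / (cl * Real.log n)) = 4 * (n * Real.log n) := by
      have := h.log_pos.ne'
      field_simp
    rw [e]
    linarith [h.ampSize_le]
  have h1 : 1 + Real.log n ≤ 2 * cl * Real.log n ^ 2 := by nlinarith
  have h2 : 4 * (ampSize ε n - 1) / ((n : ℝ) / (cl * Real.log n)) * 17 ^ degree cs n ≤
      4 * cl * Real.log n ^ 2 * (n : ℝ) ^ (0.003 : ℝ) := by gcongr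
  have h3 : 2 * cl * Real.log n ^ 2 * 1 ≤ 2 * cl * Real.log n ^ 2 * (n : ℝ) ^ (0.003 : ℝ) := by
    gcongr
  rw [coeffBound]
  linarith

theorem coeffBound_nonneg (h : Regime cl cs ε n) : 0 ≤ coeffBound cl n := by
  have := h.cl_ge
  rw [coeffBound]
  positivity

theorem abs_cutEstimator_le (h : Regime cl cs ε n) (N : ℕ) : |cutEstimator cl cs ε n N| ≤ coeffBound cl n * (N / n) := by
  obtain ⟨w, hw, hW⟩ := h.exists_coeff
  have hT : cl * Real.log n ≠ 0 := (mul_pos (by linarith [h.cl_ge]) h.log_pos).ne'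
  exact EntropyAmp.abs_cutEstimator_le (div_mul_cancel₀ _ hT) h.scale_pos.le hw hW h.n_pos N

theorem integral_cutEstimator_bounds (h : Regime cl cs ε n) (l : NNReal) :
    Integrable (fun N => cutEstimator cl cs ε n N) (poissonMeasure l) ∧
    Integrable (fun N => cutEstimator cl cs ε n N ^ 2) (poissonMeasure l) ∧
    |∫ N, cutEstimator cl cs ε n N ∂(poissonMeasure l)| ≤ coeffBound cl n * (l / n) ∧
    ∫ N, cutEstimator cl cs ε n N ^ 2 ∂(poissonMeasure l) ≤
      coeffBound cl n ^ 2 * (cl * Real.log n) * l / n ^ 2 :=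
  EntropyAmp.integral_cutEstimator_bounds h.n_pos
    (mul_nonneg (by linarith [h.cl_ge]) h.log_pos.le) h.abs_cutEstimator_le

/-- As `1/ε ≤ log n`, the Chernoff exponent is at most `(1 - 8 · 0.63) log n < -4 log n`. -/
theorem smallProb_le (h : Regime cl cs ε n) {l : NNReal} (hl : 8 * Real.log n ≤ l) : smallProb ε l ≤ 1 / (n : ℝ) ^ 4 := by
  have hn : (0 : ℝ) < n := by linarith [h.four_le]
  refine (poisson_lower_tail l ε⁻¹).trans ?_
  have e : (1 : ℝ) / n ^ 4 = Real.exp (-(4 * Real.log n)) := by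
    rw [Real.exp_neg, ← Real.exp_log (pow_pos hn 4), Real.log_pow, one_div]
    norm_num
  rw [e]
  refine Real.exp_le_exp.2 ?_
  have h1 : Real.exp (-1) ≤ 0.37 := by
    rw [Real.exp_neg, inv_le_comm₀ (Real.exp_pos 1) (by norm_num)]
    have := Real.exp_one_gt_d9
    norm_num
    linarith
  have h2 := h.inv_eps_le
  have h3 : (8 * Real.log n) * 0.63 ≤ l * (1 - Real.exp (-1)) :=
    mul_le_mul hl (by linarith) (by norm_num) (by positivity)
  linarith [h.log_pos]

/-- The mean of the cut-off small-count estimator is close to the amplified primitive. -/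
theorem abs_integral_cutEstimator_sub_le (h : Regime cl cs ε n) {l : NNReal} {x : ℝ} (hx : 0 < x) (hl : (l : ℝ) = n * x)
    (hl8 : (l : ℝ) ≤ 8 * Real.log n) :
    |∫ N, cutEstimator cl cs ε n N ∂(poissonMeasure l) - ampPrimitive (ampSize ε n) x| ≤
      coeffBound cl n * x * (1 / n)
        + 8 * cl / (cs ^ 2 * (n * Real.log n)) * min 1 (ampSize ε n * x) := by
  obtain ⟨w, hw, hW⟩ := h.exists_coeff
  have hcl := h.cl_ge
  have hL := h.log_ge
  have hn := h.four_le
  have hT : 0 < cl * Real.log n := mul_pos (by linarith) h.log_pos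
  set r := (n : ℝ) / (cl * Real.log n) with hr
  have hr0 : 0 < r := h.scale_pos
  have hrinv : r⁻¹ = cl * Real.log n / n := by rw [hr, inv_div]
  have hA := h.le_ampSize
  have hx8 : x ≤ 8 * Real.log n / n := by
    rw [le_div_iff₀ (by linarith)]; linarith
  have hδ : (ampSize ε n - 1)⁻¹ ≤ 2 / n := by
    rw [inv_le_comm₀ (by linarith) (by positivity), inv_div]; linarith
  -- The shifted point must stay in the approximation interval `[0, cl log n / n]`.
  have hxr : x + (ampSize ε n - 1)⁻¹ ≤ r⁻¹ := by
    rw [hrinv]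
    calc x + (ampSize ε n - 1)⁻¹ ≤ 8 * Real.log n / n + 2 / n := add_le_add hx8 hδ
      _ = (8 * Real.log n + 2) / n := by ring
      _ ≤ cl * Real.log n / n := by
          gcongr
          nlinarith
  have hrx : r * x ≤ 1 := by
    have : x ≤ r⁻¹ := by
      have : 0 ≤ (ampSize ε n - 1)⁻¹ := inv_nonneg.2 (by linarith)
      linarith
    rw [← mul_inv_cancel₀ hr0.ne']
    gcongr
  have b1 := abs_integral_indicator_sub_le (T := cl * Real.log n) hr0.le hw hW h.n_pos hl hx.le hrx
  have b2 := abs_primitive_sub_ampPrimitive_le h.one_le_degree hr hr0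
    (by linarith : 1 < ampSize ε n) hx hxr
  -- The choice `cl ≥ 20` exceeds the `8 · 1.72 + 0.001 + 1` needed here.
  have hexp : Real.exp (degree cs n + l * (Real.exp 1 - 1) - cl * Real.log n) ≤ 1 / n := by
    have e : (1 : ℝ) / n = Real.exp (-Real.log n) := by
      rw [Real.exp_neg, Real.exp_log (by linarith), one_div]
    rw [e]
    refine Real.exp_le_exp.2 ?_
    have h1 := h.degree_le
    have h2 : l * (Real.exp 1 - 1) ≤ 8 * Real.log n * 1.72 := by
      have := Real.exp_one_lt_d9
      have := Real.exp_one_gt_d9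
      exact mul_le_mul hl8 (by linarith) (by linarith) (by positivity)
    nlinarith
  have c1 : coeffBound cl n * x * Real.exp (degree cs n + l * (Real.exp 1 - 1) - cl * Real.log n)
      ≤ coeffBound cl n * x * (1 / n) :=
    mul_le_mul_of_nonneg_left hexp (mul_nonneg h.coeffBound_nonneg hx.le)
  -- Rounding the degree down loses at most a factor `2`, hence `8 = 2 · 2²`.
  have c2 : 2 * (r⁻¹ * (1 / (degree cs n : ℝ) ^ 2)) ≤ 8 * cl / (cs ^ 2 * (n * Real.log n)) := by
    have hcs := h.cs_pos
    have hlog := h.log_pos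
    have hd := h.half_le_degree
    have h1 : 1 / (degree cs n : ℝ) ^ 2 ≤ 1 / (cs * Real.log n / 2) ^ 2 := by gcongr
    calc 2 * (r⁻¹ * (1 / (degree cs n : ℝ) ^ 2))
        ≤ 2 * (r⁻¹ * (1 / (cs * Real.log n / 2) ^ 2)) := by gcongr
      _ = _ := by rw [hrinv]; field_simp; ring
  have c3 : min 1 ((ampSize ε n - 1) * x) ≤ min 1 (ampSize ε n * x) := by
    refine min_le_min le_rfl ?_
    gcongr
    linarith
  have c4 : 0 ≤ min 1 ((ampSize ε n - 1) * x) :=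
    le_min zero_le_one (mul_nonneg (by linarith) hx.le)
  have c5 : 0 ≤ 8 * cl / (cs ^ 2 * (n * Real.log n)) := by
    have := h.log_pos
    positivity
  have b3 := b2.trans (mul_le_mul c2 c3 c4 c5)
  exact (abs_sub_le _ _ _).trans (add_le_add (b1.trans c1) b3)

/-- Since `log A ≤ log n + log log n`, the bracket is at most `0.6 log n`. The constant `3/4` leaves
`1/4` for the polynomial approximation, so that the total constant in front of `1/(ε n)` is exactly
`1`. -/
theorem log_ampSize_bound (h : Regime cl cs ε n) :
    (ampSize ε n - 1)⁻¹ * (Real.log (ampSize ε n) / 2 + 3 / 4) ≤ 3 / 4 * (1 / (ε * n)) := by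
  have hε := h.eps_pos
  have hn := h.four_le
  have hL := h.log_ge
  have hA := h.le_ampSize
  have hεn : 0 < ε * n := mul_pos hε (by linarith)
  have h1 : Real.log (ampSize ε n) ≤ Real.log n + Real.log (Real.log n) := by
    rw [← Real.log_mul (by linarith) (by linarith)]
    exact Real.log_le_log (by linarith) h.ampSize_le
  have h2 : Real.log (Real.log n) ≤ Real.log n / 10 + 2 := by
    have h3 := Real.log_le_sub_one_of_pos (by linarith : 0 < Real.log n / 10)
    rw [Real.log_div (by linarith) (by norm_num)] at h3
    have h4 : Real.log 10 ≤ 3 := by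
      rw [Real.log_le_iff_le_exp (by norm_num)]
      have h1 := Real.exp_one_gt_d9
      have h2 : Real.exp 3 = Real.exp 1 ^ 3 := by rw [← Real.exp_nat_mul]; norm_num
      rw [h2]
      calc (10 : ℝ) ≤ 2.7 ^ 3 := by norm_num
        _ ≤ _ := pow_le_pow_left₀ (by norm_num) (by linarith) 3
    linarith
  have h5 : 4 ≤ ε * n * Real.log n := by
    have := h.le_ampSize
    rw [ampSize] at this
    linarith
  rw [inv_mul_le_iff₀ (by linarith), mul_one_div, mul_div_assoc', le_div_iff₀ hεn]
  have h6 : Real.log (ampSize ε n) / 2 + 3 / 4 ≤ Real.log n * 0.6 := by linarith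
  calc (Real.log (ampSize ε n) / 2 + 3 / 4) * (ε * n) ≤ Real.log n * 0.6 * (ε * n) := by gcongr
    _ ≤ (ampSize ε n - 1) * (3 / 4) := by
        rw [ampSize]
        have : 100 * (ε * n) ≤ Real.log n * (ε * n) := by gcongr
        have h7 : (100 : ℝ) ≤ ε * n * Real.log n := by
          have h8 := h.le_ampSize
          rw [ampSize] at h8
          have h9 := h.cl_log_le
          have h10 := h.cl_ge
          nlinarith
        linarith

end Regime

/-- The mean of the estimate of `h(p_i)`, for a symbol with Poisson rate `l`. -/
noncomputable def symbolMean (cl cs ε : ℝ) (n : ℕ) (l : NNReal) : ℝ :=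
  ∫ q : ℕ × ℕ, symbolEstimator cl cs ε n q.1 q.2 ∂((poissonMeasure l).prod (poissonMeasure l))

theorem integral_poissonMeasure_zero (f : ℕ → ℝ) : ∫ N, f N ∂(poissonMeasure 0) = f 0 := by
  rw [integral_poissonMeasure, tsum_eq_single 0]
  · simp
  · intro b hb
    simp [hb]

namespace Regime

variable {cl cs ε : ℝ} {n : ℕ}

theorem symbolMean_eq (h : Regime cl cs ε n) (l : NNReal) : symbolMean cl cs ε n l =
    smallProb ε l * ∫ N, cutEstimator cl cs ε n N ∂(poissonMeasure l) +
      (1 - smallProb ε l) * ∫ N : ℕ, Real.negMulLog ((N : ℝ) / n) ∂(poissonMeasure l) :=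
  (integral_comp_symbolEstimator cl cs ε n l id (h.integral_cutEstimator_bounds l).1
    ((memLp_negMulLog_poisson h.n_pos).integrable (by norm_num))).2

theorem memLp_symbolEstimator (h : Regime cl cs ε n) (l : NNReal) :
    MemLp (fun q : ℕ × ℕ => symbolEstimator cl cs ε n q.1 q.2) 2
      ((poissonMeasure l).prod (poissonMeasure l)) := by
  rw [memLp_two_iff_integrable_sq (Measurable.of_discrete).aestronglyMeasurable]
  exact (integral_comp_symbolEstimator cl cs ε n l (fun t => t ^ 2)
    (h.integral_cutEstimator_bounds l).2.1 (memLp_negMulLog_poisson h.n_pos).integrable_sq).1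

theorem integral_symbolEstimator_sub_sq (h : Regime cl cs ε n) (l : NNReal) (c : ℝ) :
    ∫ q : ℕ × ℕ, (symbolEstimator cl cs ε n q.1 q.2 - c) ^ 2
        ∂((poissonMeasure l).prod (poissonMeasure l)) =
      smallProb ε l * ∫ N, (cutEstimator cl cs ε n N - c) ^ 2 ∂(poissonMeasure l) +
        (1 - smallProb ε l) *
          ∫ N : ℕ, (Real.negMulLog ((N : ℝ) / n) - c) ^ 2 ∂(poissonMeasure l) := by
  have hc : MemLp (fun N => cutEstimator cl cs ε n N) 2 (poissonMeasure l) :=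
    (memLp_two_iff_integrable_sq (Measurable.of_discrete).aestronglyMeasurable).2
      (h.integral_cutEstimator_bounds l).2.1
  exact (integral_comp_symbolEstimator cl cs ε n l (fun t => (t - c) ^ 2)
    (hc.sub (memLp_const c)).integrable_sq
    ((memLp_negMulLog_poisson h.n_pos).sub (memLp_const c)).integrable_sq).2

theorem cutEstimator_zero (h : Regime cl cs ε n) : cutEstimator cl cs ε n 0 = 0 := by
  have := h.abs_cutEstimator_le 0
  simpa using this

/-- Both means lie in `[h(x) - 1/n, h(x)]`. -/
theorem abs_plugin_sub_empiricalMean_le (h : Regime cl cs ε n) {k m : ℕ} {p : PMF (Fin k)} {i : Fin k} {l : NNReal}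
    (hm : |(m : ℝ) - ampSize ε n| < 1) (hx : 0 < (p i).toReal) (hl : (l : ℝ) = n * (p i).toReal) :
    |∫ N : ℕ, Real.negMulLog ((N : ℝ) / n) ∂(poissonMeasure l) - empiricalMean p m i| ≤ 1 / n := by
  have hn := h.four_le
  have hA := h.le_ampSize
  rw [abs_lt] at hm
  have hmn : n ≤ m := by
    have : (n : ℝ) < m + 1 := by linarith
    exact Nat.lt_succ_iff.1 (by exact_mod_cast this)
  have hmR : (n : ℝ) ≤ m := by exact_mod_cast hmn
  have hm0 : 0 < m := lt_of_lt_of_le h.n_pos hmn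
  have h1 := integral_negMulLog_poisson_le h.n_pos hx hl
  have h2 := le_integral_negMulLog_poisson h.n_pos hx hl
  have h3 := empiricalMean_le_negMulLog (p := p) (i := i) hm0 hx
  have h4 := (negMulLog_sub_le hx (by positivity : 0 ≤ 1 / (m : ℝ))).trans
    (le_empiricalMean (p := p) (i := i) hm0 hx)
  have h5 : 1 / (m : ℝ) ≤ 1 / n := one_div_le_one_div_of_le (by linarith) hmR
  rw [abs_le]
  constructor <;> linarith

/-- The mean is a mixture of the cut-off and the plug-in means with weights `π` and `1 - π`, so the
bias is at most the mixture of the two biases. For rates above `8 log n` the weight `π` is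
negligible and `1/n ≤ x`; below, the cut-off bias is governed by `ampPrimitive`. -/
theorem abs_symbolMean_sub_le (h : Regime cl cs ε n) {k m : ℕ} {p : PMF (Fin k)} {i : Fin k}
    (hm : |(m : ℝ) - ampSize ε n| < 1) (hx : 0 < (p i).toReal) :
    |symbolMean cl cs ε n (rate p n i) - empiricalMean p m i| ≤
      min ((1 + (8 * cl / cs ^ 2 + 1) * ε) * (p i).toReal) (1 / (ε * n))
        + (p i).toReal * ((coeffBound cl n + 2) / n) := by
  set l := rate p n i
  set x := (p i).toReal with hxdef
  set B := empiricalMean p m i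
  set S := ∫ N, cutEstimator cl cs ε n N ∂(poissonMeasure l)
  set P := ∫ N : ℕ, Real.negMulLog ((N : ℝ) / n) ∂(poissonMeasure l)
  set π := smallProb ε l
  have hl : (l : ℝ) = n * x := coe_rate p n i
  have hε := h.eps_pos
  have hε1 := h.eps_le
  have hn := h.four_le
  have hn0 : (0 : ℝ) < n := by linarith
  have hL := h.log_ge
  have hcl := h.cl_ge
  have hcs := h.cs_pos
  have hW := h.coeffBound_nonneg
  have hA := h.le_ampSize
  have hx1 : x ≤ 1 := ENNReal.toReal_le_of_le_ofReal zero_le_one (by simpa using p.coe_le_one i)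
  have hπ0 : 0 ≤ π := smallProb_nonneg ε l
  have hπ1 : π ≤ 1 := smallProb_le_one ε l
  have hn4 : 4 ≤ n := by exact_mod_cast hn
  have hPB : |P - B| ≤ 1 / n := h.abs_plugin_sub_empiricalMean_le hm hx hl
  have hinv : 1 / (n : ℝ) ≤ 1 / (ε * n) :=
    one_div_le_one_div_of_le (by positivity) (mul_le_of_le_one_left hn0.le hε1)
  have key : |symbolMean cl cs ε n l - B| ≤ π * |S - B| + (1 - π) * |P - B| := by
    have e : symbolMean cl cs ε n l - B = π * (S - B) + (1 - π) * (P - B) := by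
      rw [h.symbolMean_eq l]; ring
    rw [e]
    refine (abs_add_le _ _).trans (le_of_eq ?_)
    rw [abs_mul, abs_mul, abs_of_nonneg hπ0, abs_of_nonneg (by linarith : 0 ≤ 1 - π)]
  refine key.trans ?_
  have hτ : x * ((coeffBound cl n + 2) / n) = coeffBound cl n * x * (1 / n) + x * (2 / n) := by ring
  rw [hτ]
  have hWx : 0 ≤ coeffBound cl n * x * (1 / n) := by positivity
  have hx2 : 0 ≤ x * (2 / n) := by positivity
  rcases le_total (8 * Real.log n) l with hl8 | hl8
  · have hB0 : 0 ≤ B := empiricalMean_nonneg p i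
    have hB1 : B ≤ 1 := by
      have hm0 : 0 < m := by
        rw [abs_lt] at hm
        exact_mod_cast (by linarith : (0 : ℝ) < m)
      have h1 := empiricalMean_le_negMulLog (p := p) (i := i) hm0 hx
      have h2 := negMulLog_le_tangent one_pos hx.le
      rw [Real.log_one] at h2
      linarith
    have hS : |S| ≤ coeffBound cl n * x := by
      have := (h.integral_cutEstimator_bounds l).2.2.1
      rwa [hl, mul_div_cancel_left₀ _ hn0.ne'] at this
    have hSB : |S - B| ≤ coeffBound cl n * x + 1 := by
      refine (abs_sub _ _).trans ?_
      rw [abs_of_nonneg hB0]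
      linarith
    have hlx : 1 / n ≤ x := by
      rw [div_le_iff₀ hn0]
      linarith
    have hπ := h.smallProb_le hl8
    have hπn : π ≤ 1 / n * (1 / n) := by
      refine hπ.trans ?_
      rw [one_div_mul_one_div, ← sq]
      exact one_div_le_one_div_of_le (by positivity) (pow_le_pow_right₀ (by linarith) (by norm_num))
    have hπn' : π ≤ 1 / n := by
      refine hπn.trans ?_
      refine mul_le_of_le_one_right (by positivity) ?_
      rw [div_le_one hn0]
      linarith
    have h1 : π * |S - B| ≤ coeffBound cl n * x * (1 / n) + x * (2 / n) := by
      calc π * |S - B| ≤ π * (coeffBound cl n * x + 1) := by gcongr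
        _ = coeffBound cl n * x * π + π := by ring
        _ ≤ coeffBound cl n * x * (1 / n) + 1 / n * (1 / n) := by gcongr
        _ ≤ coeffBound cl n * x * (1 / n) + x * (1 / n) := by gcongr
        _ ≤ _ := by
          have : x * (1 / n) ≤ x * (2 / n) := by gcongr; norm_num
          linarith
    have h2 : (1 - π) * |P - B| ≤ 1 / n := by
      calc (1 - π) * |P - B| ≤ 1 * (1 / n) := by gcongr; linarith
        _ = _ := one_mul _
    have h3 : 1 / (n : ℝ) ≤ min ((1 + (8 * cl / cs ^ 2 + 1) * ε) * x) (1 / (ε * n)) := by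
      refine le_min (hlx.trans ?_) hinv
      have : 0 ≤ (8 * cl / cs ^ 2 + 1) * ε * x := by positivity
      linarith
    linarith
  · have hS := h.abs_integral_cutEstimator_sub_le hx hl hl8
    have hG1 := abs_ampPrimitive_sub_empiricalMean_le hn4 hA hm hx
    have hG2 := (abs_ampPrimitive_sub_empiricalMean_le' hn4 hA hm hx).trans
      (add_le_add_left h.log_ampSize_bound _)
    rw [← hxdef] at hG1 hG2
    have hSB := abs_sub_le S (ampPrimitive (ampSize ε n) x) B
    have hlogp := h.log_pos
    have hc0 : 0 ≤ 8 * cl / (cs ^ 2 * (n * Real.log n)) := by positivity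
    -- The two entries of the minimum serve the two bounds: one is linear in `x`, the other free of
    -- `x`.
    have d1 : 8 * cl / (cs ^ 2 * (n * Real.log n)) * min 1 (ampSize ε n * x) ≤
        8 * cl / cs ^ 2 * ε * x := by
      calc _ ≤ 8 * cl / (cs ^ 2 * (n * Real.log n)) * (ampSize ε n * x) := by
            gcongr; exact min_le_right _ _
        _ = _ := by rw [ampSize]; field_simp
    have d2 : 8 * cl / (cs ^ 2 * (n * Real.log n)) * min 1 (ampSize ε n * x) ≤
        1 / 4 * (1 / (ε * n)) := by
      calc _ ≤ 8 * cl / (cs ^ 2 * (n * Real.log n)) * 1 := by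
            gcongr; exact min_le_left _ _
        _ = 32 * cl / cs ^ 2 / Real.log n * (1 / 4 * (1 / n)) := by field_simp; ring
        _ ≤ 1 * (1 / 4 * (1 / n)) := by
            gcongr
            exact (div_le_one hlogp).2 h.log_ge'
        _ ≤ _ := by linarith
    have a1 : |S - B| ≤ (1 + 8 * cl / cs ^ 2 * ε) * x
        + (coeffBound cl n * x * (1 / n) + x * (2 / n)) := by linarith
    have a2 : |S - B| ≤ 1 / (ε * n) + (coeffBound cl n * x * (1 / n) + x * (2 / n)) := by linarith
    -- Responsible for the summand `1` in `8 * cl / cs ^ 2 + 1`.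
    have hρ : (1 - π) * |P - B| ≤ ε * x := by
      have h1 := one_sub_smallProb_le hε l
      rw [hl] at h1
      calc (1 - π) * |P - B| ≤ ε * (n * x) * (1 / n) :=
            mul_le_mul h1 hPB (abs_nonneg _) (by positivity)
        _ = ε * x := by field_simp
    have hρ' : (1 - π) * |P - B| ≤ (1 - π) * (1 / (ε * n)) :=
      mul_le_mul_of_nonneg_left (hPB.trans hinv) (by linarith)
    rw [min_add]
    refine le_min ?_ ?_
    · have h1 : π * |S - B| ≤ (1 + 8 * cl / cs ^ 2 * ε) * x
          + (coeffBound cl n * x * (1 / n) + x * (2 / n)) :=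
        (mul_le_of_le_one_left (abs_nonneg _) hπ1).trans a1
      linarith
    -- Both biases are at most `1/(ε n)` up to the remainder, and so is their convex combination;
    -- adding them without weights would lose the constant `1`.
    · have h1 := mul_le_mul_of_nonneg_left a2 hπ0
      have h2 : π * (coeffBound cl n * x * (1 / n) + x * (2 / n)) ≤
          coeffBound cl n * x * (1 / n) + x * (2 / n) :=
        mul_le_of_le_one_left (by linarith) hπ1
      linarith

/-- Linearity in `x` is what allows summation over the symbols. For small rates raw second moments
are small enough, so the centre is `0`. For large rates the centre is `h(x)`, around which the
plug-in value concentrates, and the cut-off branch has weight at most `x/n`. -/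
theorem exists_integral_sub_sq_le (h : Regime cl cs ε n) {l : NNReal} {x : ℝ} (hx : 0 < x) (hx1 : x ≤ 1)
    (hl : (l : ℝ) = n * x) :
    ∃ c : ℝ, ∫ q : ℕ × ℕ, (symbolEstimator cl cs ε n q.1 q.2 - c) ^ 2
        ∂((poissonMeasure l).prod (poissonMeasure l)) ≤
      x * ((2 * coeffBound cl n ^ 2 * (cl * Real.log n) + 2000 * Real.log n ^ 3) / n) := by
  set L := Real.log n
  set W := coeffBound cl n
  have hn := h.four_le
  have hn0 : (0 : ℝ) < n := by linarith
  have hL : 100 ≤ L := h.log_ge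
  have hcl := h.cl_ge
  have hπ0 := smallProb_nonneg ε l
  have hπ1 := smallProb_le_one ε l
  obtain ⟨hi1, hi2, -, hS2⟩ := h.integral_cutEstimator_bounds l
  have hS2' : ∫ N, cutEstimator cl cs ε n N ^ 2 ∂(poissonMeasure l) ≤ x * (W ^ 2 * (cl * L) / n) := by
    refine hS2.trans (le_of_eq ?_)
    change W ^ 2 * (cl * L) * l / n ^ 2 = _
    rw [hl]
    field_simp
  have hV0 : 0 ≤ x * (W ^ 2 * (cl * L) / n) := by positivity
  rcases le_total (l : ℝ) (8 * L) with hl8 | hl8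
  · refine ⟨0, ?_⟩
    rw [h.integral_symbolEstimator_sub_sq]
    simp only [sub_zero]
    have h1 := integral_negMulLog_sq_poisson_le (l := l) h.n_pos
    have h2 : 2 / (n : ℝ) ^ 2 * (L ^ 2 * ((l : ℝ) ^ 2 + l)
        + ((l : ℝ) ^ 4 + 6 * (l : ℝ) ^ 3 + 7 * (l : ℝ) ^ 2 + l)) ≤ x * (2000 * L ^ 3 / n) := by
      have hl0 : (0 : ℝ) ≤ l := l.coe_nonneg
      have b : L ^ 2 * ((l : ℝ) + 1) + ((l : ℝ) ^ 3 + 6 * (l : ℝ) ^ 2 + 7 * (l : ℝ) + 1)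
          ≤ 1000 * L ^ 3 := by
        calc _ ≤ L ^ 2 * (8 * L + 1) + ((8 * L) ^ 3 + 6 * (8 * L) ^ 2 + 7 * (8 * L) + 1) := by
              gcongr
          _ ≤ _ := by nlinarith [pow_pos (by linarith : 0 < L) 2, mul_nonneg (sub_nonneg.2 hL) (pow_pos (by linarith : 0 < L) 2).le]
      calc _ = 2 / (n : ℝ) ^ 2 * (l * (L ^ 2 * ((l : ℝ) + 1)
            + ((l : ℝ) ^ 3 + 6 * (l : ℝ) ^ 2 + 7 * (l : ℝ) + 1))) := by ring
        _ ≤ 2 / (n : ℝ) ^ 2 * (l * (1000 * L ^ 3)) := by gcongr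
        _ = _ := by rw [hl]; field_simp; ring
    have h3 := (mul_le_of_le_one_left (integral_nonneg fun N => sq_nonneg _) hπ1).trans hS2'
    have h4 := (mul_le_of_le_one_left (integral_nonneg fun N => sq_nonneg _)
      (by linarith : 1 - smallProb ε l ≤ 1)).trans (h1.trans h2)
    have e : x * ((2 * W ^ 2 * (cl * L) + 2000 * L ^ 3) / n)
        = 2 * (x * (W ^ 2 * (cl * L) / n)) + x * (2000 * L ^ 3 / n) := by ring
    rw [e]
    linarith
  · refine ⟨Real.negMulLog x, ?_⟩
    rw [h.integral_symbolEstimator_sub_sq]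
    have hnx : 1 ≤ n * x := by rw [← hl]; linarith
    have hlx : 1 / n ≤ x := by rw [div_le_iff₀ hn0]; linarith
    have h1 := integral_negMulLog_sub_sq_poisson_le h.n_pos hx hl hnx
    -- From `1/n ≤ x ≤ 1`.
    have hlog : |Real.log x| ≤ L := by
      rw [abs_of_nonpos (Real.log_nonpos hx.le hx1)]
      have := Real.log_le_log (by positivity) hlx
      rw [one_div, Real.log_inv] at this
      linarith
    have h2 : x / n * (2 * (1 + |Real.log x|) ^ 2 + 8) ≤ x * (1000 * L ^ 3 / n) := by
      have b : 2 * (1 + |Real.log x|) ^ 2 + 8 ≤ 1000 * L ^ 3 := by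
        calc _ ≤ 2 * (1 + L) ^ 2 + 8 := by gcongr
          _ ≤ _ := by nlinarith [pow_pos (by linarith : 0 < L) 2, mul_nonneg (sub_nonneg.2 hL) (pow_pos (by linarith : 0 < L) 2).le]
      calc _ ≤ x / n * (1000 * L ^ 3) := by gcongr
        _ = _ := by ring
    have hh0 := Real.negMulLog_nonneg hx.le hx1
    have hh1 : Real.negMulLog x ≤ 1 := by
      have h2 := negMulLog_le_tangent one_pos hx.le
      rw [Real.log_one] at h2
      linarith
    have h3 : ∫ N, (cutEstimator cl cs ε n N - Real.negMulLog x) ^ 2 ∂(poissonMeasure l) ≤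
        2 * (x * (W ^ 2 * (cl * L) / n)) + 2 := by
      have hi3 : Integrable (fun N => 2 * cutEstimator cl cs ε n N ^ 2 + 2) (poissonMeasure l) :=
        (hi2.const_mul 2).add (integrable_const 2)
      refine (integral_mono_of_nonneg (Filter.Eventually.of_forall fun N => sq_nonneg _) hi3
        (Filter.Eventually.of_forall fun N => ?_)).trans ?_
      · have : Real.negMulLog x ^ 2 ≤ 1 := pow_le_one₀ hh0 hh1
        simp only
        nlinarith [sq_nonneg (cutEstimator cl cs ε n N + Real.negMulLog x)]
      · rw [integral_add (hi2.const_mul 2) (integrable_const 2), integral_const_mul]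
        simp only [integral_const, probReal_univ, one_smul]
        linarith
    have hπ := h.smallProb_le hl8
    have hπn : smallProb ε l ≤ x * (1 / n) := by
      refine hπ.trans ?_
      calc 1 / (n : ℝ) ^ 4 ≤ 1 / (n : ℝ) ^ 2 :=
            one_div_le_one_div_of_le (by positivity)
              (pow_le_pow_right₀ (by linarith) (by norm_num))
        _ = 1 / n * (1 / n) := by rw [one_div_mul_one_div, ← sq]
        _ ≤ _ := by gcongr
    have h4 := mul_le_mul_of_nonneg_left h3 hπ0
    have h5 := mul_le_of_le_one_left hV0 hπ1
    have h6 := (mul_le_of_le_one_left (integral_nonneg fun N => sq_nonneg _)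
      (by linarith : 1 - smallProb ε l ≤ 1)).trans (h1.trans h2)
    have h7 : 2 * (x * (1 / n)) ≤ x * (1000 * L ^ 3 / n) := by
      have b : 2 ≤ 1000 * L ^ 3 := by
        have : 1 ≤ L ^ 3 := one_le_pow₀ (by linarith)
        linarith
      calc 2 * (x * (1 / n)) = x * (2 / n) := by ring
        _ ≤ _ := by gcongr
    have e : x * ((2 * W ^ 2 * (cl * L) + 2000 * L ^ 3) / n)
        = 2 * (x * (W ^ 2 * (cl * L) / n)) + 2 * (x * (1000 * L ^ 3 / n)) := by ring
    rw [e]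
    linarith

end Regime

/-! ### The error of the estimator -/

theorem supportSize_eq_card {k : ℕ} (p : PMF (Fin k)) :
    supportSize p = (Finset.univ.filter fun i => 0 < (p i).toReal).card := by
  rw [supportSize, ← Set.ncard_coe_finset]
  congr 1
  ext i
  rw [PMF.mem_support_iff]
  simp only [Finset.coe_filter, Finset.mem_univ, true_and, Set.mem_ofPred_eq]
  rw [ENNReal.toReal_pos_iff]
  exact ⟨fun hi => ⟨pos_iff_ne_zero.2 hi, p.apply_lt_top i⟩, fun hi => hi.1.ne'⟩

namespace Regime

variable {cl cs ε : ℝ} {n : ℕ}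

theorem symbolMean_zero (h : Regime cl cs ε n) : symbolMean cl cs ε n 0 = 0 := by
  rw [h.symbolMean_eq, integral_poissonMeasure_zero, integral_poissonMeasure_zero,
    h.cutEstimator_zero]
  simp

theorem integral_sq_zero (h : Regime cl cs ε n) : ∫ q : ℕ × ℕ, (symbolEstimator cl cs ε n q.1 q.2 - 0) ^ 2
    ∂((poissonMeasure 0).prod (poissonMeasure 0)) = 0 := by
  rw [h.integral_symbolEstimator_sub_sq, integral_poissonMeasure_zero,
    integral_poissonMeasure_zero, h.cutEstimator_zero]
  simp

/-- Symbols of probability zero have both means equal to zero, so the constant bound is counted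
`S_p` times and not `k` times. -/
theorem sum_abs_symbolMean_sub_le (h : Regime cl cs ε n) {k m : ℕ} (p : PMF (Fin k))
    (hm : |(m : ℝ) - ampSize ε n| < 1) :
    ∑ i, |symbolMean cl cs ε n (rate p n i) - empiricalMean p m i| ≤
      min (1 + (8 * cl / cs ^ 2 + 1) * ε) ((supportSize p : ℝ) / (ε * n))
        + (coeffBound cl n + 2) / n := by
  have hsupp : ∀ i, ¬ 0 < (p i).toReal →
      |symbolMean cl cs ε n (rate p n i) - empiricalMean p m i| = 0 := by
    intro i hi
    have hx0 : (p i).toReal = 0 := le_antisymm (not_lt.1 hi) ENNReal.toReal_nonneg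
    have hr0 : rate p n i = 0 := by
      have := coe_rate p n i
      rw [hx0, mul_zero] at this
      exact_mod_cast this
    have h1 := empiricalMean_le_mul_log (m := m) p i
    rw [hx0, zero_mul] at h1
    rw [hr0, h.symbolMean_zero, le_antisymm h1 (empiricalMean_nonneg p i)]
    simp
  set s := Finset.univ.filter fun i => 0 < (p i).toReal with hs
  have h1 : ∑ i, |symbolMean cl cs ε n (rate p n i) - empiricalMean p m i|
      = ∑ i ∈ s, |symbolMean cl cs ε n (rate p n i) - empiricalMean p m i| := by
    rw [hs, Finset.sum_filter]
    refine Finset.sum_congr rfl fun i _ => ?_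
    split_ifs with hi
    · rfl
    · exact hsupp i hi
  have hsum : ∑ i ∈ s, (p i).toReal = 1 := by
    rw [← sum_toReal_pmf p, hs, Finset.sum_filter]
    refine Finset.sum_congr rfl fun i _ => ?_
    split_ifs with hi
    · rfl
    · exact (le_antisymm (not_lt.1 hi) ENNReal.toReal_nonneg).symm
  rw [h1]
  refine (Finset.sum_le_sum fun i hi =>
    h.abs_symbolMean_sub_le hm (Finset.mem_filter.1 hi).2).trans ?_
  rw [Finset.sum_add_distrib, ← Finset.sum_mul, hsum, one_mul]
  gcongr
  refine le_min ?_ ?_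
  · refine (Finset.sum_le_sum fun i _ => min_le_left _ _).trans (le_of_eq ?_)
    rw [← Finset.mul_sum, hsum, mul_one]
  · refine (Finset.sum_le_sum fun i _ => min_le_right _ _).trans (le_of_eq ?_)
    rw [Finset.sum_const, nsmul_eq_mul, supportSize_eq_card, mul_one_div]

/-- The one-symbol variances `p_i V` add up to `V`, and the bias passes through the mean of the
empirical estimator. -/
theorem estimatorLoss_le (h : Regime cl cs ε n) {k m : ℕ} (p : PMF (Fin k)) (hm : |(m : ℝ) - ampSize ε n| < 1) :
    Integrable (fun z => entropyEstimator cl cs ε n z - entropy p) (pairLaw p n) ∧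
      estimatorLoss cl cs ε p n ≤ empiricalLoss p m
        + (min (1 + (8 * cl / cs ^ 2 + 1) * ε) ((supportSize p : ℝ) / (ε * n))
          + ((coeffBound cl n + 2) / n + √((2 * coeffBound cl n ^ 2 * (cl * Real.log n)
            + 2000 * Real.log n ^ 3) / n))) := by
  set V := (2 * coeffBound cl n ^ 2 * (cl * Real.log n) + 2000 * Real.log n ^ 3) / (n : ℝ)
  have hvar : ∀ i, ∃ c : ℝ, ∫ q : ℕ × ℕ, (symbolEstimator cl cs ε n q.1 q.2 - c) ^ 2
      ∂((poissonMeasure (rate p n i)).prod (poissonMeasure (rate p n i))) ≤ (p i).toReal * V := by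
    intro i
    rcases (ENNReal.toReal_nonneg (a := p i)).eq_or_lt with hx | hx
    · refine ⟨0, ?_⟩
      have hr0 : rate p n i = 0 := by
        have := coe_rate p n i
        rw [← hx, mul_zero] at this
        exact_mod_cast this
      rw [hr0, h.integral_sq_zero, ← hx, zero_mul]
    · exact h.exists_integral_sub_sq_le hx
        (ENNReal.toReal_le_of_le_ofReal zero_le_one (by simpa using p.coe_le_one i))
        (coe_rate p n i)
  choose c hc using hvar
  have hmain := integral_abs_sum_sub_le
    (fun i => (poissonMeasure (rate p n i)).prod (poissonMeasure (rate p n i)))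
    (fun q : ℕ × ℕ => symbolEstimator cl cs ε n q.1 q.2) Measurable.of_discrete
    (fun i => h.memLp_symbolEstimator (rate p n i)) (entropy p) c (fun i => (p i).toReal * V) hc
  rw [← Finset.sum_mul, sum_toReal_pmf, one_mul] at hmain
  have hmp := measurePreserving_count_pair p n
  have hmeas : Measurable fun ω : Fin k → ℕ × ℕ =>
      ∑ i, symbolEstimator cl cs ε n (ω i).1 (ω i).2 - entropy p :=
    (Finset.measurable_sum _ fun i _ => (Measurable.of_discrete (f := fun q : ℕ × ℕ =>
      symbolEstimator cl cs ε n q.1 q.2)).comp (measurable_pi_apply i)).sub_const _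
  refine ⟨hmp.integrable_comp_of_integrable hmain.1, ?_⟩
  have hloss : estimatorLoss cl cs ε p n = ∫ ω : Fin k → ℕ × ℕ,
      |∑ i, symbolEstimator cl cs ε n (ω i).1 (ω i).2 - entropy p| ∂(Measure.pi fun i =>
        (poissonMeasure (rate p n i)).prod (poissonMeasure (rate p n i))) := by
    rw [← hmp.map_eq, integral_map hmp.measurable.aemeasurable hmeas.abs.aestronglyMeasurable]
    rfl
  rw [hloss]
  refine hmain.2.trans ?_
  have h1 : |∑ i, symbolMean cl cs ε n (rate p n i) - entropy p| ≤
      ∑ i, |symbolMean cl cs ε n (rate p n i) - empiricalMean p m i| + empiricalLoss p m := by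
    refine (abs_sub_le _ (∑ i, empiricalMean p m i) _).trans (add_le_add ?_
      (abs_sum_empiricalMean_sub_entropy_le p m))
    rw [← Finset.sum_sub_distrib]
    exact Finset.abs_sum_le_sum_abs _ _
  have h2 := h.sum_abs_symbolMean_sub_le p hm
  change √V + |∑ i, symbolMean cl cs ε n (rate p n i) - entropy p| ≤ _
  linarith

end Regime

/-! ### The parameter range for large `n` -/

/-- Both the bias remainder and the standard deviation are at most `n^(-0.495)`, and the factor `2`
is absorbed by `n^0.005`. The constant `72 cl³` is `2 · (6 cl)² · cl`, from the second moment of the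
cut-off estimator. -/
theorem remainder_le {cl : ℝ} (hcl : 20 ≤ cl) {n : ℕ} (hn : 1 ≤ (n : ℝ)) (hL : 1 ≤ Real.log n)
    (h2 : 2 ≤ (n : ℝ) ^ (0.005 : ℝ))
    (hK : (72 * cl ^ 3 + 2000) * Real.log n ^ 5 ≤ (n : ℝ) ^ (0.004 : ℝ)) :
    (coeffBound cl n + 2) / n + √((2 * coeffBound cl n ^ 2 * (cl * Real.log n)
      + 2000 * Real.log n ^ 3) / n) ≤ 1 / (n : ℝ) ^ (0.49 : ℝ) := by
  have hn0 : (0 : ℝ) < n := by linarith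
  set L := Real.log n
  have hmono : ∀ {a b : ℝ}, a ≤ b → (n : ℝ) ^ a ≤ (n : ℝ) ^ b := fun hab =>
    Real.rpow_le_rpow_of_exponent_le hn hab
  have hone : ∀ {a : ℝ}, 0 ≤ a → 1 ≤ (n : ℝ) ^ a := fun ha => Real.one_le_rpow hn ha
  have hcl2 : 6 * cl ≤ 72 * cl ^ 3 + 2000 := by nlinarith [pow_pos (by linarith : 0 < cl) 2]
  have hW : coeffBound cl n ≤ (n : ℝ) ^ (0.007 : ℝ) := by
    have : 6 * cl * L ^ 2 ≤ (n : ℝ) ^ (0.004 : ℝ) := by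
      refine le_trans ?_ hK
      exact mul_le_mul hcl2 (pow_le_pow_right₀ hL (by norm_num)) (by positivity) (by positivity)
    calc coeffBound cl n = 6 * cl * L ^ 2 * (n : ℝ) ^ (0.003 : ℝ) := rfl
      _ ≤ (n : ℝ) ^ (0.004 : ℝ) * (n : ℝ) ^ (0.003 : ℝ) := by gcongr
      _ = _ := by rw [← Real.rpow_add hn0]; norm_num
  have hτ : (coeffBound cl n + 2) / n ≤ (n : ℝ) ^ (-0.495 : ℝ) := by
    have h1 : coeffBound cl n + 2 ≤ (n : ℝ) ^ (0.505 : ℝ) := by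
      calc coeffBound cl n + 2 ≤ (n : ℝ) ^ (0.007 : ℝ) + (n : ℝ) ^ (0.007 : ℝ) :=
            add_le_add hW (h2.trans (hmono (by norm_num)))
        _ = 2 * (n : ℝ) ^ (0.007 : ℝ) := by ring
        _ ≤ (n : ℝ) ^ (0.005 : ℝ) * (n : ℝ) ^ (0.007 : ℝ) := by gcongr
        _ = (n : ℝ) ^ (0.012 : ℝ) := by rw [← Real.rpow_add hn0]; norm_num
        _ ≤ _ := hmono (by norm_num)
    rw [div_le_iff₀ hn0]
    refine h1.trans (le_of_eq ?_)
    nth_rewrite 3 [← Real.rpow_one (n : ℝ)]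
    rw [← Real.rpow_add hn0]
    norm_num
  have hV : √((2 * coeffBound cl n ^ 2 * (cl * L) + 2000 * L ^ 3) / n) ≤
      (n : ℝ) ^ (-0.495 : ℝ) := by
    refine Real.sqrt_le_iff.2 ⟨by positivity, ?_⟩
    rw [div_le_iff₀ hn0]
    have e1 : ((n : ℝ) ^ (-0.495 : ℝ)) ^ 2 * n = (n : ℝ) ^ (0.01 : ℝ) := by
      rw [← Real.rpow_natCast, ← Real.rpow_mul hn0.le]
      nth_rewrite 2 [← Real.rpow_one (n : ℝ)]
      rw [← Real.rpow_add hn0]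
      norm_num
    have e2 : 2 * coeffBound cl n ^ 2 * (cl * L)
        = 72 * cl ^ 3 * L ^ 5 * (n : ℝ) ^ (0.006 : ℝ) := by
      have : ((n : ℝ) ^ (0.003 : ℝ)) ^ 2 = (n : ℝ) ^ (0.006 : ℝ) := by
        rw [← Real.rpow_natCast, ← Real.rpow_mul hn0.le]; norm_num
      rw [coeffBound, ← this]
      change 2 * (6 * cl * L ^ 2 * (n : ℝ) ^ (0.003 : ℝ)) ^ 2 * (cl * L) = _
      ring
    have e3 : 2000 * L ^ 3 ≤ 2000 * L ^ 5 * (n : ℝ) ^ (0.006 : ℝ) := by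
      calc 2000 * L ^ 3 ≤ 2000 * L ^ 5 :=
            mul_le_mul_of_nonneg_left (pow_le_pow_right₀ hL (by norm_num)) (by norm_num)
        _ ≤ _ := le_mul_of_one_le_right (by positivity) (hone (by norm_num))
    rw [e1, e2]
    calc 72 * cl ^ 3 * L ^ 5 * (n : ℝ) ^ (0.006 : ℝ) + 2000 * L ^ 3
        ≤ (72 * cl ^ 3 + 2000) * L ^ 5 * (n : ℝ) ^ (0.006 : ℝ) := by linarith
      _ ≤ (n : ℝ) ^ (0.004 : ℝ) * (n : ℝ) ^ (0.006 : ℝ) := by gcongr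
      _ = _ := by rw [← Real.rpow_add hn0]; norm_num
  calc _ ≤ (n : ℝ) ^ (-0.495 : ℝ) + (n : ℝ) ^ (-0.495 : ℝ) := add_le_add hτ hV
    _ = 2 * (n : ℝ) ^ (-0.495 : ℝ) := by ring
    _ ≤ (n : ℝ) ^ (0.005 : ℝ) * (n : ℝ) ^ (-0.495 : ℝ) := by gcongr
    _ = 1 / (n : ℝ) ^ (0.49 : ℝ) := by
        rw [← Real.rpow_add hn0, one_div, ← Real.rpow_neg hn0.le]; norm_num

theorem eventually_large (cl M : ℝ) : ∀ᶠ n : ℕ in Filter.atTop,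
    1 ≤ (n : ℝ) ∧ M ≤ Real.log n ∧ cl * Real.log n ≤ n ∧ 2 ≤ (n : ℝ) ^ (0.005 : ℝ) ∧
      (72 * cl ^ 3 + 2000) * Real.log n ^ 5 ≤ (n : ℝ) ^ (0.004 : ℝ) := by
  have hlittle : ∀ (K r : ℝ) (j : ℕ), 0 < r →
      ∀ᶠ x : ℝ in Filter.atTop, K * Real.log x ^ j ≤ x ^ r := by
    intro K r j hr
    have ho := isLittleO_log_rpow_rpow_atTop (j : ℝ) hr
    filter_upwards [ho.bound (by positivity : 0 < (|K| + 1)⁻¹), Filter.eventually_ge_atTop 1]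
      with x hx hx1
    have hL := Real.log_nonneg hx1
    have hxr : 0 ≤ x ^ r := Real.rpow_nonneg (by linarith) r
    rw [Real.rpow_natCast, Real.norm_of_nonneg (pow_nonneg hL j), Real.norm_of_nonneg hxr,
      inv_mul_eq_div, le_div_iff₀ (by positivity)] at hx
    calc K * Real.log x ^ j ≤ (|K| + 1) * Real.log x ^ j :=
          mul_le_mul_of_nonneg_right (by linarith [le_abs_self K]) (pow_nonneg hL j)
      _ ≤ x ^ r := by linarith
  have hreal : ∀ᶠ x : ℝ in Filter.atTop, 1 ≤ x ∧ M ≤ Real.log x ∧ cl * Real.log x ≤ x ∧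
      2 ≤ x ^ (0.005 : ℝ) ∧ (72 * cl ^ 3 + 2000) * Real.log x ^ 5 ≤ x ^ (0.004 : ℝ) := by
    filter_upwards [Filter.eventually_ge_atTop 1,
      Real.tendsto_log_atTop.eventually_ge_atTop M, hlittle cl 1 1 one_pos,
      (tendsto_rpow_atTop (by norm_num : (0 : ℝ) < 0.005)).eventually_ge_atTop 2,
      hlittle (72 * cl ^ 3 + 2000) 0.004 5 (by norm_num)] with x h1 h2 h3 h4 h5
    exact ⟨h1, h2, by simpa using h3, h4, h5⟩
  exact tendsto_natCast_atTop_atTop.eventually hreal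

end EntropyAmp

theorem theorem6 :
    ∃ cl₀ cs₀ : ℝ, 0 < cl₀ ∧ 0 < cs₀ ∧
      ∀ cl cs : ℝ, cl₀ ≤ cl → 0 < cs → cs ≤ cs₀ →
        ∃ (c : ℝ) (n₀ : ℕ), ∀ n : ℕ, n₀ ≤ n →
          ∀ ε : ℝ, ε ≤ 1 → 1 ≤ ε * Real.log n →
            ∀ (k : ℕ) (p : PMF (Fin k)) (m : ℕ), |(m : ℝ) - ε * n * Real.log n| < 1 →
              MeasureTheory.Integrable
                  (fun z => EntropyAmp.entropyEstimator cl cs ε n z - EntropyAmp.entropy p)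
                  (EntropyAmp.pairLaw p n) ∧
                EntropyAmp.estimatorLoss cl cs ε p n ≤
                  EntropyAmp.empiricalLoss p m +
                    min (1 + c * ε)
                      ((EntropyAmp.supportSize p : ℝ) / (ε * n) + 1 / (n : ℝ) ^ (0.49 : ℝ)) := by
  -- `20` makes the mass beyond the cutoff negligible at rates up to `8 log n`; `1/1000` keeps the
  -- coefficient growth below `n^0.003`.
  refine ⟨20, 1 / 1000, by norm_num, by norm_num, fun cl cs hcl hcs hcs' => ?_⟩
  obtain ⟨n₀, hn₀⟩ := Filter.eventually_atTop.1
    (EntropyAmp.eventually_large cl (max 100 (max (2 / cs) (32 * cl / cs ^ 2))))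
  -- The bias supplies `8 * cl / cs ^ 2 + 1`; one more unit absorbs the remainder in the first entry
  -- of the minimum.
  refine ⟨8 * cl / cs ^ 2 + 2, n₀, fun n hn ε hε hεL k p m hm => ?_⟩
  obtain ⟨hn1, hM, hcln, h2, hK⟩ := hn₀ n hn
  have hL : 100 ≤ Real.log n := (le_max_left _ _).trans hM
  have hM' := (le_max_right _ _).trans hM
  have hregime : EntropyAmp.Regime cl cs ε n :=
    { cl_ge := hcl
      cs_pos := hcs
      cs_le := hcs'
      eps_le := hε
      eps_log := hεL
      log_ge := hL
      cs_log := by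
        have := (le_max_left _ _).trans hM'
        rw [div_le_iff₀ hcs] at this
        linarith
      log_ge' := (le_max_right _ _).trans hM'
      cl_log_le := hcln }
  obtain ⟨hinteg, hloss⟩ := hregime.estimatorLoss_le p hm
  refine ⟨hinteg, hloss.trans ?_⟩
  have hrem := EntropyAmp.remainder_le hcl hn1 (by linarith) h2 hK
  have hn0 : (0 : ℝ) < n := by linarith
  -- Since `ε ≥ 1 / log n`, the remainder is at most `ε`.
  have hremε : 1 / (n : ℝ) ^ (0.49 : ℝ) ≤ ε := by
    have h3 : Real.log n ≤ (n : ℝ) ^ (0.49 : ℝ) := by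
      calc Real.log n ≤ Real.log n ^ 5 := le_self_pow₀ (by linarith) (by norm_num)
        _ ≤ (72 * cl ^ 3 + 2000) * Real.log n ^ 5 := by
            refine le_mul_of_one_le_left (by positivity) ?_
            have : 0 ≤ 72 * cl ^ 3 := by positivity
            linarith
        _ ≤ (n : ℝ) ^ (0.004 : ℝ) := hK
        _ ≤ _ := Real.rpow_le_rpow_of_exponent_le hn1 (by norm_num)
    calc 1 / (n : ℝ) ^ (0.49 : ℝ) ≤ 1 / Real.log n :=
          one_div_le_one_div_of_le (by linarith) h3
      _ ≤ ε := by rw [div_le_iff₀ (by linarith)]; exact hεL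
  refine add_le_add le_rfl (le_min ?_ ?_)
  · refine (add_le_add (min_le_left _ _) (hrem.trans hremε)).trans (le_of_eq ?_)
    ring
  · exact add_le_add (min_le_right _ _) hrem
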